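/- Conventions. Cube complexes whose fundamental group is mentioned are connected; "compact" means having finitely many cubes. A cube complex is nonpositively curved if the link of each vertex is a flag simplicial complex. A combinatorial map $Y\to X$ of nonpositively curved cube complexes is a local isometry if it maps the link of each vertex $y$ injectively onto a full subcomplex of the link of the image of $y$. A nonpositively curved cube complex is special (Haglund–Wise) if its hyperplanes are two-sided and embedded, no hyperplane directly self-osculates, and no two hyperplanes inter-osculate. Let $G$ be a group and $\Omega=\{G_\lambda\}_{\lambda\in\Lambda}$ a collection of subgroups. Then $(G,\Omega)$ has finite stature if for each $H\in\Omega$ there are finitely many $H$-conjugacy classes of infinite subgroups of the form $H\cap C$, where $C$ is an intersection of (possibly infinitely many) $G$-conjugates of elements of $\Omega$. A graph of nonpositively curved cube complexes consists of a graph $\Gamma$, connected nonpositively curved cube complexes $X_v$ (vertex spaces) and $X_e$ (edge spaces) for the vertices $v$ and edges $e$ of $\Gamma$, and local isometries (attaching maps) $X_e\to X_{\iota(e)}$ and $X_e\to X_{\tau(e)}$; its total space $X$ is obtained from the disjoint union of the $X_v$ and the $X_e\times[-1,1]$ by gluing $X_e\times\{-1\}$ and $X_e\times\{1\}$ to $X_{\iota(e)}$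 and $X_{\tau(e)}$ by the attaching maps. Vertex groups and edge groups are the subgroups $\pi_1X_v$ and $\pi_1X_e$ of $\pi_1X$, which are defined up to conjugacy. A subgroup of $G$ is separable if it is an intersection of finite index subgroups of $G$. 1. Let $X$ be a compact nonpositively curved cube complex that has a finite special cover, and let $\{f_i:A_i\to X\}_{i=1}^n$ be local isometries with each $A_i$ a compact nonpositively curved cube complex. Then $(\pi_1X,\{\pi_1A_i\}_{i=1}^n)$ has finite stature. 2. Let $X$ be the total space of a graph of nonpositively curved cube complexes, with $X$ compact and connected. Suppose that each vertex space is special and that each attaching map of an edge space to a vertex space is an embedding. Then $\pi_1X$ has finite stature with respect to its vertex groups. 3. Let $X$ be the total space of a graph of nonpositively curved cube complexes, with $X$ compact and connected. Suppose that each vertex space is special and that each edge group is separable in $\pi_1X$. Then $\pi_1X$ has finite stature with respect to its vertex groups. -/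

import Mathlib

open CategoryTheory

universe u

/-! ### Combinatorial cubes and cube complexes -/

/-- A coordinate of a map out of the combinatorial `m`-cube `{0,1}^m`: either constantly `b`, or the
`i`-th coordinate `x i`, flipped when `s = true` (that is, `x ↦ xor (x i) s`). -/
inductive Coord (m : ℕ) : Type
  | const (b : Bool) : Coord m
  | var (i : Fin m) (s : Bool) : Coord m

/-- Substitute the coordinates of a map `{0,1}^m → {0,1}^n` in a coordinate on `{0,1}^n`. -/
def Coord.subst {m n : ℕ} (f : Fin n → Coord m) : Coord n → Coord m
  | .const b => .const b
  | .var i s =>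
    match f i with
    | .const b => .const (xor b s)
    | .var k t => .var k (xor t s)

/-- The isometric inclusions of the `m`-cube onto an `m`-dimensional subcube of the `n`-cube: each
coordinate of the target is constant or a possibly flipped coordinate of the source, and each
coordinate of the source is used exactly once. For `m = n` these are the symmetries of the cube. -/
@[ext]
structure CubeMap (m n : ℕ) : Type where
  coord : Fin n → Coord m
  used : ∀ i : Fin m, ∃! j : Fin n, ∃ s : Bool, coord j = .var i s

namespace CubeMap

/-- The identity of the `n`-cube. -/
def id (n : ℕ) : CubeMap n n where
  coord i := .var i false
  used i := ⟨i, ⟨false, rfl⟩, by rintro j ⟨s, h⟩; cases h; rfl⟩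

/-- Composition of subcube inclusions, `f` first. -/
def comp {m n p : ℕ} (g : CubeMap n p) (f : CubeMap m n) : CubeMap m p where
  coord j := (g.coord j).subst f.coord
  used i := by
    obtain ⟨k, ⟨s, hs⟩, hk⟩ := f.used i
    obtain ⟨j, ⟨t, ht⟩, hj⟩ := g.used k
    refine ⟨j, ⟨xor s t, by simp [ht, Coord.subst, hs]⟩, ?_⟩
    rintro j' ⟨s', h'⟩
    cases hc : g.coord j' with
    | const b => simp [hc, Coord.subst] at h'
    | var k' t' =>
      cases hc' : f.coord k' with
      | const b => simp [hc, Coord.subst, hc'] at h'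
      | var i' t'' =>
        simp only [hc, Coord.subst, hc', Coord.var.injEq] at h'
        obtain ⟨rfl, -⟩ := h'
        obtain rfl := hk k' ⟨t'', hc'⟩
        exact hj j' ⟨t', hc⟩

/-- The vertex `b` of the `n`-cube. -/
def vertex {n : ℕ} (b : Fin n → Bool) : CubeMap 0 n where
  coord j := .const (b j)
  used i := i.elim0

/-- The edge of the `n`-cube in direction `i` whose other coordinates are those of `b`; it is
oriented from the end with `i`-th coordinate `0` to the end with `i`-th coordinate `1`. -/
def axis {n : ℕ} (i : Fin n) (b : Fin n → Bool) : CubeMap 1 n where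
  coord j := if j = i then .var 0 false else .const (b j)
  used k := by
    refine ⟨i, ⟨false, by simp [Subsingleton.elim k 0]⟩, ?_⟩
    rintro j ⟨s, h⟩
    by_contra hne
    simp [hne] at h

/-- The flip of the interval. -/
def flip : CubeMap 1 1 where
  coord _ := .var 0 true
  used i := ⟨0, ⟨true, by rw [Subsingleton.elim i 0]⟩, fun j _ => Subsingleton.elim j 0⟩

end CubeMap

/-- A cube complex, presented by its parametrized cubes: `cube n` is the set of `n`-cubes of the
complex together with an isometric parametrization by the standard `n`-cube, and `face f c` is the
restriction of `c` along the subcube inclusion `f`. Each `n`-cell of the complex thus gives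
`2 ^ n * n !` elements of `cube n`, and `free` says that these are distinct, that is, that no cube is
glued to itself by a nontrivial symmetry (so open cubes embed). -/
structure CubeComplex : Type (u + 1) where
  cube : ℕ → Type u
  face : ∀ {m n : ℕ}, CubeMap m n → cube n → cube m
  face_id : ∀ {n : ℕ} (c : cube n), face (CubeMap.id n) c = c
  face_comp : ∀ {m n p : ℕ} (g : CubeMap n p) (f : CubeMap m n) (c : cube p),
    face (g.comp f) c = face f (face g c)
  free : ∀ {n : ℕ} (f : CubeMap n n) (c : cube n), face f c = c → f = CubeMap.id n

namespace CubeComplex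

/-- The `0`-cubes. -/
def Vertex (X : CubeComplex.{u}) : Type u := X.cube 0

/-- The initial vertex of an oriented edge. -/
def src (X : CubeComplex.{u}) (a : X.cube 1) : X.Vertex :=
  X.face (CubeMap.vertex fun _ => false) a

/-- The terminal vertex of an oriented edge. -/
def tgt (X : CubeComplex.{u}) (a : X.cube 1) : X.Vertex :=
  X.face (CubeMap.vertex fun _ => true) a

/-- The same edge with the opposite orientation. -/
def rev (X : CubeComplex.{u}) (a : X.cube 1) : X.cube 1 := X.face CubeMap.flip a

/-- The corner `(0,…,0)` of a parametrized cube. -/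
def corner (X : CubeComplex.{u}) {n : ℕ} (c : X.cube n) : X.Vertex :=
  X.face (CubeMap.vertex fun _ => false) c

/-- The `i`-th edge at the corner `(0,…,0)` of a parametrized cube, oriented away from it. -/
def cornerEdge (X : CubeComplex.{u}) {n : ℕ} (c : X.cube n) (i : Fin n) : X.cube 1 :=
  X.face (CubeMap.axis i fun _ => false) c

/-- The edge of a parametrized square parallel to `cornerEdge c i`, on the opposite side. -/
def oppositeEdge (X : CubeComplex.{u}) (c : X.cube 2) (i : Fin 2) : X.cube 1 :=
  X.face (CubeMap.axis i fun _ => true) c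

/-- The oriented edges `a`, `b` are the two edges at a corner of a square, i.e. they are adjacent
vertices of the link of their common initial vertex. -/
def SpanSquare (X : CubeComplex.{u}) (a b : X.cube 1) : Prop :=
  ∃ c : X.cube 2, X.cornerEdge c 0 = a ∧ X.cornerEdge c 1 = b

/-- Compactness: there are finitely many cubes. -/
def IsCompact (X : CubeComplex.{u}) : Prop := Finite (Σ n, X.cube n)

/-- Nonpositive curvature: the link of each vertex `x` is a flag simplicial complex. The vertices of
the link are the oriented edges starting at `x`, its simplices are the corners of cubes at `x`. -/
structure IsNonpositivelyCurved (X : CubeComplex.{u}) : Prop where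
  /-- The vertices of a simplex of the link are distinct. -/
  no_loop : ∀ c : X.cube 2, X.cornerEdge c 0 ≠ X.cornerEdge c 1
  /-- Pairwise adjacent vertices of the link span exactly one simplex. -/
  flag : ∀ (x : X.Vertex) (n : ℕ) (a : Fin n → X.cube 1), (∀ i, X.src (a i) = x) →
    (∀ i j, i ≠ j → X.SpanSquare (a i) (a j)) →
    ∃! c : X.cube n, X.corner c = x ∧ ∀ i, X.cornerEdge c i = a i

/-- Parallelism of oriented edges: the equivalence relation generated by identifying opposite edges
of squares. Hyperplanes correspond to parallelism classes of unoriented edges (the edges dual to the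
hyperplane). -/
def Parallel (X : CubeComplex.{u}) : X.cube 1 → X.cube 1 → Prop :=
  Relation.EqvGen fun a b => ∃ (c : X.cube 2) (i : Fin 2), a = X.cornerEdge c i ∧ b = X.oppositeEdge c i

/-- Special cube complexes in the sense of Haglund and Wise. -/
structure IsSpecial (X : CubeComplex.{u}) : Prop where
  nonpositivelyCurved : X.IsNonpositivelyCurved
  /-- Hyperplanes are two-sided. -/
  two_sided : ∀ a, ¬ X.Parallel a (X.rev a)
  /-- Hyperplanes are embedded: none crosses itself. -/
  embedded : ∀ a b, X.SpanSquare a b → ¬ X.Parallel a b ∧ ¬ X.Parallel a (X.rev b)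
  /-- No hyperplane directly self-osculates: each side of the carrier of a hyperplane embeds. -/
  no_self_osculation : ∀ a b, X.src a = X.src b → X.Parallel a b → a = b
  /-- No two hyperplanes inter-osculate: edges at a vertex that are dual to two crossing
  hyperplanes span a square. -/
  no_inter_osculation : ∀ a b a' b', X.SpanSquare a b → X.Parallel a a' → X.Parallel b b' →
    X.src a' = X.src b' → X.SpanSquare a' b'

/-! ### Fundamental groups -/

/-- The vertices and oriented edges form a quiver. -/
instance (X : CubeComplex.{u}) : Quiver.{u} X.Vertex where
  Hom x y := {a : X.cube 1 // X.src a = x ∧ X.tgt a = y}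

/-- `X` is nonempty and any two vertices are joined by an edge path. -/
def IsConnected (X : CubeComplex.{u}) : Prop :=
  Nonempty X.Vertex ∧ ∀ x y : X.Vertex, Nonempty (Quiver.Path x y)

/-- The elementary homotopies of edge paths: removing a backtrack, and pushing across a square. -/
inductive ElementaryHomotopy (X : CubeComplex.{u}) : HomRel (Paths X.Vertex)
  | backtrack {x y : X.Vertex} (a : x ⟶ y) (b : y ⟶ x) (h : b.1 = X.rev a.1) :
      @ElementaryHomotopy X x x (a.toPath.comp b.toPath) Quiver.Path.nil
  | square {x y y' z : X.Vertex} (c : X.cube 2) (a : x ⟶ y) (b : y ⟶ z) (a' : x ⟶ y') (b' : y' ⟶ z)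
      (ha : a.1 = X.cornerEdge c 0) (hb : b.1 = X.oppositeEdge c 1)
      (ha' : a'.1 = X.cornerEdge c 1) (hb' : b'.1 = X.oppositeEdge c 0) :
      @ElementaryHomotopy X x z (a.toPath.comp b.toPath) (a'.toPath.comp b'.toPath)

/-- The fundamental groupoid: edge paths up to the congruence generated by elementary homotopies. -/
abbrev FundGroupoid (X : CubeComplex.{u}) : Type u := CategoryTheory.Quotient X.ElementaryHomotopy

/-- A vertex as a point of the fundamental groupoid. -/
def pt (X : CubeComplex.{u}) (x : X.Vertex) : X.FundGroupoid := ⟨x⟩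

/-- The fundamental group at `x`: homotopy classes of closed edge paths at `x`. Every morphism of the
fundamental groupoid is invertible because of the backtracks. -/
abbrev Pi1 (X : CubeComplex.{u}) (x : X.Vertex) : Type u := Aut (X.pt x)

/-- Homotopy classes of edge paths from `x` to `y`. -/
abbrev PathClass (X : CubeComplex.{u}) (x y : X.Vertex) : Type u := X.pt x ≅ X.pt y

end CubeComplex

/-! ### Combinatorial maps -/

/-- A combinatorial map: it maps `n`-cubes isometrically to `n`-cubes, compatibly with faces. -/
structure CubicalMap (Y X : CubeComplex.{u}) : Type u where
  toFun : ∀ {n : ℕ}, Y.cube n → X.cube n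
  map_face : ∀ {m n : ℕ} (f : CubeMap m n) (c : Y.cube n), toFun (Y.face f c) = X.face f (toFun c)

namespace CubicalMap

variable {Y X Z : CubeComplex.{u}}

/-- Composition of combinatorial maps, `f` first. -/
def comp (g : CubicalMap X Z) (f : CubicalMap Y X) : CubicalMap Y Z where
  toFun c := g.toFun (f.toFun c)
  map_face h c := by rw [f.map_face, g.map_face]

/-- The map on vertices. -/
def onVertex (f : CubicalMap Y X) (y : Y.Vertex) : X.Vertex := f.toFun (n := 0) y

/-- An embedding: injective on cubes. -/
def IsEmbedding (f : CubicalMap Y X) : Prop :=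
  ∀ n : ℕ, Function.Injective (f.toFun : Y.cube n → X.cube n)

/-- A local isometry: on links it is injective with full image. -/
structure IsLocalIsometry (f : CubicalMap Y X) : Prop where
  link_injective : ∀ a b : Y.cube 1, Y.src a = Y.src b → f.toFun a = f.toFun b → a = b
  link_full : ∀ (y : Y.Vertex) (n : ℕ) (a : Fin n → Y.cube 1), (∀ i, Y.src (a i) = y) →
    (∃ c : X.cube n, X.corner c = f.onVertex y ∧ ∀ i, X.cornerEdge c i = f.toFun (a i)) →
    ∃ d : Y.cube n, Y.corner d = y ∧ ∀ i, Y.cornerEdge d i = a i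

/-- A covering map of finite degree: onto, finite fibres, and bijective on the cubes at each
vertex. -/
structure IsFiniteCover (f : CubicalMap Y X) : Prop where
  surjective : Function.Surjective f.onVertex
  finite_fiber : ∀ x : X.Vertex, {y : Y.Vertex | f.onVertex y = x}.Finite
  lift_unique : ∀ (y : Y.Vertex) (n : ℕ) (c : X.cube n), X.corner c = f.onVertex y →
    ∃! d : Y.cube n, Y.corner d = y ∧ f.toFun d = c

/-- The map of quivers of vertices and oriented edges. -/
def toPrefunctor (f : CubicalMap Y X) : Y.Vertex ⥤q X.Vertex where
  obj := f.onVertex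
  map a := ⟨f.toFun a.1,
    (f.map_face _ _).symm.trans (congrArg f.onVertex a.2.1),
    (f.map_face _ _).symm.trans (congrArg f.onVertex a.2.2)⟩

/-- The induced functor on edge paths up to homotopy. -/
def onGroupoid (f : CubicalMap Y X) : Y.FundGroupoid ⥤ X.FundGroupoid :=
  CategoryTheory.Quotient.lift _
    (Paths.lift (f.toPrefunctor ⋙q Paths.of X.Vertex) ⋙
      CategoryTheory.Quotient.functor X.ElementaryHomotopy) (by
    intro x y p q h
    apply CategoryTheory.Quotient.sound
    cases h with
    | backtrack a b h =>
      refine CubeComplex.ElementaryHomotopy.backtrack (f.toPrefunctor.map a)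
        (f.toPrefunctor.map b) ?_
      change f.toFun b.1 = X.rev (f.toFun a.1)
      rw [h]; exact f.map_face _ _
    | square c a b a' b' ha hb ha' hb' =>
      refine CubeComplex.ElementaryHomotopy.square (f.toFun c) (f.toPrefunctor.map a)
        (f.toPrefunctor.map b) (f.toPrefunctor.map a') (f.toPrefunctor.map b') ?_ ?_ ?_ ?_
      · change f.toFun a.1 = _; rw [ha]; exact f.map_face _ _
      · change f.toFun b.1 = _; rw [hb]; exact f.map_face _ _
      · change f.toFun a'.1 = _; rw [ha']; exact f.map_face _ _
      · change f.toFun b'.1 = _; rw [hb']; exact f.map_face _ _)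

/-- The induced homomorphism of fundamental groups. -/
def onPi1 (f : CubicalMap Y X) (y : Y.Vertex) : Y.Pi1 y →* X.Pi1 (f.onVertex y) :=
  f.onGroupoid.mapAut (Y.pt y)

/-- The subgroup `π₁ Y` of `π₁ (X, x)`, where the base points are joined by the path `γ`. -/
def subgroup (f : CubicalMap Y X) (y : Y.Vertex) {x : X.Vertex} (γ : X.PathClass (f.onVertex y) x) :
    Subgroup (X.Pi1 x) :=
  (f.onPi1 y).range.map γ.conjAut.toMonoidHom

end CubicalMap

/-- `X` has a finite cover that is special. -/
def CubeComplex.IsVirtuallySpecial (X : CubeComplex.{u}) : Prop :=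
  ∃ (Y : CubeComplex.{u}) (p : CubicalMap Y X), Y.IsConnected ∧ p.IsFiniteCover ∧ Y.IsSpecial

/-! ### Group theory -/

/-- A subgroup is separable if it is an intersection of finite index subgroups. -/
def Subgroup.IsSeparable {G : Type u} [Group G] (H : Subgroup G) : Prop :=
  ∀ g : G, g ∉ H → ∃ K : Subgroup G, K.FiniteIndex ∧ H ≤ K ∧ g ∉ K

/-- The conjugate `g H g⁻¹`. -/
def Subgroup.conjBy {G : Type u} [Group G] (g : G) (H : Subgroup G) : Subgroup G :=
  H.map (MulAut.conj g).toMonoidHom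

/-- `(G, Ω)` has finite stature: for each `H ∈ Ω` there are finitely many `H`-conjugacy classes of
infinite subgroups of the form `H ∩ C` with `C` an intersection of (possibly infinitely many)
`G`-conjugates of members of `Ω`. -/
def HasFiniteStature {G : Type u} [Group G] {Λ : Type*} (Ω : Λ → Subgroup G) : Prop :=
  ∀ l : Λ, ∃ F : Set (Subgroup G), F.Finite ∧
    ∀ S : Set (Λ × G), Infinite ↥(Ω l ⊓ ⨅ p ∈ S, (Ω p.1).conjBy p.2) →
      ∃ K ∈ F, ∃ h ∈ Ω l, Ω l ⊓ ⨅ p ∈ S, (Ω p.1).conjBy p.2 = K.conjBy h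

/-! ### Graphs of cube complexes -/

/-- A graph of nonpositively curved cube complexes. The edge `e` of the underlying graph goes from
`endpoint false e` to `endpoint true e`; vertex and edge spaces are connected and nonpositively
curved, and attaching maps are local isometries. -/
structure GraphOfCubeComplexes : Type (u + 1) where
  V : Type u
  E : Type u
  endpoint : Bool → E → V
  vertexSpace : V → CubeComplex.{u}
  edgeSpace : E → CubeComplex.{u}
  attach : ∀ (b : Bool) (e : E), CubicalMap (edgeSpace e) (vertexSpace (endpoint b e))
  vertexSpace_connected : ∀ v, (vertexSpace v).IsConnected
  edgeSpace_connected : ∀ e, (edgeSpace e).IsConnected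
  vertexSpace_npc : ∀ v, (vertexSpace v).IsNonpositivelyCurved
  edgeSpace_npc : ∀ e, (edgeSpace e).IsNonpositivelyCurved
  attach_localIsometry : ∀ b e, (attach b e).IsLocalIsometry

namespace CubeMap

/-- Forget the coordinate `j` of the target, on which the map is constant. -/
def eraseConst {m n : ℕ} (f : CubeMap m (n + 1)) (j : Fin (n + 1)) (b : Bool)
    (h : f.coord j = .const b) : CubeMap m n where
  coord k := f.coord (j.succAbove k)
  used i := by
    obtain ⟨k, ⟨s, hs⟩, hk⟩ := f.used i
    have hkj : k ≠ j := by rintro rfl; rw [h] at hs; cases hs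
    obtain ⟨k', rfl⟩ := Fin.exists_succAbove_eq hkj
    exact ⟨k', ⟨s, hs⟩, fun j' h' => Fin.succAbove_right_injective (hk _ h')⟩

/-- Rewrite a coordinate that does not involve `x i` in terms of the remaining coordinates. -/
def lower {m : ℕ} (i : Fin (m + 1)) : Coord (m + 1) → Coord m
  | .const b => .const b
  | .var k s =>
    match finSuccEquiv' i k with
    | none => .const s
    | some k' => .var k' s

theorem lower_succAbove {m : ℕ} (i : Fin (m + 1)) (k : Fin m) (s : Bool) :
    lower i (.var (i.succAbove k) s) = .var k s := by
  simp [lower]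

/-- Forget the coordinate `j` of the target and the coordinate `i` of the source, where the `j`-th
coordinate of the map is the possibly flipped `i`-th coordinate. -/
def eraseVar {m n : ℕ} (f : CubeMap (m + 1) (n + 1)) (j : Fin (n + 1)) (i : Fin (m + 1)) (t : Bool)
    (h : f.coord j = .var i t) : CubeMap m n where
  coord k := lower i (f.coord (j.succAbove k))
  used l := by
    obtain ⟨k, ⟨s, hs⟩, hk⟩ := f.used (i.succAbove l)
    have hkj : k ≠ j := by
      rintro rfl
      rw [h] at hs
      exact Fin.succAbove_ne i l (Coord.var.inj hs).1.symm
    obtain ⟨k', rfl⟩ := Fin.exists_succAbove_eq hkj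
    refine ⟨k', ⟨s, by simp only [hs, lower_succAbove]⟩, ?_⟩
    rintro j' ⟨s', h'⟩
    apply Fin.succAbove_right_injective (p := j)
    apply hk
    cases hc : f.coord (j.succAbove j') with
    | const b => simp [hc, lower] at h'
    | var q r =>
      by_cases hq : q = i
      · subst hq
        simp [hc, lower] at h'
      · obtain ⟨q', rfl⟩ := Fin.exists_succAbove_eq hq
        simp only [hc, lower_succAbove, Coord.var.injEq] at h'
        exact ⟨r, by rw [h'.1]⟩

end CubeMap

namespace GraphOfCubeComplexes

/-- The parametrized cubes of the total space: those of the vertex spaces, and those of the thickened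
edge spaces `X_e × [-1,1]` that are not contained in `X_e × {±1}`. The latter are products of an
`n`-cube `c` of `X_e` and the interval: in `thick e j s c` the interval coordinate is the `j`-th
coordinate, flipped when `s = true`, and `c` is parametrized by the other coordinates in order. The
value `false` of the interval coordinate is the end `-1`, and `true` is the end `1`. -/
inductive TotalCube (𝒢 : GraphOfCubeComplexes.{u}) : ℕ → Type u
  | vert {n : ℕ} (v : 𝒢.V) (c : (𝒢.vertexSpace v).cube n) : TotalCube 𝒢 n
  | thick {n : ℕ} (e : 𝒢.E) (j : Fin (n + 1)) (s : Bool) (c : (𝒢.edgeSpace e).cube n) :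
      TotalCube 𝒢 (n + 1)

variable (𝒢 : GraphOfCubeComplexes.{u})

/-- The cube `c × {b}` of a thickened edge space, glued to a vertex space by the attaching map. -/
def glued {m : ℕ} (e : 𝒢.E) (b : Bool) (c : (𝒢.edgeSpace e).cube m) : 𝒢.TotalCube m :=
  .vert (𝒢.endpoint b e) ((𝒢.attach b e).toFun c)

/-- The face along `f` of `thick e j s c`, according to the `j`-th coordinate `q` of `f`. -/
def thickFace {n : ℕ} (e : 𝒢.E) (j : Fin (n + 1)) (s : Bool) (c : (𝒢.edgeSpace e).cube n) :
    ∀ {m : ℕ} (f : CubeMap m (n + 1)) (q : Coord m), f.coord j = q → 𝒢.TotalCube m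
  | _, f, .const b, h => 𝒢.glued e (xor b s) ((𝒢.edgeSpace e).face (f.eraseConst j b h) c)
  | 0, _, .var i _, _ => i.elim0
  | _ + 1, f, .var i t, h => .thick e i (xor t s) ((𝒢.edgeSpace e).face (f.eraseVar j i t h) c)

/-- Faces of cubes of the total space. -/
def totalFace {m n : ℕ} (f : CubeMap m n) : 𝒢.TotalCube n → 𝒢.TotalCube m
  | .vert v c => .vert v ((𝒢.vertexSpace v).face f c)
  | .thick e j s c => 𝒢.thickFace e j s c f (f.coord j) rfl

theorem totalFace_thick {m n : ℕ} (f : CubeMap m (n + 1)) (e : 𝒢.E) (j : Fin (n + 1)) (s : Bool)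
    (c : (𝒢.edgeSpace e).cube n) (q : Coord m) (h : f.coord j = q) :
    𝒢.totalFace f (.thick e j s c) = 𝒢.thickFace e j s c f q h := by
  subst h; rfl

theorem totalFace_glued {m n : ℕ} (f : CubeMap m n) (e : 𝒢.E) (b : Bool)
    (c : (𝒢.edgeSpace e).cube n) :
    𝒢.totalFace f (𝒢.glued e b c) = 𝒢.glued e b ((𝒢.edgeSpace e).face f c) := by
  simp only [glued, totalFace, (𝒢.attach b e).map_face]

theorem totalFace_id {n : ℕ} (c : 𝒢.TotalCube n) : 𝒢.totalFace (CubeMap.id n) c = c := by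
  cases c with
  | vert v c => simp only [totalFace, CubeComplex.face_id]
  | @thick n e j s c =>
    rw [𝒢.totalFace_thick _ e j s c (.var j false) rfl]
    have : (CubeMap.id (n + 1)).eraseVar j j false rfl = CubeMap.id n := by
      ext1; funext k
      exact CubeMap.lower_succAbove j k false
    simp only [thickFace, this, CubeComplex.face_id, Bool.false_xor]

theorem totalFace_comp {m n p : ℕ} (g : CubeMap n p) (f : CubeMap m n) (c : 𝒢.TotalCube p) :
    𝒢.totalFace (g.comp f) c = 𝒢.totalFace f (𝒢.totalFace g c) := by
  cases c with
  | vert v c => simp only [totalFace, CubeComplex.face_comp]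
  | @thick p e j s c =>
    cases hg : g.coord j with
    | const b =>
      have hgf : (g.comp f).coord j = .const b := by simp [CubeMap.comp, hg, Coord.subst]
      rw [𝒢.totalFace_thick _ e j s c _ hgf, 𝒢.totalFace_thick _ e j s c _ hg]
      simp only [thickFace, totalFace_glued, ← CubeComplex.face_comp]
      rfl
    | var i t =>
      obtain _ | n := n
      · exact i.elim0
      rw [𝒢.totalFace_thick g e j s c _ hg]
      simp only [thickFace]
      have key : ∀ k, (∃ b, g.coord (j.succAbove k) = .const b) ∨
          ∃ q w, g.coord (j.succAbove k) = .var (i.succAbove q) w := by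
        intro k
        cases hk : g.coord (j.succAbove k) with
        | const b => exact .inl ⟨b, rfl⟩
        | var q r =>
          have hq : q ≠ i := by
            rintro rfl
            exact Fin.succAbove_ne j k ((g.used q).unique ⟨r, hk⟩ ⟨t, hg⟩)
          obtain ⟨q', rfl⟩ := Fin.exists_succAbove_eq hq
          exact .inr ⟨q', r, rfl⟩
      cases hf : f.coord i with
      | const b =>
        have hgf : (g.comp f).coord j = .const (xor b t) := by
          simp [CubeMap.comp, hg, Coord.subst, hf]
        rw [𝒢.totalFace_thick _ e j s c _ hgf, 𝒢.totalFace_thick f e i _ _ _ hf]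
        simp only [thickFace, ← CubeComplex.face_comp, Bool.xor_assoc]
        congr 2
        ext1; funext k
        obtain ⟨d, hd⟩ | ⟨q, w, hd⟩ := key k
        · simp [CubeMap.eraseConst, CubeMap.comp, CubeMap.eraseVar, hd, CubeMap.lower, Coord.subst]
        · simp [CubeMap.eraseConst, CubeMap.comp, CubeMap.eraseVar, hd, CubeMap.lower_succAbove,
            Coord.subst]
      | var l r =>
        obtain _ | m := m
        · exact l.elim0
        have hgf : (g.comp f).coord j = .var l (xor r t) := by
          simp [CubeMap.comp, hg, Coord.subst, hf]
        rw [𝒢.totalFace_thick _ e j s c _ hgf, 𝒢.totalFace_thick f e i _ _ _ hf]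
        simp only [thickFace, ← CubeComplex.face_comp, Bool.xor_assoc]
        congr 2
        ext1; funext k
        obtain ⟨d, hd⟩ | ⟨q, w, hd⟩ := key k
        · simp [CubeMap.comp, CubeMap.eraseVar, hd, CubeMap.lower, Coord.subst]
        · simp only [CubeMap.comp, CubeMap.eraseVar, hd, CubeMap.lower_succAbove, Coord.subst]
          cases hq : f.coord (i.succAbove q) with
          | const b => rfl
          | var a z =>
            have ha : a ≠ l := by
              rintro rfl
              exact Fin.succAbove_ne i q ((f.used a).unique ⟨z, hq⟩ ⟨r, hf⟩)
            obtain ⟨a', rfl⟩ := Fin.exists_succAbove_eq ha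
            simp [CubeMap.lower_succAbove]

theorem totalFace_free {n : ℕ} (f : CubeMap n n) (c : 𝒢.TotalCube n) (h : 𝒢.totalFace f c = c) :
    f = CubeMap.id n := by
  cases c with
  | vert v c =>
    simp only [totalFace, TotalCube.vert.injEq, heq_eq_eq, true_and] at h
    exact CubeComplex.free _ f c h
  | @thick n e j s c =>
    cases hf : f.coord j with
    | const b =>
      rw [𝒢.totalFace_thick f e j s c _ hf] at h
      simp [thickFace, glued] at h
    | var i t =>
      rw [𝒢.totalFace_thick f e j s c _ hf] at h
      simp only [thickFace, TotalCube.thick.injEq, heq_eq_eq, true_and] at h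
      obtain ⟨rfl, ht, hc⟩ := h
      have ht' : t = false := by cases t <;> cases s <;> simp_all
      subst ht'
      have hid := CubeComplex.free _ _ c hc
      ext1; funext k
      by_cases hk : k = i
      · subst hk; exact hf
      · obtain ⟨k', rfl⟩ := Fin.exists_succAbove_eq hk
        have h1 : CubeMap.lower i (f.coord (i.succAbove k')) = .var k' false :=
          congrFun (congrArg CubeMap.coord hid) k'
        cases hq : f.coord (i.succAbove k') with
        | const b => simp [hq, CubeMap.lower] at h1
        | var a z =>
          have ha : a ≠ i := by
            rintro rfl
            exact hk ((f.used a).unique ⟨z, hq⟩ ⟨false, hf⟩)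
          obtain ⟨a', rfl⟩ := Fin.exists_succAbove_eq ha
          rw [hq, CubeMap.lower_succAbove] at h1
          cases h1
          rfl

/-- The cube complex `X` obtained from the disjoint union of the vertex spaces and the thickened edge
spaces by gluing along the attaching maps. -/
def total : CubeComplex.{u} where
  cube := 𝒢.TotalCube
  face := 𝒢.totalFace
  face_id := 𝒢.totalFace_id
  face_comp := 𝒢.totalFace_comp
  free := 𝒢.totalFace_free

/-- The inclusion of a vertex space. -/
def vertexMap (v : 𝒢.V) : CubicalMap (𝒢.vertexSpace v) 𝒢.total where
  toFun c := TotalCube.vert v c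
  map_face _ _ := rfl

/-- The map of an edge space to the total space through its initial vertex space. -/
def edgeMap (e : 𝒢.E) : CubicalMap (𝒢.edgeSpace e) 𝒢.total :=
  (𝒢.vertexMap (𝒢.endpoint false e)).comp (𝒢.attach false e)

/-- The edge group of `e` is separable in `π₁ X`. Base points do not matter, as changing them
conjugates the subgroup. -/
def EdgeGroupSeparable (e : 𝒢.E) : Prop :=
  ∀ y : (𝒢.edgeSpace e).Vertex, ((𝒢.edgeMap e).onPi1 y).range.IsSeparable

/-- `π₁ X` has finite stature with respect to its vertex groups, for any base point and any choice of
paths that turn the vertex groups into subgroups. -/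
def HasFiniteStatureVertexGroups : Prop :=
  ∀ (x : 𝒢.total.Vertex) (y : ∀ v, (𝒢.vertexSpace v).Vertex)
    (γ : ∀ v, 𝒢.total.PathClass ((𝒢.vertexMap v).onVertex (y v)) x),
    HasFiniteStature fun v => (𝒢.vertexMap v).subgroup (y v) (γ v)

end GraphOfCubeComplexes

/-! Label the edges of a special complex by its oriented hyperplanes, and let two labels commute
when the hyperplanes cross. Edges at a vertex have distinct labels, and edges with commuting labels
span a square, so the labels behave like the generators of a right-angled Artin group: the reduced
word read along a path in the universal cover is determined by the end points of the path, up to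
exchanging adjacent commuting letters. `SpecialGraph` records this. Consequently local isometries
lift to injections with convex image (`SpecialGraph.range_convex`), and for convex sets D and E one
fixed word leads from the points of D nearest to E to the points of E nearest to D
(`SpecialGraph.bridge_pair`).

Finiteness comes from a label-preserving subgroup N with finitely many orbits. A pair (D, C) is good
if D is convex, C preserves D, and every element of N that takes some point of D to a point of D
lies in C. Given one point of D, the pair is then determined by finite data in the quotient by N, so
only finitely many groups C belong to good pairs through a given point. If (D, C) and (E, K) are
good, then so are the points of D nearest to E together with C ⊓ K. A possibly infinite intersection
is therefore attained by a good pair with as little data as possible (`exists_finite_types`).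
Whether the intersection is an infinite group plays no role.

In the first statement the labels come from a finite special cover Y, and the convex sets are the
translates of the universal covers of the A_i. Labels act on the vertices of the fibre product of
A_i and Y by partial permutations. Completing these to permutations of a finite set gives a finite
representation of the path classes of Y (`EdgeLabelling.exists_separating_holonomy`); N consists of
the elements of π₁Y that it kills for all i.

In the other two statements only the edges of the vertex spaces are labelled. The components of the
labelled graph are the translates of the universal covers of the vertex spaces, which inject because
vertex groups do (`vertexMap_mapHom_injective`). Components are joined across walls, the translates
of the thickened edge spaces. To intersect with the stabilizer of another component, take a path
with the fewest crossings. An element that preserves both end components preserves the first wall;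
so shrink D to the points nearest to this wall, cross it, continue by induction and pull the result
back (`GoodConvex.exists_inf_joinedStab`). All that is needed is a finite index subgroup N for which
the sides of walls are good. If the edge spaces embed, N is the whole group; if the edge groups are
separable, N is a finite intersection of normal subgroups of finite index. -/

/-! ### Words in partially commuting letters -/

/-- An alphabet with formal inverses and a commutation relation between distinct letters. -/
class Letters (S : Type*) where
  inv : S → S
  comm : S → S → Prop
  inv_inv : ∀ s, inv (inv s) = s
  comm_symm : ∀ {s t}, comm s t → comm t s
  comm_irrefl : ∀ s, ¬ comm s s
  comm_inv : ∀ {s t}, comm s t → comm (inv s) t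

namespace Letters

variable {S : Type*} [Letters S]

theorem comm_inv_right {s t : S} (h : comm s t) : comm s (inv t) :=
  comm_symm (comm_inv (comm_symm h))

theorem ne_of_comm {s t : S} (h : comm s t) : s ≠ t := by
  rintro rfl; exact comm_irrefl _ h

/-- Words that differ by exchanging adjacent commuting letters. -/
inductive SwapEq : List S → List S → Prop
  | refl (w) : SwapEq w w
  | swap {a b} (w) : comm a b → SwapEq (a :: b :: w) (b :: a :: w)
  | cons (a) {w v} : SwapEq w v → SwapEq (a :: w) (a :: v)
  | trans {w v x} : SwapEq w v → SwapEq v x → SwapEq w x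

theorem SwapEq.symm {w v : List S} (h : SwapEq w v) : SwapEq v w := by
  induction h with
  | refl w => exact .refl w
  | swap w h => exact .swap w (comm_symm h)
  | cons a _ ih => exact .cons a ih
  | trans _ _ ih₁ ih₂ => exact ih₂.trans ih₁

theorem SwapEq.perm {w v : List S} (h : SwapEq w v) : w.Perm v := by
  induction h with
  | refl w => exact .refl w
  | swap w h => exact .swap ..
  | cons a _ ih => exact ih.cons a
  | trans _ _ ih₁ ih₂ => exact ih₁.trans ih₂

theorem SwapEq.length_eq {w v : List S} (h : SwapEq w v) : w.length = v.length := h.perm.length_eq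

theorem SwapEq.cons_append {a : S} {w : List S} (h : ∀ b ∈ w, comm b a) (v : List S) :
    SwapEq (a :: (w ++ v)) (w ++ a :: v) := by
  induction w with
  | nil => exact .refl _
  | cons b w ih =>
    exact (SwapEq.swap _ (comm_symm (h b (by simp)))).trans
      (.cons b (ih fun c hc => h c (by simp [hc])))

open Classical in
/-- Remove the letter `t` from a word in which it can be moved to the front. -/
noncomputable def pull (t : S) : List S → Option (List S)
  | [] => none
  | a :: w => if a = t then some w else if comm a t then (pull t w).map (a :: ·) else none

theorem pull_cons_self (t : S) (w : List S) : pull t (t :: w) = some w := by simp [pull]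

theorem pull_cons_comm {a t : S} (h : comm a t) (w : List S) :
    pull t (a :: w) = (pull t w).map (a :: ·) := by simp [pull, ne_of_comm h, h]

theorem pull_cons_none {a t : S} (h : a ≠ t) (h' : ¬ comm a t) (w : List S) :
    pull t (a :: w) = none := by simp [pull, h, h']

theorem pull_cons_eq_some {a t : S} {w v : List S} (h : pull t (a :: w) = some v) :
    (a = t ∧ v = w) ∨ (comm a t ∧ ∃ v', pull t w = some v' ∧ v = a :: v') := by
  by_cases h1 : a = t
  · subst h1; rw [pull_cons_self] at h; left; exact ⟨rfl, (Option.some.inj h).symm⟩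
  · by_cases h2 : comm a t
    · rw [pull_cons_comm h2, Option.map_eq_some_iff] at h
      obtain ⟨v', hv', rfl⟩ := h
      exact .inr ⟨h2, v', hv', rfl⟩
    · rw [pull_cons_none h1 h2] at h; cases h

theorem swapEq_of_pull {t : S} {w v : List S} (h : pull t w = some v) : SwapEq w (t :: v) := by
  induction w generalizing v with
  | nil => simp [pull] at h
  | cons a w ih =>
    obtain ⟨rfl, rfl⟩ | ⟨hc, v', hv', rfl⟩ := pull_cons_eq_some h
    · exact .refl _
    · exact (SwapEq.cons a (ih hv')).trans (.swap _ hc)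

theorem mem_of_pull {t : S} {w v : List S} (h : pull t w = some v) : t ∈ w :=
  (swapEq_of_pull h).perm.mem_iff.2 (by simp)

/-- No letter commutes with itself, so two occurrences of `t` never pass each other and the
occurrence that is removed stays the same under swaps. Thus `pull` makes sense on swap classes. -/
theorem SwapEq.pull {t : S} {w v w' : List S} (h : SwapEq w v) (hw : pull t w = some w') :
    ∃ v', Letters.pull t v = some v' ∧ SwapEq w' v' := by
  induction h generalizing w' with
  | refl w => exact ⟨w', hw, .refl _⟩
  | @swap a b w h =>
    obtain ⟨rfl, rfl⟩ | ⟨hc, v', hv', rfl⟩ := pull_cons_eq_some hw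
    · exact ⟨b :: w, by rw [pull_cons_comm (comm_symm h), pull_cons_self]; rfl, .refl _⟩
    · obtain ⟨rfl, rfl⟩ | ⟨hc', v'', hv'', rfl⟩ := pull_cons_eq_some hv'
      · exact ⟨_, pull_cons_self _ _, .refl _⟩
      · exact ⟨b :: a :: v'', by rw [pull_cons_comm hc', pull_cons_comm hc, hv'']; rfl, .swap _ h⟩
  | @cons a w v h ih =>
    obtain ⟨rfl, rfl⟩ | ⟨hc, v', hv', rfl⟩ := pull_cons_eq_some hw
    · exact ⟨v, pull_cons_self _ _, h⟩
    · obtain ⟨x, hx, hx'⟩ := ih hv'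
      exact ⟨a :: x, by rw [pull_cons_comm hc, hx]; rfl, .cons a hx'⟩
  | trans _ _ ih₁ ih₂ =>
    obtain ⟨x, hx, hx'⟩ := ih₁ hw
    obtain ⟨y, hy, hy'⟩ := ih₂ hx
    exact ⟨y, hy, hx'.trans hy'⟩

theorem SwapEq.pull_none {t : S} {w v : List S} (h : SwapEq w v) (hw : Letters.pull t w = none) :
    Letters.pull t v = none := by
  by_contra hv
  obtain ⟨v', hv'⟩ := Option.ne_none_iff_exists'.1 hv
  obtain ⟨x, hx, -⟩ := h.symm.pull hv'
  rw [hw] at hx; cases hx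

theorem pull_append_eq_some {t : S} {w v x : List S} (h : pull t (w ++ v) = some x) :
    (∃ w', pull t w = some w') ∨
      ((∀ a ∈ w, comm a t) ∧ ∃ v', pull t v = some v' ∧ x = w ++ v') := by
  induction w generalizing x with
  | nil => exact .inr ⟨by simp, x, h, rfl⟩
  | cons a w ih =>
    obtain ⟨rfl, rfl⟩ | ⟨hc, v', hv', rfl⟩ := pull_cons_eq_some h
    · exact .inl ⟨_, pull_cons_self _ _⟩
    · obtain ⟨w', hw'⟩ | ⟨h1, v'', h2, rfl⟩ := ih hv'
      · exact .inl ⟨a :: w', by rw [pull_cons_comm hc, hw']; rfl⟩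
      · refine .inr ⟨?_, v'', h2, rfl⟩
        simpa [hc] using h1

/-! ### Reduced words and normal forms -/

/-- No letter can be cancelled against its inverse. -/
def Reduced : List S → Prop
  | [] => True
  | a :: w => pull (inv a) w = none ∧ Reduced w

theorem reduced_singleton (a : S) : Reduced [a] := ⟨rfl, trivial⟩

theorem SwapEq.reduced {w v : List S} (h : SwapEq w v) (hw : Reduced w) : Reduced v := by
  induction h with
  | refl w => exact hw
  | @swap a b w h =>
    obtain ⟨h1, h2, h3⟩ := hw
    rw [pull_cons_comm (comm_inv_right (comm_symm h)), Option.map_eq_none_iff] at h1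
    refine ⟨?_, h1, h3⟩
    rw [pull_cons_comm (comm_inv_right h), h2]; rfl
  | cons a h ih => exact ⟨h.pull_none hw.1, ih hw.2⟩
  | trans _ _ ih₁ ih₂ => exact ih₂ (ih₁ hw)

/-- Since both factors are reduced, a cancellation pairs a letter of `w` with a letter of `v`. The
inverse letter passes the rest of `w`, so the letter itself can be moved to the end of `w`. -/
theorem exists_cancel_of_not_reduced {w v : List S} (hw : Reduced w) (hv : Reduced v)
    (h : ¬ Reduced (w ++ v)) :
    ∃ s w' v', SwapEq w (w' ++ [s]) ∧ SwapEq v (inv s :: v') := by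
  induction w with
  | nil => exact absurd hv h
  | cons a w ih =>
    by_cases h' : Reduced (w ++ v)
    · have h1 : pull (inv a) (w ++ v) ≠ none := fun h0 => h ⟨h0, h'⟩
      obtain ⟨x, hx⟩ := Option.ne_none_iff_exists'.1 h1
      obtain ⟨w', hw'⟩ | ⟨hc, v', hv', rfl⟩ := pull_append_eq_some hx
      · rw [hw.1] at hw'; cases hw'
      · refine ⟨a, w, v', ?_, swapEq_of_pull hv'⟩
        have := SwapEq.cons_append (a := a) (w := w)
          (fun b hb => by simpa [inv_inv] using comm_inv_right (hc b hb)) []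
        simpa using this
    · obtain ⟨s, w', v', h1, h2⟩ := ih hw.2 h'
      exact ⟨s, a :: w', v', .cons a h1, h2⟩

/-- Multiply a reduced word by a letter. -/
noncomputable def act (s : S) (w : List S) : List S :=
  match pull (inv s) w with
  | some v => v
  | none => s :: w

theorem act_of_some {s : S} {w v : List S} (h : pull (inv s) w = some v) : act s w = v := by
  simp [act, h]

theorem act_of_none {s : S} {w : List S} (h : pull (inv s) w = none) : act s w = s :: w := by
  simp [act, h]

theorem act_reduced {s : S} {w : List S} (hw : Reduced w) : Reduced (act s w) := by
  cases h : pull (inv s) w with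
  | none => rw [act_of_none h]; exact ⟨h, hw⟩
  | some v => rw [act_of_some h]; exact ((swapEq_of_pull h).reduced hw).2

theorem SwapEq.act {w v : List S} (s : S) (h : SwapEq w v) :
    SwapEq (Letters.act s w) (Letters.act s v) := by
  cases h' : Letters.pull (inv s) w with
  | none => rw [act_of_none h', act_of_none (h.pull_none h')]; exact .cons s h
  | some x =>
    obtain ⟨y, hy, hxy⟩ := h.pull h'
    rw [act_of_some h', act_of_some hy]; exact hxy

theorem act_act_inv {s : S} {w : List S} (hw : Reduced w) : SwapEq (act s (act (inv s) w)) w := by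
  cases h : pull (inv (inv s)) w with
  | none => rw [act_of_none h, act_of_some (pull_cons_self _ _)]; exact .refl _
  | some v =>
    rw [act_of_some h]
    have h1 := swapEq_of_pull h
    have h2 := (h1.reduced hw).1
    rw [inv_inv] at h2 h1
    rw [act_of_none h2]; exact h1.symm

/-- With `act_act_inv` this says that letters act on reduced words, up to swaps, according to the
relations of a partially commutative group. Hence `nf` is invariant under these relations. -/
theorem act_comm {s t : S} (hst : comm s t) (w : List S) :
    -- The roles of `s` and `t` are symmetric, so apart from the case where `inv s` cannot be pulled
    -- only the case where both inverses can be pulled needs an argument.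
    SwapEq (act s (act t w)) (act t (act s w)) := by
  wlog hs : pull (inv s) w = none generalizing s t
  · obtain ⟨v, hv⟩ := Option.ne_none_iff_exists'.1 hs
    by_cases ht : pull (inv t) w = none
    · exact (this (comm_symm hst) ht).symm
    · have h1 := swapEq_of_pull hv
      obtain ⟨x, hx⟩ := Option.ne_none_iff_exists'.1 ht
      obtain ⟨y, hy, hxy⟩ := h1.pull hx
      obtain ⟨he, -⟩ | ⟨hc, y', hy', rfl⟩ := pull_cons_eq_some hy
      · exact absurd he (ne_of_comm (comm_inv (comm_inv_right hst)))
      · rw [act_of_some hv, act_of_some hx, act_of_some hy']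
        have := hxy.act s
        rwa [act_of_some (pull_cons_self _ _)] at this
  · rw [act_of_none hs]
    have hts : comm t (inv s) := comm_inv_right (comm_symm hst)
    cases ht : pull (inv t) w with
    | none =>
      rw [act_of_none ht, act_of_none (by rw [pull_cons_comm hts, hs]; rfl),
        act_of_none (by rw [pull_cons_comm (comm_inv_right hst), ht]; rfl)]
      exact .swap _ hst
    | some v =>
      rw [act_of_some ht, act_of_some (s := t) (v := s :: v)
        (by rw [pull_cons_comm (comm_inv_right hst), ht]; rfl)]
      rw [act_of_none]
      · exact .refl _
      · have := (swapEq_of_pull ht).pull_none hs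
        rw [pull_cons_comm (comm_inv hts)] at this
        simpa using this

/-- The reduced form of a word. -/
noncomputable def nf : List S → List S
  | [] => []
  | a :: w => act a (nf w)

theorem nf_reduced (w : List S) : Reduced (nf w) := by
  induction w with
  | nil => trivial
  | cons a w ih => exact act_reduced ih

theorem nf_of_reduced {w : List S} (h : Reduced w) : nf w = w := by
  induction w with
  | nil => rfl
  | cons a w ih => rw [nf, ih h.2, act_of_none h.1]

theorem nf_append_congr (x : List S) {w v : List S} (h : SwapEq (nf w) (nf v)) :
    SwapEq (nf (x ++ w)) (nf (x ++ v)) := by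
  induction x with
  | nil => exact h
  | cons a x ih => exact ih.act a

theorem nf_backtrack (s : S) (w : List S) : SwapEq (nf (s :: inv s :: w)) (nf w) :=
  act_act_inv (nf_reduced w)

theorem nf_swap {s t : S} (h : comm s t) (w : List S) :
    SwapEq (nf (s :: t :: w)) (nf (t :: s :: w)) :=
  act_comm h (nf w)

/-- If `h u₂` and `u₁ k` are the same up to swaps and `h`, `u₁` have no common first letter, then
`u₁` commutes with `h` and divides `u₂`. -/
theorem commute_of_swapEq_append {h u₁ u₂ k : List S} (hs : SwapEq (h ++ u₂) (u₁ ++ k))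
    (hf : ∀ t x, pull t u₁ = some x → pull t h = none) :
    (∀ t ∈ u₁, ∀ s ∈ h, comm s t) ∧ ∃ r, SwapEq u₂ (u₁ ++ r) ∧ SwapEq (h ++ r) k := by
  induction u₁ generalizing u₂ with
  | nil => exact ⟨by simp, u₂, .refl _, hs⟩
  | cons t u₁ ih =>
    have h1 : pull t ((t :: u₁) ++ k) = some (u₁ ++ k) := pull_cons_self _ _
    obtain ⟨x, hx, hx'⟩ := hs.symm.pull h1
    obtain ⟨w', hw'⟩ | ⟨hc, v', hv', rfl⟩ := pull_append_eq_some hx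
    · rw [hf t u₁ (pull_cons_self _ _)] at hw'; cases hw'
    -- The condition on first letters passes to the shorter word: a common first letter of it and
    -- `h` commutes with `t`, hence could be moved in front of `t`.
    · obtain ⟨ha, r, hr, hr'⟩ := ih hx'.symm (by
        intro t' y hy
        by_contra hne
        obtain ⟨y', hy'⟩ := Option.ne_none_iff_exists'.1 hne
        have hcm : comm t t' := comm_symm (hc t' (mem_of_pull hy'))
        exact hne (hf t' (t :: y) (by rw [pull_cons_comm hcm, hy]; rfl)))
      refine ⟨?_, r, (swapEq_of_pull hv').trans (.cons t hr), hr'⟩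
      intro t' ht'
      obtain rfl | ht' := List.mem_cons.1 ht'
      · exact hc
      · exact ha t' ht'

end Letters

/-! ### Labelled graphs with commuting squares -/

section LabelledGraph

set_option linter.unusedSectionVars false

open Letters

variable {Z S : Type*} [Letters S]

/-- A walk that reads the given word. -/
def Walk (step : Z → S → Z → Prop) : Z → List S → Z → Prop
  | z, [], z' => z = z'
  | z, s :: w, z' => ∃ y, step z s y ∧ Walk step y w z'

/-- A deterministic labelled graph in which edges with commuting labels span squares. -/
structure PreSpecialGraph (step : Z → S → Z → Prop) : Prop where
  inv : ∀ {z s z'}, step z s z' → step z' (Letters.inv s) z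
  det : ∀ {z s a b}, step z s a → step z s b → a = b
  square : ∀ {z s t a b}, comm s t → step z s a → step z t b → ∃ w, step a t w ∧ step b s w

/-- A labelled graph in which the endpoints determine the label of a walk. -/
structure SpecialGraph (step : Z → S → Z → Prop) : Prop extends PreSpecialGraph step where
  label_unique : ∀ {z z' w v}, Walk step z w z' → Walk step z v z' → Reduced w → Reduced v →
    SwapEq w v

/-- Adjacency in a labelled graph. -/
def StepAdj (step : Z → S → Z → Prop) (z z' : Z) : Prop := ∃ s, step z s z'

/-- The subgraph induced by a set. -/
def stepOn (step : Z → S → Z → Prop) (D : Set Z) (z : Z) (s : S) (z' : Z) : Prop :=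
  step z s z' ∧ z ∈ D ∧ z' ∈ D

/-- A set that is connected and contains the fourth corner of each 4-cycle of which it contains
three corners. -/
structure ConvexIn (Adj : Z → Z → Prop) (D : Set Z) : Prop where
  conn : ∀ z ∈ D, ∀ z' ∈ D, Relation.ReflTransGen (fun a b => Adj a b ∧ a ∈ D ∧ b ∈ D) z z'
  square : ∀ {z a b w}, z ∈ D → a ∈ D → b ∈ D → Adj z a → Adj z b → Adj a w → Adj b w →
    a ≠ b → z ≠ w → w ∈ D

/-- The formal inverse of a word. -/
def Letters.invWord : List S → List S
  | [] => []
  | a :: w => Letters.invWord w ++ [Letters.inv a]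

variable {step : Z → S → Z → Prop}

theorem Letters.length_invWord (w : List S) : (Letters.invWord w).length = w.length := by
  induction w with
  | nil => rfl
  | cons a w ih => simp [Letters.invWord, ih]

theorem Walk.append {z y z' : Z} {w v : List S} (h : Walk step z w y) (h' : Walk step y v z') :
    Walk step z (w ++ v) z' := by
  induction w generalizing z with
  | nil => cases h; exact h'
  | cons a w ih => obtain ⟨x, hx, h⟩ := h; exact ⟨x, hx, ih h⟩

theorem Walk.single {z z' : Z} {s : S} (h : step z s z') : Walk step z [s] z' := ⟨z', h, rfl⟩

theorem Walk.of_single {z z' : Z} {s : S} (h : Walk step z [s] z') : step z s z' := by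
  obtain ⟨y, hy, rfl⟩ := h; exact hy

theorem Walk.split {z z' : Z} {w v : List S} (h : Walk step z (w ++ v) z') :
    ∃ y, Walk step z w y ∧ Walk step y v z' := by
  induction w generalizing z with
  | nil => exact ⟨z, rfl, h⟩
  | cons a w ih =>
    obtain ⟨x, hx, h⟩ := h
    obtain ⟨y, h1, h2⟩ := ih h
    exact ⟨y, ⟨x, hx, h1⟩, h2⟩

theorem Walk.of_stepOn {D : Set Z} {z z' : Z} {w : List S} (h : Walk (stepOn step D) z w z') :
    Walk step z w z' := by
  induction w generalizing z with
  | nil => exact h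
  | cons a w ih => obtain ⟨x, hx, h⟩ := h; exact ⟨x, hx.1, ih h⟩

theorem Walk.exists_of_reflTransGen {D : Set Z} {z z' : Z}
    (h : Relation.ReflTransGen (fun a b => StepAdj step a b ∧ a ∈ D ∧ b ∈ D) z z') :
    ∃ w, Walk (stepOn step D) z w z' := by
  induction h with
  | refl => exact ⟨[], rfl⟩
  | tail _ h ih =>
    obtain ⟨w, hw⟩ := ih
    obtain ⟨⟨s, hs⟩, h1, h2⟩ := h
    exact ⟨w ++ [s], hw.append (.single ⟨hs, h1, h2⟩)⟩

theorem Walk.reflTransGen {D : Set Z} {z z' : Z} {w : List S} (h : Walk (stepOn step D) z w z') :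
    Relation.ReflTransGen (fun a b => StepAdj step a b ∧ a ∈ D ∧ b ∈ D) z z' := by
  induction w generalizing z with
  | nil => cases h; exact .refl
  | cons a w ih => obtain ⟨x, hx, h⟩ := h; exact .head ⟨⟨a, hx.1⟩, hx.2⟩ (ih h)

theorem Walk.map_adj {g : Z → Z} (hg : ∀ a b, StepAdj step a b → StepAdj step (g a) (g b))
    {z z' : Z} {w : List S} (h : Walk step z w z') :
    ∃ v, Walk step (g z) v (g z') ∧ v.length = w.length := by
  induction w generalizing z with
  | nil => cases h; exact ⟨[], rfl, rfl⟩
  | cons a w ih =>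
    obtain ⟨x, hx, h⟩ := h
    obtain ⟨v, hv, hl⟩ := ih h
    obtain ⟨s, hs⟩ := hg _ _ ⟨a, hx⟩
    exact ⟨s :: v, ⟨_, hs, hv⟩, by simp [hl]⟩

theorem Walk.map_step {Z' : Type*} {step' : Z' → S → Z' → Prop} {g : Z' → Z}
    (hg : ∀ a s b, step' a s b → step (g a) s (g b)) {z z' : Z'} {w : List S}
    (h : Walk step' z w z') : Walk step (g z) w (g z') := by
  induction w generalizing z with
  | nil => cases h; rfl
  | cons a w ih => obtain ⟨x, hx, h⟩ := h; exact ⟨_, hg _ _ _ hx, ih h⟩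

namespace PreSpecialGraph

variable (hG : PreSpecialGraph step)
include hG

theorem walk_det {z a b : Z} {w : List S} (h : Walk step z w a) (h' : Walk step z w b) :
    a = b := by
  induction w generalizing z with
  | nil => exact h.symm.trans h'
  | cons s w ih =>
    obtain ⟨x, hx, h⟩ := h
    obtain ⟨y, hy, h'⟩ := h'
    obtain rfl := hG.det hx hy
    exact ih h h'

theorem walk_inv {z z' : Z} {w : List S} (h : Walk step z w z') :
    Walk step z' (invWord w) z := by
  induction w generalizing z with
  | nil => exact Eq.symm h
  | cons s w ih =>
    obtain ⟨x, hx, h⟩ := h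
    exact (ih h).append (.single (hG.inv hx))

/-- Two consecutive edges with commuting labels span a square at their middle vertex; the other two
sides of the square read the labels in the opposite order. -/
theorem walk_swapEq {z z' : Z} {w v : List S} (h : SwapEq w v) (hw : Walk step z w z') :
    Walk step z v z' := by
  induction h generalizing z with
  | refl => exact hw
  | swap w h =>
    obtain ⟨x, hx, y, hy, hw⟩ := hw
    obtain ⟨b, h1, h2⟩ := hG.square (comm_inv h) (hG.inv hx) hy
    have h3 := hG.inv h2
    rw [Letters.inv_inv] at h3
    exact ⟨b, h1, y, h3, hw⟩
  | cons a _ ih => obtain ⟨x, hx, hw⟩ := hw; exact ⟨x, hx, ih hw⟩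
  | trans _ _ ih₁ ih₂ => exact ih₂ (ih₁ hw)

/-- If the first letter cancels against the reduced remainder, that remainder can be rearranged to
start with its inverse, and by determinism its first edge returns to the starting point. -/
theorem exists_reduced {z z' : Z} {w : List S} (hw : Walk step z w z') :
    ∃ v, Walk step z v z' ∧ Reduced v ∧ v.length ≤ w.length := by
  induction w generalizing z with
  | nil => exact ⟨[], hw, trivial, le_rfl⟩
  | cons a w ih =>
    obtain ⟨x, hx, hw⟩ := hw
    obtain ⟨v, hv, hr, hl⟩ := ih hw
    cases h : pull (Letters.inv a) v with
    | none => exact ⟨a :: v, ⟨x, hx, hv⟩, ⟨h, hr⟩, by simpa using hl⟩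
    | some y =>
      have hs := swapEq_of_pull h
      obtain ⟨b, hb, hy⟩ := hG.walk_swapEq hs hv
      obtain rfl := hG.det hb (hG.inv hx)
      refine ⟨y, hy, (hs.reduced hr).2, ?_⟩
      have := hs.length_eq
      simp at this ⊢; omega

/-- Transport a walk along an edge whose label commutes with it. -/
theorem transport {z z' y : Z} {u : List S} {s : S} (hu : Walk step z u z') (hs : step z s y)
    (hc : ∀ t ∈ u, comm s t) : ∃ y', Walk step y u y' ∧ step z' s y' := by
  induction u generalizing z y with
  | nil => cases hu; exact ⟨y, rfl, hs⟩
  | cons t u ih =>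
    obtain ⟨x, hx, hu⟩ := hu
    obtain ⟨w, h1, h2⟩ := hG.square (hc t (by simp)) hs hx
    obtain ⟨y', h3, h4⟩ := ih hu h2 fun t' ht' => hc t' (by simp [ht'])
    exact ⟨y', ⟨w, h1, h3⟩, h4⟩

end PreSpecialGraph

namespace SpecialGraph

variable (hG : SpecialGraph step)
include hG

theorem label_eq {z a : Z} {s t : S} (h : step z s a) (h' : step z t a) : s = t := by
  have := (hG.label_unique (.single h) (.single h') (reduced_singleton _)
    (reduced_singleton _)).perm
  simpa using this

theorem ne_corner {z a w : Z} {s t : S} (hc : comm s t) (h : step z s a) (h' : step a t w) :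
    z ≠ w := by
  rintro rfl
  have hr : Reduced [s, t] := by
    refine ⟨?_, reduced_singleton _⟩
    rw [pull_cons_comm (comm_symm (comm_inv hc))]; rfl
  have := (hG.label_unique (show Walk step z [s, t] z from ⟨a, h, z, h', rfl⟩)
    (show Walk step z [] z from rfl) hr trivial).length_eq
  simp at this

/-- As `z ≠ w`, neither half of the cycle is a backtrack, so both read reduced words of length two.
These agree up to swaps and, as `a ≠ b`, begin with different letters; hence one is the swap of the
other. -/
theorem four_cycle {z a b w : Z} {s t : S} (hs : step z s a) (ht : step z t b)
    (ha : StepAdj step a w) (hb : StepAdj step b w) (hab : a ≠ b) (hzw : z ≠ w) :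
    comm s t ∧ step a t w ∧ step b s w := by
  obtain ⟨t', ht'⟩ := ha
  obtain ⟨s', hs'⟩ := hb
  have red : ∀ {z a w : Z} {s t : S}, step z s a → step a t w → z ≠ w → Reduced [s, t] := by
    intro z a w s t h h' hzw
    refine ⟨?_, reduced_singleton _⟩
    have hne : t ≠ Letters.inv s := by
      rintro rfl
      exact hzw (hG.det (hG.inv h) h')
    by_cases hc : comm t (Letters.inv s)
    · rw [pull_cons_comm hc]; rfl
    · rw [pull_cons_none hne hc]
  have h := hG.label_unique (show Walk step z [s, t'] w from ⟨a, hs, w, ht', rfl⟩)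
    (show Walk step z [t, s'] w from ⟨b, ht, w, hs', rfl⟩) (red hs ht' hzw) (red ht hs' hzw)
  obtain ⟨x, hx, hx'⟩ := h.pull (pull_cons_self s [t'])
  obtain ⟨rfl, rfl⟩ | ⟨hc, v', hv', rfl⟩ := pull_cons_eq_some hx
  · exact absurd (hG.det hs ht) hab
  · obtain ⟨rfl, rfl⟩ | ⟨hc, v', hv', rfl⟩ := pull_cons_eq_some hv'
    · have := hx'.perm
      simp at this
      subst this
      exact ⟨comm_symm hc, ht', hs'⟩
    · simp [pull] at hv'

theorem stepOn_special {D : Set Z} (hD : ConvexIn (StepAdj step) D) :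
    SpecialGraph (stepOn step D) where
  inv h := ⟨hG.inv h.1, h.2.2, h.2.1⟩
  det h h' := hG.det h.1 h'.1
  square {z s t a b} hc h h' := by
    obtain ⟨w, h1, h2⟩ := hG.square hc h.1 h'.1
    have hw : w ∈ D := hD.square h.2.1 h.2.2 h'.2.2 ⟨_, h.1⟩ ⟨_, h'.1⟩ ⟨_, h1⟩ ⟨_, h2⟩
      (by rintro rfl; exact ne_of_comm hc (hG.label_eq h.1 h'.1)) (hG.ne_corner hc h.1 h1)
    exact ⟨w, ⟨h1, h.2.2, hw⟩, ⟨h2, h'.2.2, hw⟩⟩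
  label_unique h h' := hG.label_unique h.of_stepOn h'.of_stepOn

theorem exists_reduced_on {D : Set Z} (hD : ConvexIn (StepAdj step) D) {z z' : Z} (hz : z ∈ D)
    (hz' : z' ∈ D) : ∃ w, Walk (stepOn step D) z w z' ∧ Reduced w := by
  obtain ⟨w, hw⟩ := Walk.exists_of_reflTransGen (hD.conn z hz z' hz')
  obtain ⟨v, hv, hr, -⟩ := (hG.stepOn_special hD).exists_reduced hw
  exact ⟨v, hv, hr⟩

/-- A label-preserving map of a connected labelled graph with commuting squares is injective. -/
theorem map_injective {Z' : Type*} {step' : Z' → S → Z' → Prop} (hG' : PreSpecialGraph step')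
    (hconn : ∀ a b, ∃ w, Walk step' a w b) {g : Z' → Z}
    (hg : ∀ a s b, step' a s b → step (g a) s (g b)) : Function.Injective g := by
  intro a b hab
  obtain ⟨w, hw⟩ := hconn a b
  obtain ⟨v, hv, hr, -⟩ := hG'.exists_reduced hw
  have h := hv.map_step hg
  rw [hab] at h
  have := (hG.label_unique h (show Walk step (g b) [] (g b) from rfl) hr trivial).length_eq
  obtain rfl : v = [] := by simpa using this
  exact hv

/-- A reduced walk from `a` to `b` reads, in the target, a reduced word with the end points of the
single edge; it is therefore that one letter. -/
theorem map_reflects_step {Z' : Type*} {step' : Z' → S → Z' → Prop} (hG' : PreSpecialGraph step')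
    (hconn : ∀ a b, ∃ w, Walk step' a w b) {g : Z' → Z}
    (hg : ∀ a s b, step' a s b → step (g a) s (g b)) {a b : Z'} {s : S}
    (h : step (g a) s (g b)) : step' a s b := by
  obtain ⟨w, hw⟩ := hconn a b
  obtain ⟨v, hv, hr, -⟩ := hG'.exists_reduced hw
  have := (hG.label_unique (hv.map_step hg) (.single h) hr (reduced_singleton _)).perm
  obtain rfl : v = [s] := by simpa using this
  exact hv.of_single

theorem range_convex {Z' : Type*} {step' : Z' → S → Z' → Prop} (hG' : PreSpecialGraph step')
    (hconn : ∀ a b, ∃ w, Walk step' a w b) {g : Z' → Z}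
    (hg : ∀ a s b, step' a s b → step (g a) s (g b)) :
    ConvexIn (StepAdj step) (Set.range g) where
  conn := by
    rintro _ ⟨a, rfl⟩ _ ⟨b, rfl⟩
    obtain ⟨w, hw⟩ := hconn a b
    exact (Walk.map_step (step := stepOn step (Set.range g)) (g := g)
      (fun _ _ _ h => ⟨hg _ _ _ h, ⟨_, rfl⟩, ⟨_, rfl⟩⟩) hw).reflTransGen
  square := by
    rintro _ _ _ w ⟨z, rfl⟩ ⟨a, rfl⟩ ⟨b, rfl⟩ ⟨s, hs⟩ ⟨t, ht⟩ ha hb hab hzw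
    obtain ⟨hc, h1, h2⟩ := hG.four_cycle hs ht ha hb hab hzw
    obtain ⟨x, hx, -⟩ := hG'.square hc (hG.map_reflects_step hG' hconn hg hs)
      (hG.map_reflects_step hG' hconn hg ht)
    exact ⟨x, hG.det (hg _ _ _ hx) h1⟩

end SpecialGraph

/-! ### Nearest points of two convex sets -/

/-- The points of `D` at distance `m` from `E`. -/
def nearSet (step : Z → S → Z → Prop) (D E : Set Z) (m : ℕ) : Set Z :=
  {z | z ∈ D ∧ ∃ z' ∈ E, ∃ w, Walk step z w z' ∧ w.length = m}

theorem nearSet_smul {g : Z → Z} (hg : ∀ a b, StepAdj step a b → StepAdj step (g a) (g b))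
    {D E : Set Z} (hD : ∀ z ∈ D, g z ∈ D) (hE : ∀ z ∈ E, g z ∈ E) {m : ℕ} {z : Z}
    (hz : z ∈ nearSet step D E m) : g z ∈ nearSet step D E m := by
  obtain ⟨h, z', hz', w, hw, hl⟩ := hz
  obtain ⟨v, hv, hvl⟩ := hw.map_adj hg
  exact ⟨hD z h, g z', hE z' hz', v, hv, hvl.trans hl⟩

/-- `m` is a lower bound for the distance of `D` and `E`. -/
def DistLower (step : Z → S → Z → Prop) (D E : Set Z) (m : ℕ) : Prop :=
  ∀ z ∈ D, ∀ z' ∈ E, ∀ w, Walk step z w z' → m ≤ w.length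

namespace SpecialGraph

variable (hG : SpecialGraph step) {D E : Set Z} (hD : ConvexIn (StepAdj step) D)
  (hE : ConvexIn (StepAdj step) E) {m : ℕ} (hm : DistLower step D E m)
include hG hD hE hm

/-- Consider the quadrilateral with sides `h` in `D`, `k` in `E` and two shortest bridges `u₁`,
`u₂`. The words `h ++ u₂` and `u₁ ++ k` are reduced, since a cancellation would give a shorter
bridge, so they agree up to swaps. A common first letter of `h` and `u₁` would shorten `u₁` as well.
Hence `u₁` commutes with `h` and divides `u₂`, and equal lengths leave no remainder. -/
theorem bridge_pair {z₁ z₂ z₁' z₂' : Z} {u₁ u₂ h : List S} (hz₁' : z₁' ∈ E) (hz₂' : z₂' ∈ E)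
    (h₁ : Walk step z₁ u₁ z₁') (h₂ : Walk step z₂ u₂ z₂') (l₁ : u₁.length = m)
    (l₂ : u₂.length = m) (r₁ : Reduced u₁) (r₂ : Reduced u₂) (hz₁ : z₁ ∈ D)
    (hh : Walk (stepOn step D) z₁ h z₂) (rh : Reduced h) :
    (∀ t ∈ u₁, ∀ s ∈ h, comm s t) ∧ SwapEq u₂ u₁ ∧ Walk (stepOn step E) z₁' h z₂' := by
  have hGD := hG.stepOn_special hD
  have hGE := hG.stepOn_special hE
  obtain ⟨k, hk, rk⟩ := hG.exists_reduced_on hE hz₁' hz₂'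
  have R1 : Reduced (h ++ u₂) := by
    by_contra hn
    obtain ⟨s, h', u', e1, e2⟩ := exists_cancel_of_not_reduced rh r₂ hn
    obtain ⟨y, -, hy⟩ := (hGD.walk_swapEq e1 hh).split
    have hy := hy.of_single
    obtain ⟨y', hy', hw⟩ := hG.walk_swapEq e2 h₂
    obtain rfl := hG.det hy' (hG.inv hy.1)
    have := hm _ hy.2.1 _ hz₂' _ hw
    have := e2.length_eq
    simp at this; omega
  have R2 : Reduced (u₁ ++ k) := by
    by_contra hn
    obtain ⟨s, u', k', e1, e2⟩ := exists_cancel_of_not_reduced r₁ rk hn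
    obtain ⟨y, hw, hy⟩ := (hG.walk_swapEq e1 h₁).split
    have hy := hy.of_single
    obtain ⟨y', hy', -⟩ := hGE.walk_swapEq e2 hk
    obtain rfl := hG.det hy'.1 (hG.inv hy)
    have := hm _ hz₁ _ hy'.2.2 _ hw
    have := e1.length_eq
    simp at this; omega
  have hs := hG.label_unique (hh.of_stepOn.append h₂) (h₁.append hk.of_stepOn) R1 R2
  obtain ⟨hc, r, e1, e2⟩ := commute_of_swapEq_append hs (by
    intro t x hx
    by_contra hn
    obtain ⟨y, hy⟩ := Option.ne_none_iff_exists'.1 hn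
    obtain ⟨p, hp, -⟩ := hGD.walk_swapEq (swapEq_of_pull hy) hh
    obtain ⟨p', hp', hw⟩ := hG.walk_swapEq (swapEq_of_pull hx) h₁
    obtain rfl := hG.det hp.1 hp'
    have := hm _ hp.2.2 _ hz₁' _ hw
    have := (swapEq_of_pull hx).length_eq
    simp at this; omega)
  have hl := e1.length_eq
  rw [List.length_append] at hl
  obtain rfl : r = [] := List.length_eq_zero_iff.1 (by omega)
  rw [List.append_nil] at e1 e2
  exact ⟨hc, e1, hGE.walk_swapEq e2.symm hk⟩

theorem exists_reduced_of_near {z : Z} (hz : z ∈ nearSet step D E m) :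
    ∃ z' ∈ E, ∃ u, Walk step z u z' ∧ u.length = m ∧ Reduced u := by
  obtain ⟨hzD, z', hz', w, hw, hl⟩ := hz
  obtain ⟨v, hv, hr, hvl⟩ := hG.exists_reduced hw
  exact ⟨z', hz', v, hv, le_antisymm (hvl.trans hl.le) (hm _ hzD _ hz' _ hv), hr⟩

/-- The bridge is carried along `h` letter by letter, so every point of this walk has a bridge of
the same length. -/
theorem near_walk {z₁ z₂ z₁' z₂' : Z} {u h : List S} (hu : Walk step z₁ u z₁')
    (lu : u.length = m) (hc : ∀ t ∈ u, ∀ s ∈ h, comm s t)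
    (hz₁ : z₁ ∈ D) (hz₁' : z₁' ∈ E)
    (hh : Walk (stepOn step D) z₁ h z₂) (hh' : Walk (stepOn step E) z₁' h z₂') :
    Walk (stepOn step (nearSet step D E m)) z₁ h z₂ := by
  induction h generalizing z₁ z₁' with
  | nil => exact hh
  | cons s h ih =>
    obtain ⟨y, hy, hh⟩ := hh
    obtain ⟨y', hy', hh'⟩ := hh'
    obtain ⟨x, hx, hx'⟩ := hG.transport hu hy.1 fun t ht => hc t ht s (by simp)
    obtain rfl := hG.det hx' hy'.1
    exact ⟨y, ⟨hy.1, ⟨hz₁, z₁', hz₁', u, hu, lu⟩, ⟨hy.2.2, x, hy'.2.2, u, hx, lu⟩⟩,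
      ih hx (fun t ht s hs => hc t ht s (by simp [hs])) hy.2.2 hy'.2.2 hh hh'⟩

theorem nearSet_convex : ConvexIn (StepAdj step) (nearSet step D E m) where
  conn z₁ hz₁ z₂ hz₂ := by
    obtain ⟨z₁', h₁', u₁, hu₁, l₁, r₁⟩ := hG.exists_reduced_of_near hD hE hm hz₁
    obtain ⟨z₂', h₂', u₂, hu₂, l₂, r₂⟩ := hG.exists_reduced_of_near hD hE hm hz₂
    obtain ⟨h, hh, rh⟩ := hG.exists_reduced_on hD hz₁.1 hz₂.1
    obtain ⟨hc, -, hh'⟩ := hG.bridge_pair hD hE hm h₁' h₂' hu₁ hu₂ l₁ l₂ r₁ r₂ hz₁.1 hh rh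
    exact (hG.near_walk hD hE hm hu₁ l₁ hc hz₁.1 h₁' hh hh').reflTransGen
  square := by
    rintro z a b w hz ha hb ⟨s, hs⟩ ⟨t, ht⟩ haw hbw hab hzw
    have hw := hD.square hz.1 ha.1 hb.1 ⟨s, hs⟩ ⟨t, ht⟩ haw hbw hab hzw
    obtain ⟨hst, h1, h2⟩ := hG.four_cycle hs ht haw hbw hab hzw
    obtain ⟨z', hz', u, hu, lu, ru⟩ := hG.exists_reduced_of_near hD hE hm hz
    obtain ⟨a', ha', ua, hua, lua, rua⟩ := hG.exists_reduced_of_near hD hE hm ha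
    obtain ⟨b', hb', ub, hub, lub, rub⟩ := hG.exists_reduced_of_near hD hE hm hb
    obtain ⟨hcs, -, hsa⟩ := hG.bridge_pair hD hE hm hz' ha' hu hua lu lua ru rua hz.1
      (.single ⟨hs, hz.1, ha.1⟩) (reduced_singleton s)
    obtain ⟨hct, -, hsb⟩ := hG.bridge_pair hD hE hm hz' hb' hu hub lu lub ru rub hz.1
      (.single ⟨ht, hz.1, hb.1⟩) (reduced_singleton t)
    have hsa := hsa.of_single
    have hsb := hsb.of_single
    -- Carry the bridge at `z` along the edges `s` and `t`. Its end over the fourth corner `w` is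
    -- the fourth corner of a square with three corners in `E`.
    obtain ⟨x, hx, hx'⟩ := hG.transport hu hs fun r hr => hcs r hr s (by simp)
    obtain rfl := hG.det hx' hsa.1
    obtain ⟨y, hy, hy'⟩ := hG.transport hx h1 fun r hr => hct r hr t (by simp)
    obtain ⟨y₂, hy₂, hy₂'⟩ := hG.square hst hsa.1 hsb.1
    obtain rfl := hG.det hy₂ hy'
    have hyE : y₂ ∈ E := hE.square hz' ha' hb' ⟨s, hsa.1⟩ ⟨t, hsb.1⟩ ⟨t, hy'⟩ ⟨s, hy₂'⟩
      (by rintro rfl; exact ne_of_comm hst (hG.label_eq hsa.1 hsb.1))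
      (hG.ne_corner hst hsa.1 hy')
    exact ⟨hw, y₂, hyE, u, hy, lu⟩

/-- One word leads from all points of `D` that are nearest to `E` to `E`. -/
theorem exists_bridge_word (hne : (nearSet step D E m).Nonempty) :
    ∃ u : List S, u.length = m ∧ ∀ z ∈ nearSet step D E m, ∃ z' ∈ E, Walk step z u z' := by
  obtain ⟨z₀, hz₀⟩ := hne
  obtain ⟨z₀', h₀', u, hu, lu, ru⟩ := hG.exists_reduced_of_near hD hE hm hz₀
  refine ⟨u, lu, fun z hz => ?_⟩
  obtain ⟨z', h', v, hv, lv, rv⟩ := hG.exists_reduced_of_near hD hE hm hz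
  obtain ⟨h, hh, rh⟩ := hG.exists_reduced_on hD hz₀.1 hz.1
  obtain ⟨-, hs, -⟩ := hG.bridge_pair hD hE hm h₀' h' hu hv lu lv ru rv hz₀.1 hh rh
  exact ⟨z', h', hG.walk_swapEq hs hv⟩

theorem bridge_adj {z₁ z₂ z₁' z₂' : Z} {u : List S} (lu : u.length = m) (hz₁ : z₁ ∈ D)
    (hz₂ : z₂ ∈ D) (hz₁' : z₁' ∈ E) (hz₂' : z₂' ∈ E) (h₁ : Walk step z₁ u z₁')
    (h₂ : Walk step z₂ u z₂') (h : StepAdj step z₁ z₂) : StepAdj step z₁' z₂' := by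
  obtain ⟨s, hs⟩ := h
  obtain ⟨v, hv, rv, lv⟩ := hG.exists_reduced h₁
  obtain ⟨v', hv', rv', lv'⟩ := hG.exists_reduced h₂
  have := hm _ hz₁ _ hz₁' _ hv
  have := hm _ hz₂ _ hz₂' _ hv'
  obtain ⟨-, -, hw⟩ := hG.bridge_pair hD hE hm hz₁' hz₂' hv hv' (by omega) (by omega) rv rv' hz₁
    (.single ⟨hs, hz₁, hz₂⟩) (reduced_singleton s)
  exact ⟨s, hw.of_single.1⟩

end SpecialGraph

theorem DistLower.symm (hG : PreSpecialGraph step) {D E : Set Z} {m : ℕ}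
    (hm : DistLower step D E m) : DistLower step E D m := by
  intro z hz z' hz' w hw
  have := hm z' hz' z hz _ (hG.walk_inv hw)
  rwa [length_invWord] at this

theorem exists_distLower {D E : Set Z} {z z' : Z} {w : List S} (hz : z ∈ D) (hz' : z' ∈ E)
    (hw : Walk step z w z') : ∃ m, DistLower step D E m ∧ (nearSet step D E m).Nonempty := by
  classical
  have hex : ∃ m, ∃ z ∈ D, ∃ z' ∈ E, ∃ w, Walk step z w z' ∧ w.length = m :=
    ⟨_, z, hz, z', hz', w, hw, rfl⟩
  refine ⟨Nat.find hex, fun a ha b hb v hv => Nat.find_min' hex ⟨a, ha, b, hb, v, hv, rfl⟩, ?_⟩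
  obtain ⟨a, ha, b⟩ := Nat.find_spec hex
  exact ⟨a, ha, b⟩

end LabelledGraph

/-! ### Subgroups acting on connected sets with few orbits -/

theorem Subgroup.mem_conjBy {G : Type u} [Group G] {g x : G} {H : Subgroup G} :
    x ∈ H.conjBy g ↔ g⁻¹ * x * g ∈ H := by
  constructor
  · rintro ⟨y, hy, rfl⟩
    simpa [MulAut.conj_apply, mul_assoc] using hy
  · intro h
    exact ⟨_, h, by simp [MulAut.conj_apply, mul_assoc]⟩

section GoodPairs

variable {G : Type u} {Z : Type*} [Group G] [MulAction G Z]

/-- A subgroup `C` and a connected set `D` on which it acts, such that elements of `N` that do not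
move `D` off itself belong to `C`. -/
structure GoodPair (Adj : Z → Z → Prop) (N : Subgroup G) (D : Set Z) (C : Subgroup G) : Prop where
  nonempty : D.Nonempty
  conn : ∀ z ∈ D, ∀ z' ∈ D, Relation.ReflTransGen (fun a b => Adj a b ∧ a ∈ D ∧ b ∈ D) z z'
  smul_mem : ∀ c ∈ C, ∀ z ∈ D, c • z ∈ D
  emb : ∀ n ∈ N, ∀ z ∈ D, n • z ∈ D → n ∈ C

variable {Adj : Z → Z → Prop} {N : Subgroup G}

theorem GoodPair.conj (hAdj : ∀ (g : G) a b, Adj a b → Adj (g • a) (g • b)) {D : Set Z}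
    {C : Subgroup G} (h : GoodPair Adj N D C) {n : G} (hn : n ∈ N) :
    GoodPair Adj N ((n • ·) ⁻¹' D) (C.conjBy n⁻¹) where
  nonempty := by
    obtain ⟨z, hz⟩ := h.nonempty
    exact ⟨n⁻¹ • z, by simpa using hz⟩
  conn z hz z' hz' := by
    have := (h.conn _ hz _ hz').lift (n⁻¹ • ·)
      (p := fun a b => Adj a b ∧ a ∈ (n • ·) ⁻¹' D ∧ b ∈ (n • ·) ⁻¹' D)
      (fun a b hab => ⟨hAdj _ _ _ hab.1, by simpa using hab.2.1, by simpa using hab.2.2⟩)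
    simpa [Function.onFun] using this
  smul_mem c hc z hz := by
    have := h.smul_mem _ (Subgroup.mem_conjBy.1 hc) _ hz
    simpa [mul_smul] using this
  emb x hx z hz hxz := by
    rw [Subgroup.mem_conjBy]
    refine h.emb _ (by
      rw [inv_inv]; exact N.mul_mem (N.mul_mem hn hx) (N.inv_mem hn)) _ hz ?_
    simpa [mul_smul] using hxz

/-- The orbits under `N` of the edges in `D`, for given orbit representatives. -/
def edgeKeys (Adj : Z → Z → Prop) (ν : Z → G) (D : Set Z) : Set (Z × Z) :=
  {p | ∃ z ∈ D, ∃ y ∈ D, Adj z y ∧ p = (ν z • z, ν z • y)}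

/-- The pairs of orbits under `N` of points of `D` in the same orbit under `C`. -/
def orbitKeys (ν : Z → G) (D : Set Z) (C : Subgroup G) : Set (Z × Z) :=
  {p | ∃ z ∈ D, ∃ c ∈ C, p = (ν z • z, ν (c • z) • c • z)}

variable {ν : Z → G} (hν : ∀ z, ν z ∈ N)
include hν

/-- Follow `D` edge by edge from `r`. Each edge is an `N`-translate of an edge of `D'`. The
translating element takes a point of `D'` to the point of `D'` already reached, so by `emb` it lies
in `C'` and keeps the whole edge in `D'`. -/
theorem GoodPair.subset_of_keys {D D' : Set Z} {C C' : Subgroup G} (h : GoodPair Adj N D C)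
    (h' : GoodPair Adj N D' C') {r : Z} (hr : r ∈ D) (hr' : r ∈ D')
    (hE : edgeKeys Adj ν D ⊆ edgeKeys Adj ν D') : D ⊆ D' := by
  intro z hz
  have := h.conn r hr z hz
  induction this with
  | refl => exact hr'
  | @tail b c _ hbc ih =>
    obtain ⟨z', hz', y', hy', hadj, he⟩ := hE ⟨b, hbc.2.1, c, hbc.2.2, hbc.1, rfl⟩
    rw [Prod.mk.injEq] at he
    have h1 : ((ν b)⁻¹ * ν z') • z' = b := by rw [mul_smul, ← he.1, inv_smul_smul]
    have h2 : ((ν b)⁻¹ * ν z') • y' = c := by rw [mul_smul, ← he.2, inv_smul_smul]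
    have hn : (ν b)⁻¹ * ν z' ∈ C' :=
      h'.emb _ (N.mul_mem (N.inv_mem (hν b)) (hν z')) z' hz' (h1.symm ▸ ih hbc.2.1)
    exact h2 ▸ h'.smul_mem _ hn _ hy'

/-- The orbits of `r` and `c • r` are also those of `z'` and `c' • z'` for some `c'` in `C'`. By
`emb` the translations between these points lie in `C'`; combined with `c'` they give an element of
`C'` that agrees with `c` at `r`, and the action is free. -/
theorem GoodPair.le_of_keys (hfree : ∀ (g : G) (z : Z), g • z = z → g = 1) {D D' : Set Z}
    {C C' : Subgroup G} (h : GoodPair Adj N D C) (h' : GoodPair Adj N D' C') {r : Z} (hr : r ∈ D)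
    (hr' : r ∈ D') (hE : edgeKeys Adj ν D ⊆ edgeKeys Adj ν D')
    (hC : orbitKeys ν D C ⊆ orbitKeys ν D' C') : C ≤ C' := by
  have hsub := h.subset_of_keys hν h' hr hr' hE
  intro c hc
  obtain ⟨z', hz', c', hc', he⟩ := hC ⟨r, hr, c, hc, rfl⟩
  rw [Prod.mk.injEq] at he
  have h1 : ((ν r)⁻¹ * ν z') • z' = r := by rw [mul_smul, ← he.1, inv_smul_smul]
  have h2 : ((ν (c • r))⁻¹ * ν (c' • z')) • c' • z' = c • r := by
    rw [mul_smul, ← he.2, inv_smul_smul]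
  have n1 : (ν r)⁻¹ * ν z' ∈ C' :=
    h'.emb _ (N.mul_mem (N.inv_mem (hν _)) (hν _)) z' hz' (h1.symm ▸ hr')
  have n2 : (ν (c • r))⁻¹ * ν (c' • z') ∈ C' :=
    h'.emb _ (N.mul_mem (N.inv_mem (hν _)) (hν _)) _ (h'.smul_mem _ hc' _ hz')
      (h2.symm ▸ hsub (h.smul_mem _ hc _ hr))
  set n := (ν r)⁻¹ * ν z'
  set n' := (ν (c • r))⁻¹ * ν (c' • z')
  have h3 : (c⁻¹ * (n' * c' * n⁻¹)) • r = r := by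
    rw [mul_smul, mul_smul, mul_smul, ← h1, inv_smul_smul, h2, h1, inv_smul_smul]
  have h4 := hfree _ _ h3
  have h5 : c = n' * c' * n⁻¹ := by rw [inv_mul_eq_one] at h4; exact h4
  rw [h5]
  exact C'.mul_mem (C'.mul_mem n2 hc') (C'.inv_mem n1)

omit hν in
/-- If a good pair can be shrunk so as to intersect the group with each member of a family, then
there are finitely many conjugacy classes of intersections with members of the family. -/
theorem exists_finite_types (hAdj : ∀ (g : G) a b, Adj a b → Adj (g • a) (g • b))
    (hfree : ∀ (g : G) (z : Z), g • z = z → g = 1)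
    {R : Set Z} (hR : R.Finite) (hRN : ∀ z, ∃ n ∈ N, n • z ∈ R)
    (hloc : ∀ z, {y | Adj z y}.Finite)
    {P : Set Z → Subgroup G → Prop} (hP : ∀ {D C}, P D C → GoodPair Adj N D C)
    {J : Type*} {K : J → Subgroup G}
    (hstep : ∀ D C, P D C → ∀ j, ∃ D', D' ⊆ D ∧ P D' (C ⊓ K j))
    {D₀ : Set Z} {H : Subgroup G} (h₀ : P D₀ H) :
    ∃ F : Set (Subgroup G), F.Finite ∧
      ∀ T : Set J, ∃ L ∈ F, ∃ h ∈ H, H ⊓ ⨅ j ∈ T, K j = L.conjBy h := by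
  classical
  choose ν hν hνR using hRN
  set A : Set (Z × Z) := ⋃ r ∈ R, (Prod.mk r) '' {y | Adj r y} with hA
  have hAfin : A.Finite := hR.biUnion fun r _ => (hloc r).image _
  have hBfin : (R ×ˢ R).Finite := hR.prod hR
  have hEA : ∀ D, edgeKeys Adj ν D ⊆ A := by
    rintro D _ ⟨z, -, y, -, hadj, rfl⟩
    simp only [hA, Set.mem_iUnion]
    exact ⟨_, hνR z, _, hAdj _ _ _ hadj, rfl⟩
  have hCB : ∀ D C, orbitKeys ν D C ⊆ R ×ˢ R := by
    rintro D C _ ⟨z, -, c, -, rfl⟩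
    exact ⟨hνR _, hνR _⟩
  -- Two points of `D₀` in one `N`-orbit differ by an element of `H`, by `emb`; so `D₀` is covered
  -- by the translates under `N ⊓ H` of finitely many points.
  have hrep : ∃ Q : Set Z, Q.Finite ∧ ∀ z ∈ D₀, ∃ d ∈ Q, ∃ n ∈ N, n ∈ H ∧ n • d = z := by
    have hfin : ((fun z => ν z • z) '' D₀).Finite :=
      hR.subset (by rintro _ ⟨z, -, rfl⟩; exact hνR z)
    obtain ⟨Q, hQ, hQfin, hQeq⟩ := Set.exists_subset_bijOn D₀ (fun z => ν z • z) |>.imp fun Q hQ =>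
      show Q ⊆ D₀ ∧ Q.Finite ∧ (fun z => ν z • z) '' Q = (fun z => ν z • z) '' D₀ from
        ⟨hQ.1, (Set.Finite.of_finite_image (hQ.2.image_eq ▸ hfin) hQ.2.injOn), hQ.2.image_eq⟩
    refine ⟨Q, hQfin, fun z hz => ?_⟩
    obtain ⟨d, hd, hdz⟩ : (fun z => ν z • z) z ∈ (fun z => ν z • z) '' Q :=
      hQeq ▸ ⟨z, hz, rfl⟩
    have h1 : ((ν z)⁻¹ * ν d) • d = z := by
      rw [mul_smul]; simp only at hdz; rw [hdz, inv_smul_smul]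
    have h2 := N.mul_mem (N.inv_mem (hν z)) (hν d)
    exact ⟨d, hd, _, h2, (hP h₀).emb _ h2 d (hQ hd) (h1.symm ▸ hz), h1⟩
  obtain ⟨Q, hQ, hQrep⟩ := hrep
  -- The candidates are the groups of good pairs through a representative. Such a group is
  -- determined by its two sets of keys, which are subsets of the finite sets `A` and `R ×ˢ R`.
  refine ⟨⋃ d ∈ Q, {C | ∃ D, GoodPair Adj N D C ∧ d ∈ D}, hQ.biUnion fun d _ => ?_, ?_⟩
  · choose! f hf using fun (C : Subgroup G) (hC : C ∈ {C | ∃ D, GoodPair Adj N D C ∧ d ∈ D}) => hC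
    refine Set.Finite.of_finite_image (f := fun C => (edgeKeys Adj ν (f C), orbitKeys ν (f C) C))
      ((hAfin.finite_subsets.prod hBfin.finite_subsets).subset ?_) ?_
    · rintro _ ⟨C, -, rfl⟩
      exact ⟨hEA _, hCB _ _⟩
    · intro C hC C' hC' he
      simp only [Prod.mk.injEq] at he
      obtain ⟨g1, d1⟩ := hf C hC
      obtain ⟨g2, d2⟩ := hf C' hC'
      exact le_antisymm (g1.le_of_keys hν hfree g2 d1 d2 he.1.subset he.2.subset)
        (g2.le_of_keys hν hfree g1 d2 d1 he.1.superset he.2.superset)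
  · intro T
    set CT := H ⊓ ⨅ j ∈ T, K j with hCT
    -- Minimize the number of keys among the admissible pairs whose group contains the intersection.
    -- Shrinking a minimal pair by any `K j` loses no key, and by `le_of_keys` it does not change
    -- the group either.
    let μ : Set Z × Subgroup G → ℕ := fun p =>
      (edgeKeys Adj ν p.1).ncard + (orbitKeys ν p.1 p.2).ncard
    let W : Set (Set Z × Subgroup G) := {p | P p.1 p.2 ∧ p.1 ⊆ D₀ ∧ p.2 ≤ H ∧ CT ≤ p.2}
    have hW : W.Nonempty := ⟨(D₀, H), h₀, le_rfl, le_rfl, inf_le_left⟩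
    obtain ⟨⟨D, C⟩, ⟨hPD, hsub, hCH, hCTC⟩, hmin⟩ : ∃ p ∈ W, ∀ q ∈ W, μ p ≤ μ q :=
      ⟨_, Function.argminOn_mem μ W hW, fun q hq => Function.argminOn_le μ W hq⟩
    have hle : C ≤ CT := by
      refine le_inf hCH (le_iInf₂ fun j hj => ?_)
      obtain ⟨D', hD', hPD'⟩ := hstep D C hPD j
      have hq := hmin (D', C ⊓ K j) ⟨hPD', hD'.trans hsub, inf_le_left.trans hCH,
        le_inf hCTC (inf_le_right.trans (iInf₂_le j hj))⟩
      have s1 : edgeKeys Adj ν D' ⊆ edgeKeys Adj ν D := by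
        rintro _ ⟨z, hz, y, hy, h⟩
        exact ⟨z, hD' hz, y, hD' hy, h⟩
      have s2 : orbitKeys ν D' (C ⊓ K j) ⊆ orbitKeys ν D C := by
        rintro _ ⟨z, hz, c, hc, h⟩
        exact ⟨z, hD' hz, c, hc.1, h⟩
      have f1 := hAfin.subset (hEA D)
      have f2 := hBfin.subset (hCB D C)
      have l1 := Set.ncard_le_ncard s1 f1
      have l2 := Set.ncard_le_ncard s2 f2
      simp only [μ] at hq
      have e1 := Set.eq_of_subset_of_ncard_le s1 (by omega) f1
      have e2 := Set.eq_of_subset_of_ncard_le s2 (by omega) f2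
      obtain ⟨r, hr⟩ := (hP hPD').nonempty
      exact ((hP hPD).le_of_keys hν hfree (hP hPD') (hD' hr) hr e1.superset e2.superset).trans
        inf_le_right
    have hC : CT = C := le_antisymm hCTC hle
    obtain ⟨z, hz⟩ := (hP hPD).nonempty
    -- Translate the minimal pair by an element of `N ⊓ H` so that it passes through a
    -- representative.
    obtain ⟨d, hd, n, hn, hnH, rfl⟩ := hQrep z (hsub hz)
    refine ⟨C.conjBy n⁻¹, Set.mem_biUnion hd ⟨_, (hP hPD).conj hAdj hn, hz⟩, n, hnH, ?_⟩
    rw [hC]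
    ext x
    simp [Subgroup.mem_conjBy, mul_assoc]

end GoodPairs

/-! ### Edges, squares and their symmetries -/

namespace CubeComplex

variable (X : CubeComplex.{u})

theorem rev_rev (a : X.cube 1) : X.rev (X.rev a) = a := by
  unfold rev
  rw [← X.face_comp]
  have : CubeMap.flip.comp CubeMap.flip = CubeMap.id 1 := by
    ext1; funext k; obtain rfl := Subsingleton.elim k 0; rfl
  rw [this, X.face_id]

theorem src_rev (a : X.cube 1) : X.src (X.rev a) = X.tgt a := by
  unfold src rev tgt
  rw [← X.face_comp]; rfl

theorem tgt_rev (a : X.cube 1) : X.tgt (X.rev a) = X.src a := by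
  unfold src rev tgt
  rw [← X.face_comp]; rfl

theorem face_axis_vertex {n : ℕ} (c : X.cube n) (i : Fin n) (b : Fin n → Bool) (t : Bool) :
    X.face (CubeMap.vertex fun _ => t) (X.face (CubeMap.axis i b) c) =
      X.face (CubeMap.vertex (Function.update b i t)) c := by
  rw [← X.face_comp]
  congr 1
  ext1; funext k
  by_cases h : k = i
  · subst h; simp [CubeMap.comp, CubeMap.axis, CubeMap.vertex, Coord.subst]
  · simp [CubeMap.comp, CubeMap.axis, CubeMap.vertex, Coord.subst, h]

theorem src_cornerEdge {n : ℕ} (c : X.cube n) (i : Fin n) : X.src (X.cornerEdge c i) = X.corner c := by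
  unfold src cornerEdge corner
  rw [face_axis_vertex]
  congr 2
  exact Function.update_eq_self i fun _ : Fin n => false

theorem tgt_cornerEdge_zero (c : X.cube 2) :
    X.tgt (X.cornerEdge c 0) = X.src (X.oppositeEdge c 1) := by
  unfold src tgt cornerEdge oppositeEdge
  rw [face_axis_vertex, face_axis_vertex]
  congr 2
  funext k; fin_cases k <;> rfl

theorem tgt_cornerEdge_one (c : X.cube 2) :
    X.tgt (X.cornerEdge c 1) = X.src (X.oppositeEdge c 0) := by
  unfold src tgt cornerEdge oppositeEdge
  rw [face_axis_vertex, face_axis_vertex]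
  congr 2
  funext k; fin_cases k <;> rfl

theorem tgt_oppositeEdge (c : X.cube 2) :
    X.tgt (X.oppositeEdge c 1) = X.tgt (X.oppositeEdge c 0) := by
  unfold tgt oppositeEdge
  rw [face_axis_vertex, face_axis_vertex]
  congr 2
  funext k; fin_cases k <;> rfl

end CubeComplex

/-- Exchange the coordinates of a square. -/
def CubeMap.swapSquare : CubeMap 2 2 where
  coord j := .var (1 - j) false
  used i := ⟨1 - i, ⟨false, by fin_cases i <;> rfl⟩, by
    rintro j ⟨s, h⟩
    have := (Coord.var.inj h).1
    fin_cases i <;> fin_cases j <;> simp_all⟩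

/-- Flip one coordinate of a square. -/
def CubeMap.flipAt (i : Fin 2) : CubeMap 2 2 where
  coord j := .var j (j = i)
  used k := ⟨k, ⟨(k = i : Bool), rfl⟩, by
    rintro j ⟨s, h⟩
    exact (Coord.var.inj h).1⟩

namespace CubeComplex

variable (X : CubeComplex.{u})

theorem SpanSquare.symm {X : CubeComplex.{u}} {a b : X.cube 1} (h : X.SpanSquare a b) :
    X.SpanSquare b a := by
  obtain ⟨c, rfl, rfl⟩ := h
  refine ⟨X.face CubeMap.swapSquare c, ?_, ?_⟩ <;>
  · unfold cornerEdge
    rw [← X.face_comp]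
    congr 1
    ext1; funext k
    fin_cases k <;> rfl

theorem spanSquare_rev (c : X.cube 2) :
    X.SpanSquare (X.rev (X.cornerEdge c 0)) (X.oppositeEdge c 1) := by
  refine ⟨X.face (CubeMap.flipAt 0) c, ?_, ?_⟩ <;>
  · unfold cornerEdge
    first | unfold rev | unfold oppositeEdge
    simp only [← X.face_comp]
    congr 1
    ext1; funext k
    fin_cases k <;> rfl

/-! ### The fundamental groupoid -/

variable {X}

/-- The class of an edge. -/
def arr {x y : X.Vertex} (a : x ⟶ y) : X.pt x ⟶ X.pt y :=
  (CategoryTheory.Quotient.functor X.ElementaryHomotopy).map (Quiver.Hom.toPath a)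

/-- The class of an edge path. -/
def cls {x y : X.Vertex} (p : Quiver.Path x y) : X.pt x ⟶ X.pt y :=
  (CategoryTheory.Quotient.functor X.ElementaryHomotopy).map (X := x) (Y := y) p

theorem cls_cons {x y z : X.Vertex} (p : Quiver.Path x y) (a : y ⟶ z) :
    cls (p.cons a) = cls p ≫ arr a :=
  (CategoryTheory.Quotient.functor X.ElementaryHomotopy).map_comp (X := x) (Y := y) (Z := z) p
    (Quiver.Hom.toPath a)

theorem exists_cls {x y : X.Vertex} (g : X.pt x ⟶ X.pt y) : ∃ p : Quiver.Path x y, cls p = g :=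
  (CategoryTheory.Quotient.functor X.ElementaryHomotopy).map_surjective g

theorem hom_induction {x : X.Vertex} {motive : ∀ y : X.Vertex, (X.pt x ⟶ X.pt y) → Prop}
    (nil : motive x (𝟙 _))
    (cons : ∀ (y z : X.Vertex) (g : X.pt x ⟶ X.pt y) (a : y ⟶ z), motive y g →
      motive z (g ≫ arr a)) {y : X.Vertex} (g : X.pt x ⟶ X.pt y) : motive y g := by
  obtain ⟨p, rfl⟩ := exists_cls g
  induction p with
  | nil => exact nil
  | cons p a ih => rw [cls_cons]; exact cons _ _ _ _ ih

/-- The reversed edge. -/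
def revArr {x y : X.Vertex} (a : x ⟶ y) : y ⟶ x :=
  ⟨X.rev a.1, (X.src_rev _).trans a.2.2, (X.tgt_rev _).trans a.2.1⟩

theorem arr_revArr {x y : X.Vertex} (a : x ⟶ y) : arr a ≫ arr (revArr a) = 𝟙 _ :=
  CategoryTheory.Quotient.sound _ (ElementaryHomotopy.backtrack a (revArr a) rfl)

theorem revArr_arr {x y : X.Vertex} (a : x ⟶ y) : arr (revArr a) ≫ arr a = 𝟙 _ :=
  CategoryTheory.Quotient.sound _ (ElementaryHomotopy.backtrack (revArr a) a (X.rev_rev _).symm)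

theorem arr_square {x y y' z : X.Vertex} (c : X.cube 2) (a : x ⟶ y) (b : y ⟶ z) (a' : x ⟶ y')
    (b' : y' ⟶ z) (ha : a.1 = X.cornerEdge c 0) (hb : b.1 = X.oppositeEdge c 1)
    (ha' : a'.1 = X.cornerEdge c 1) (hb' : b'.1 = X.oppositeEdge c 0) :
    arr a ≫ arr b = arr a' ≫ arr b' :=
  CategoryTheory.Quotient.sound _ (ElementaryHomotopy.square c a b a' b' ha hb ha' hb')

theorem isIso_hom {x y : X.Vertex} (g : X.pt x ⟶ X.pt y) : IsIso g := by
  induction g using hom_induction with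
  | nil => infer_instance
  | cons y z g a ih =>
    have : IsIso (arr a) := ⟨arr (revArr a), arr_revArr a, revArr_arr a⟩
    infer_instance

instance {x y : X.FundGroupoid} (g : x ⟶ y) : IsIso g := isIso_hom (x := x.as) (y := y.as) g

/-! ### The vertices of the universal cover -/

/-- The vertices of the universal cover: path classes that start at the base point. -/
structure Univ (X : CubeComplex.{u}) (x : X.Vertex) : Type u where
  vtx : X.Vertex
  hom : X.pt x ⟶ X.pt vtx

theorem Univ.mk_congr {x : X.Vertex} {y : X.Vertex} {p q : X.pt x ⟶ X.pt y} (h : p = q) :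
    (⟨y, p⟩ : X.Univ x) = ⟨y, q⟩ := by rw [h]

theorem Univ.hom_eq {x : X.Vertex} {y : X.Vertex} {p q : X.pt x ⟶ X.pt y}
    (h : (⟨y, p⟩ : X.Univ x) = ⟨y, q⟩) : p = q := eq_of_heq (Univ.mk.inj h).2

/-- The base point of the universal cover. -/
def Univ.base (X : CubeComplex.{u}) (x : X.Vertex) : X.Univ x := ⟨x, 𝟙 _⟩

/-- The product of `Aut` composes in the order opposite to paths, so it is precomposition with the
inverse that gives a left action. -/
instance (x : X.Vertex) : MulAction (X.Pi1 x) (X.Univ x) where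
  smul g z := ⟨z.1, g.inv ≫ z.2⟩
  one_smul _ := Univ.mk_congr (Category.id_comp _)
  mul_smul _ _ _ := Univ.mk_congr (Category.assoc _ _ _)

theorem smul_free {x : X.Vertex} (g : X.Pi1 x) (z : X.Univ x) (h : g • z = z) : g = 1 := by
  obtain ⟨y, p⟩ := z
  have h1 : g.inv ≫ p = 𝟙 _ ≫ p := by simpa using Univ.hom_eq h
  have h2 : g.inv = 𝟙 _ := (cancel_mono p).1 h1
  have h3 : g⁻¹ = 1 := Iso.ext h2
  exact inv_eq_one.1 h3

theorem exists_smul_eq {x : X.Vertex} (z z' : X.Univ x) (h : z.1 = z'.1) :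
    ∃ g : X.Pi1 x, g • z = z' := by
  obtain ⟨y, p⟩ := z
  obtain ⟨y', p'⟩ := z'
  obtain rfl : y = y' := h
  exact ⟨(asIso (p' ≫ inv p)).symm, Univ.mk_congr (by simp)⟩

end CubeComplex

/-! ### Images of universal covers and the subgroups that act on them -/

namespace CubicalMap

open CubeComplex

variable {A X B : CubeComplex.{u}}

/-- The map on path classes. -/
def mapHom (f : CubicalMap A X) {a b : A.Vertex} (p : A.pt a ⟶ A.pt b) :
    X.pt (f.onVertex a) ⟶ X.pt (f.onVertex b) := f.onGroupoid.map p

theorem mapHom_comp (f : CubicalMap A X) {a b c : A.Vertex} (p : A.pt a ⟶ A.pt b)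
    (q : A.pt b ⟶ A.pt c) : f.mapHom (p ≫ q) = f.mapHom p ≫ f.mapHom q :=
  f.onGroupoid.map_comp p q

theorem mapHom_id (f : CubicalMap A X) (a : A.Vertex) : f.mapHom (𝟙 (A.pt a)) = 𝟙 _ :=
  f.onGroupoid.map_id _

/-- The image of an edge. -/
def mapArr (f : CubicalMap A X) {a b : A.Vertex} (e : a ⟶ b) : f.onVertex a ⟶ f.onVertex b :=
  f.toPrefunctor.map e

theorem mapHom_arr (f : CubicalMap A X) {a b : A.Vertex} (e : a ⟶ b) :
    f.mapHom (arr e) = arr (f.mapArr e) := rfl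

theorem mapHom_inv (f : CubicalMap A X) {a b : A.Vertex} (p : A.pt a ⟶ A.pt b) :
    f.mapHom (inv p) = inv (f.mapHom p) := f.onGroupoid.map_inv p

/-- The map of universal covers that sends the base point to `q`. -/
def univMap (f : CubicalMap A X) (a : A.Vertex) {x : X.Vertex} (q : X.pt x ⟶ X.pt (f.onVertex a))
    (u : A.Univ a) : X.Univ x := ⟨f.onVertex u.1, q ≫ f.mapHom u.2⟩

/-- The image of the universal cover under `univMap`. -/
def orb (f : CubicalMap A X) (a : A.Vertex) {x : X.Vertex} (q : X.pt x ⟶ X.pt (f.onVertex a)) :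
    Set (X.Univ x) := Set.range (f.univMap a q)

/-- The fundamental group of the source, as a subgroup that acts on `orb`. -/
def stab (f : CubicalMap A X) (a : A.Vertex) {x : X.Vertex} (q : X.pt x ⟶ X.pt (f.onVertex a)) :
    Subgroup (X.Pi1 x) where
  carrier := {g | ∃ h : A.pt a ⟶ A.pt a, g.inv ≫ q = q ≫ f.mapHom h}
  one_mem' := ⟨𝟙 _, by rw [mapHom_id, Category.comp_id]; exact Category.id_comp _⟩
  mul_mem' := by
    rintro g g' ⟨h, hh⟩ ⟨h', hh'⟩
    refine ⟨h ≫ h', ?_⟩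
    change (g.inv ≫ g'.inv) ≫ q = _
    rw [mapHom_comp, Category.assoc, hh', ← Category.assoc, hh, Category.assoc]
  inv_mem' := by
    rintro g ⟨h, hh⟩
    refine ⟨inv h, ?_⟩
    change g.hom ≫ q = _
    rw [mapHom_inv, ← cancel_epi g.inv, ← Category.assoc, g.inv_hom_id, ← Category.assoc, hh]
    simp

variable (f : CubicalMap A X) {x : X.Vertex}

theorem mem_stab {a : A.Vertex} {q : X.pt x ⟶ X.pt (f.onVertex a)} {g : X.Pi1 x} :
    g ∈ f.stab a q ↔ ∃ h : A.pt a ⟶ A.pt a, g.inv ≫ q = q ≫ f.mapHom h := Iff.rfl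

theorem subgroup_eq_stab (a : A.Vertex) (γ : X.PathClass (f.onVertex a) x) :
    f.subgroup a γ = f.stab a γ.inv := by
  ext g
  rw [mem_stab]
  constructor
  · rintro ⟨_, ⟨h, rfl⟩, rfl⟩
    refine ⟨h.inv, ?_⟩
    change (γ.inv ≫ f.mapHom h.inv ≫ γ.hom) ≫ γ.inv = γ.inv ≫ f.mapHom h.inv
    simp
  · rintro ⟨h, hh⟩
    refine ⟨_, ⟨(asIso h).symm, rfl⟩, ?_⟩
    apply Iso.ext
    rw [← cancel_epi g.inv, g.inv_hom_id]
    change g.inv ≫ γ.inv ≫ (f.mapHom (inv h)) ≫ γ.hom = 𝟙 _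
    rw [← Category.assoc, hh, mapHom_inv]
    simp

theorem stab_conjBy {a : A.Vertex} (q : X.pt x ⟶ X.pt (f.onVertex a)) (g : X.Pi1 x) :
    (f.stab a q).conjBy g = f.stab a (g.inv ≫ q) := by
  ext k
  rw [Subgroup.mem_conjBy, mem_stab, mem_stab]
  refine exists_congr fun h => ?_
  change ((g.hom ≫ k.inv) ≫ g.inv) ≫ q = _ ↔ _
  have e : ∀ {W : X.FundGroupoid} (r : X.pt x ⟶ W), g.inv ≫ g.hom ≫ r = r :=
    fun r => Iso.inv_hom_id_assoc g r
  rw [← cancel_epi g.inv]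
  simp only [Category.assoc, e]

theorem orb_comp {a b : A.Vertex} (q : X.pt x ⟶ X.pt (f.onVertex a)) (p : A.pt a ⟶ A.pt b) :
    f.orb b (q ≫ f.mapHom p) = f.orb a q := by
  ext z; constructor
  · rintro ⟨⟨c, r⟩, rfl⟩
    exact ⟨⟨c, p ≫ r⟩, Univ.mk_congr (by rw [mapHom_comp, Category.assoc])⟩
  · rintro ⟨⟨c, r⟩, rfl⟩
    exact ⟨⟨c, inv p ≫ r⟩, Univ.mk_congr (by
      change (q ≫ f.mapHom p) ≫ f.mapHom (inv p ≫ r) = q ≫ f.mapHom r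
      rw [Category.assoc, ← mapHom_comp, IsIso.hom_inv_id_assoc])⟩

theorem stab_comp {a b : A.Vertex} (q : X.pt x ⟶ X.pt (f.onVertex a)) (p : A.pt a ⟶ A.pt b) :
    f.stab b (q ≫ f.mapHom p) = f.stab a q := by
  ext g
  rw [mem_stab, mem_stab]
  constructor
  · rintro ⟨h, hh⟩
    refine ⟨p ≫ h ≫ inv p, ?_⟩
    rw [← cancel_mono (f.mapHom p), Category.assoc, hh]
    simp only [Category.assoc, ← mapHom_comp, IsIso.inv_hom_id, Category.comp_id]
  · rintro ⟨h, hh⟩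
    refine ⟨inv p ≫ h ≫ p, ?_⟩
    rw [← Category.assoc, hh]
    simp only [Category.assoc, ← mapHom_comp, IsIso.hom_inv_id_assoc]

theorem mem_orb_self {a : A.Vertex} (q : X.pt x ⟶ X.pt (f.onVertex a)) :
    (⟨_, q⟩ : X.Univ x) ∈ f.orb a q :=
  ⟨Univ.base A a, Univ.mk_congr (by
    change q ≫ f.mapHom (𝟙 _) = q
    rw [mapHom_id, Category.comp_id])⟩

theorem smul_univMap {a : A.Vertex} {q : X.pt x ⟶ X.pt (f.onVertex a)} {g : X.Pi1 x}
    {h : A.pt a ⟶ A.pt a} (hg : g.inv ≫ q = q ≫ f.mapHom h) (u : A.Univ a) :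
    g • f.univMap a q u = f.univMap a q ⟨u.1, h ≫ u.2⟩ :=
  Univ.mk_congr (by
    change g.inv ≫ q ≫ f.mapHom u.2 = q ≫ f.mapHom (h ≫ u.2)
    rw [mapHom_comp, ← Category.assoc, hg, Category.assoc])

theorem smul_mem_orb {a : A.Vertex} {q : X.pt x ⟶ X.pt (f.onVertex a)} {g : X.Pi1 x}
    (hg : g ∈ f.stab a q) {z : X.Univ x} (hz : z ∈ f.orb a q) : g • z ∈ f.orb a q := by
  obtain ⟨h, hh⟩ := hg
  obtain ⟨u, rfl⟩ := hz
  exact ⟨_, (f.smul_univMap hh u).symm⟩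

/-- The criterion by which good pairs are recognized: it suffices that `g` takes a point of the
image to another one over the same vertex of `A`. The closed path `p' ≫ inv p` then represents `g`.
-/
theorem mem_stab_of_smul {a b : A.Vertex} {q : X.pt x ⟶ X.pt (f.onVertex a)} {g : X.Pi1 x}
    {p p' : A.pt a ⟶ A.pt b} (h : g • f.univMap a q ⟨b, p⟩ = f.univMap a q ⟨b, p'⟩) :
    g ∈ f.stab a q := by
  have h1 : g.inv ≫ q ≫ f.mapHom p = q ≫ f.mapHom p' := Univ.hom_eq h
  refine ⟨p' ≫ inv p, ?_⟩
  rw [← cancel_mono (f.mapHom p), Category.assoc, h1, Category.assoc, ← mapHom_comp]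
  simp

end CubicalMap

/-! ### Holonomy -/

namespace CubeComplex

variable {X : CubeComplex.{u}} {Γ : Type*} [Group Γ]

/-- A labelling of the edges by elements of a group extends to path classes if it is compatible
with reversal and squares. -/
theorem exists_holonomy (ρ : X.cube 1 → Γ) (hrev : ∀ a, ρ (X.rev a) = (ρ a)⁻¹)
    (hsq : ∀ c : X.cube 2, ρ (X.cornerEdge c 0) * ρ (X.oppositeEdge c 1) =
      ρ (X.cornerEdge c 1) * ρ (X.oppositeEdge c 0)) :
    ∃ hol : ∀ {x y : X.Vertex}, (X.pt x ⟶ X.pt y) → Γ,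
      (∀ x, hol (𝟙 (X.pt x)) = 1) ∧
      (∀ {x y z : X.Vertex} (p : X.pt x ⟶ X.pt y) (q : X.pt y ⟶ X.pt z),
        hol (p ≫ q) = hol p * hol q) ∧
      ∀ {x y : X.Vertex} (a : x ⟶ y), hol (arr a) = ρ a.1 := by
  -- Composition in `SingleObj` reverses products; the opposite group makes the holonomy
  -- multiplicative in the order in which a path is traversed.
  let F₀ : X.Vertex ⥤q SingleObj Γᵐᵒᵖ :=
    { obj := fun _ => SingleObj.star _, map := fun a => MulOpposite.op (ρ a.1) }
  have hF : ∀ {x y : X.Vertex} (a : x ⟶ y),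
      (Paths.lift F₀).map (Quiver.Hom.toPath a) = MulOpposite.op (ρ a.1) :=
    fun a => Paths.lift_toPath F₀ a
  have hF2 : ∀ {x y z : X.Vertex} (a : x ⟶ y) (b : y ⟶ z),
      (Paths.lift F₀).map (X := x) (Y := z) (a.toPath.comp b.toPath) =
        MulOpposite.op (ρ a.1 * ρ b.1) := by
    intro x y z a b
    refine ((Paths.lift F₀).map_comp (X := x) (Y := y) (Z := z) a.toPath b.toPath).trans ?_
    rw [hF, hF]; rfl
  let F : X.FundGroupoid ⥤ SingleObj Γᵐᵒᵖ :=
    CategoryTheory.Quotient.lift _ (Paths.lift F₀) (by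
      intro x y p q h
      cases h with
      | backtrack a b h =>
        exact (hF2 a b).trans (by rw [h, hrev, mul_inv_cancel]; rfl)
      | square c a b a' b' ha hb ha' hb' =>
        exact (hF2 a b).trans ((congrArg MulOpposite.op
          (by rw [ha, hb, ha', hb', hsq])).trans (hF2 a' b').symm))
  refine ⟨fun {x y} p => MulOpposite.unop (show Γᵐᵒᵖ from F.map p), ?_, ?_, ?_⟩
  · intro x; exact congrArg MulOpposite.unop (F.map_id (X.pt x))
  · intro x y z p q; exact congrArg MulOpposite.unop (F.map_comp p q)
  · intro x y a
    exact congrArg MulOpposite.unop (hF a)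

end CubeComplex

/-! ### Labellings of edges by letters -/

/-- A labelling of some of the edges by letters: edges at a vertex with commuting labels span a
square, and the labels at a vertex are distinct. -/
structure EdgeLabelling (X : CubeComplex.{u}) (S : Type*) [Letters S] where
  lab : X.cube 1 → Option S
  lab_rev : ∀ {a s}, lab a = some s → lab (X.rev a) = some (Letters.inv s)
  lab_inj : ∀ {a b s}, X.src a = X.src b → lab a = some s → lab b = some s → a = b
  lab_span : ∀ {a b s t}, X.src a = X.src b → lab a = some s → lab b = some t →
    Letters.comm s t → X.SpanSquare a b
  lab_square : ∀ {c s t}, lab (X.cornerEdge c 0) = some s → lab (X.cornerEdge c 1) = some t →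
    lab (X.oppositeEdge c 0) = some s ∧ lab (X.oppositeEdge c 1) = some t ∧ Letters.comm s t

namespace EdgeLabelling

open CubeComplex Letters

variable {X A : CubeComplex.{u}} {S : Type*} [Letters S] (ℓ : EdgeLabelling X S)

/-- All edges are labelled. -/
def IsTotal : Prop := ∀ a, ∃ s, ℓ.lab a = some s

/-- The labelled edges of the universal cover. -/
def step (x : X.Vertex) (z : X.Univ x) (s : S) (z' : X.Univ x) : Prop :=
  ∃ e : z.1 ⟶ z'.1, z.2 ≫ arr e = z'.2 ∧ ℓ.lab e.1 = some s

theorem step_mk {x y y' : X.Vertex} {p : X.pt x ⟶ X.pt y} {p' : X.pt x ⟶ X.pt y'} {s : S} :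
    ℓ.step x ⟨y, p⟩ s ⟨y', p'⟩ ↔ ∃ e : y ⟶ y', p ≫ arr e = p' ∧ ℓ.lab e.1 = some s := Iff.rfl

theorem preSpecialGraph (x : X.Vertex) : PreSpecialGraph (ℓ.step x) where
  inv := by
    rintro ⟨y, p⟩ s ⟨y', p'⟩ h
    obtain ⟨e, rfl, he⟩ := ℓ.step_mk.1 h
    exact ⟨revArr e, by rw [Category.assoc, arr_revArr, Category.comp_id], ℓ.lab_rev he⟩
  det := by
    rintro ⟨y, p⟩ s ⟨a, p₁⟩ ⟨b, p₂⟩ h h'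
    obtain ⟨⟨e, h1, h2⟩, rfl, he⟩ := ℓ.step_mk.1 h
    obtain ⟨⟨e', h1', h2'⟩, rfl, he'⟩ := ℓ.step_mk.1 h'
    obtain rfl : e = e' := ℓ.lab_inj (h1.trans h1'.symm) he he'
    obtain rfl : X.tgt e = a := h2
    obtain rfl : X.tgt e = b := h2'
    rfl
  square := by
    rintro ⟨y, p⟩ s t ⟨a, p₁⟩ ⟨b, p₂⟩ hc h h'
    obtain ⟨e, rfl, he⟩ := ℓ.step_mk.1 h
    obtain ⟨e', rfl, he'⟩ := ℓ.step_mk.1 h'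
    obtain ⟨c, h0, h1⟩ := ℓ.lab_span (e.2.1.trans e'.2.1.symm) he he' hc
    rw [← h0] at he
    rw [← h1] at he'
    obtain ⟨l0, l1, -⟩ := ℓ.lab_square he he'
    let d : a ⟶ X.tgt (X.oppositeEdge c 1) :=
      ⟨X.oppositeEdge c 1, by rw [← X.tgt_cornerEdge_zero, h0]; exact e.2.2, rfl⟩
    let d' : b ⟶ X.tgt (X.oppositeEdge c 1) :=
      ⟨X.oppositeEdge c 0, by rw [← X.tgt_cornerEdge_one, h1]; exact e'.2.2,
        (X.tgt_oppositeEdge c).symm⟩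
    refine ⟨⟨_, (p ≫ arr e) ≫ arr d⟩, ⟨d, rfl, l1⟩, ⟨d', ?_, l0⟩⟩
    simp only [Category.assoc]
    rw [arr_square c e d e' d' h0.symm rfl h1.symm rfl]

theorem step_smul {x : X.Vertex} (g : X.Pi1 x) {z z' : X.Univ x} {s : S} (h : ℓ.step x z s z') :
    ℓ.step x (g • z) s (g • z') := by
  obtain ⟨y, p⟩ := z
  obtain ⟨y', p'⟩ := z'
  obtain ⟨e, rfl, he⟩ := ℓ.step_mk.1 h
  exact ⟨e, Category.assoc _ _ _, he⟩

theorem walk_connected (hℓ : ℓ.IsTotal) {x : X.Vertex} (z z' : X.Univ x) :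
    ∃ w, Walk (ℓ.step x) z w z' := by
  have key : ∀ z : X.Univ x, ∃ w, Walk (ℓ.step x) (Univ.base X x) w z := by
    rintro ⟨y, p⟩
    induction p using hom_induction with
    | nil => exact ⟨[], rfl⟩
    | cons y y' p e ih =>
      obtain ⟨w, hw⟩ := ih
      obtain ⟨s, hs⟩ := hℓ e.1
      exact ⟨w ++ [s], hw.append (.single ⟨e, rfl, hs⟩)⟩
  obtain ⟨w, hw⟩ := key z
  obtain ⟨v, hv⟩ := key z'
  exact ⟨_, ((ℓ.preSpecialGraph x).walk_inv hw).append hv⟩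

/-- The word read along an edge path. -/
def pathWord (lam : X.cube 1 → S) {x : X.Vertex} : ∀ {y : X.Vertex}, Quiver.Path x y → List S
  | _, .nil => []
  | _, .cons p e => pathWord lam p ++ [lam e.1]

omit [Letters S] in
theorem pathWord_comp (lam : X.cube 1 → S) {x y z : X.Vertex} (p : Quiver.Path x y)
    (q : Quiver.Path y z) : pathWord lam (p.comp q) = pathWord lam p ++ pathWord lam q := by
  induction q with
  | nil => simp [pathWord]
  | cons q e ih => simp [pathWord, ih]

theorem nf_pathWord_homotopy {lam : X.cube 1 → S} (hlam : ∀ a, ℓ.lab a = some (lam a))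
    {x a b y : X.Vertex} (f : Quiver.Path x a) {m₁ m₂ : Quiver.Path a b} (g : Quiver.Path b y)
    (h : @ElementaryHomotopy X a b m₁ m₂) :
    SwapEq (nf (pathWord lam (f.comp (m₁.comp g)))) (nf (pathWord lam (f.comp (m₂.comp g)))) := by
  rw [pathWord_comp, pathWord_comp, pathWord_comp, pathWord_comp]
  refine nf_append_congr _ ?_
  cases h with
  | backtrack a b h =>
    have hb : lam b.1 = Letters.inv (lam a.1) := by
      have := ℓ.lab_rev (hlam a.1)
      rw [← h, hlam] at this
      exact Option.some.inj this
    have := nf_backtrack (lam a.1) (pathWord lam g)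
    rw [← hb] at this
    exact this
  | square c a b a' b' ha hb ha' hb' =>
    have h0 := hlam (X.cornerEdge c 0)
    have h1 := hlam (X.cornerEdge c 1)
    obtain ⟨e0, e1, hc⟩ := ℓ.lab_square h0 h1
    rw [hlam, Option.some.injEq] at e0 e1
    rw [← ha, ← ha'] at hc
    rw [← ha, ← hb'] at e0
    rw [← ha', ← hb] at e1
    have := nf_swap hc (pathWord lam g)
    change SwapEq (nf (lam a.1 :: lam b.1 :: pathWord lam g))
      (nf (lam a'.1 :: lam b'.1 :: pathWord lam g))
    rw [e0, e1]
    exact this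

/-- Backtracks and squares become cancellations and swaps, so homotopy classes have a well-defined
reduced word up to swaps. This is the algebraic counterpart of a map to a Salvetti complex. -/
theorem nf_pathWord_eq {lam : X.cube 1 → S} (hlam : ∀ a, ℓ.lab a = some (lam a))
    {x y : X.Vertex} {p q : Quiver.Path x y} (h : cls p = cls q) :
    SwapEq (nf (pathWord lam p)) (nf (pathWord lam q)) := by
  have h' := Quot.eqvGen_exact h
  clear h
  induction h' with
  | rel p q h =>
    obtain ⟨_, _, f, m₁, m₂, g, h⟩ := h
    exact ℓ.nf_pathWord_homotopy hlam f g h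
  | refl p => exact .refl _
  | symm p q _ ih => exact ih.symm
  | trans p q r _ _ ih1 ih2 => exact ih1.trans ih2

theorem exists_path_of_walk {lam : X.cube 1 → S} (hlam : ∀ a, ℓ.lab a = some (lam a))
    {x : X.Vertex} {z z' : X.Univ x} {w : List S} (h : Walk (ℓ.step x) z w z') :
    ∃ p : Quiver.Path z.1 z'.1, z.2 ≫ cls p = z'.2 ∧ pathWord lam p = w := by
  induction w using List.reverseRecOn generalizing z' with
  | nil => cases h; exact ⟨.nil, Category.comp_id _, rfl⟩
  | append_singleton w s ih =>
    obtain ⟨y, h1, h2⟩ := h.split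
    obtain ⟨e, he, hs⟩ := h2.of_single
    obtain ⟨p, hp, rfl⟩ := ih h1
    refine ⟨p.cons e, ?_, ?_⟩
    · rw [cls_cons, ← Category.assoc, hp, he]
    · rw [hlam, Option.some.injEq] at hs
      simp [pathWord, hs]

theorem specialGraph (hℓ : ℓ.IsTotal) (x : X.Vertex) : SpecialGraph (ℓ.step x) where
  toPreSpecialGraph := ℓ.preSpecialGraph x
  label_unique {z z' w v} hw hv rw' rv := by
    choose lam hlam using hℓ
    obtain ⟨p, hp, rfl⟩ := ℓ.exists_path_of_walk hlam hw
    obtain ⟨q, hq, rfl⟩ := ℓ.exists_path_of_walk hlam hv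
    have := ℓ.nf_pathWord_eq hlam ((cancel_epi z.2).1 (hp.trans hq.symm))
    rwa [nf_of_reduced rw', nf_of_reduced rv] at this

end EdgeLabelling

/-! ### Maps that embed links and the labellings they induce -/

/-- A map that is injective on the vertices of links with full image on edges of links. -/
structure CubicalMap.IsLinkEmbedding {A X : CubeComplex.{u}} (f : CubicalMap A X) : Prop where
  inj : ∀ a b : A.cube 1, A.src a = A.src b → f.toFun a = f.toFun b → a = b
  span : ∀ a b : A.cube 1, A.src a = A.src b → X.SpanSquare (f.toFun a) (f.toFun b) →
    A.SpanSquare a b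

namespace CubicalMap

variable {A X B : CubeComplex.{u}}

theorem IsLocalIsometry.isLinkEmbedding {f : CubicalMap A X} (hf : f.IsLocalIsometry) :
    f.IsLinkEmbedding where
  inj := hf.link_injective
  span a b hab h := by
    obtain ⟨c, h0, h1⟩ := h
    obtain ⟨d, -, hd⟩ := hf.link_full (A.src a) 2 ![a, b]
      (by intro i; fin_cases i; exacts [rfl, hab.symm])
      ⟨c, by
        rw [← X.src_cornerEdge c 0, h0]; exact (f.map_face _ _).symm, by
        intro i; fin_cases i; exacts [h0, h1]⟩
    exact ⟨d, hd 0, hd 1⟩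

theorem map_src (f : CubicalMap A X) (a : A.cube 1) :
    X.src (f.toFun a) = f.onVertex (A.src a) := (f.map_face _ _).symm

theorem map_tgt (f : CubicalMap A X) (a : A.cube 1) :
    X.tgt (f.toFun a) = f.onVertex (A.tgt a) := (f.map_face _ _).symm

theorem map_rev (f : CubicalMap A X) (a : A.cube 1) :
    f.toFun (A.rev a) = X.rev (f.toFun a) := f.map_face _ _

theorem map_cornerEdge (f : CubicalMap A X) {n : ℕ} (c : A.cube n) (i : Fin n) :
    f.toFun (A.cornerEdge c i) = X.cornerEdge (f.toFun c) i := f.map_face _ _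

theorem map_oppositeEdge (f : CubicalMap A X) (c : A.cube 2) (i : Fin 2) :
    f.toFun (A.oppositeEdge c i) = X.oppositeEdge (f.toFun c) i := f.map_face _ _

end CubicalMap

namespace EdgeLabelling

open CubeComplex Letters

variable {X A : CubeComplex.{u}} {S : Type*} [Letters S] (ℓ : EdgeLabelling X S)

/-- The labelling of the source of a map that is an embedding of links. -/
def comap (f : CubicalMap A X) (hf : f.IsLinkEmbedding) : EdgeLabelling A S where
  lab a := ℓ.lab (f.toFun a)
  lab_rev h := by rw [f.map_rev]; exact ℓ.lab_rev h
  lab_inj h ha hb := hf.inj _ _ h (ℓ.lab_inj (by rw [f.map_src, f.map_src, h]) ha hb)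
  lab_span h ha hb hc := hf.span _ _ h (ℓ.lab_span (by rw [f.map_src, f.map_src, h]) ha hb hc)
  lab_square h h' := by
    rw [f.map_cornerEdge] at h h'
    rw [f.map_oppositeEdge, f.map_oppositeEdge]
    exact ℓ.lab_square h h'

theorem comap_step {f : CubicalMap A X} {hf : f.IsLinkEmbedding} {a : A.Vertex} {x : X.Vertex}
    (q : X.pt x ⟶ X.pt (f.onVertex a)) (u : A.Univ a) (s : S) (u' : A.Univ a)
    (h : (ℓ.comap f hf).step a u s u') : ℓ.step x (f.univMap a q u) s (f.univMap a q u') := by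
  obtain ⟨y, p⟩ := u
  obtain ⟨y', p'⟩ := u'
  obtain ⟨e, rfl, he⟩ := (ℓ.comap f hf).step_mk.1 h
  refine ⟨f.mapArr e, ?_, he⟩
  change (q ≫ f.mapHom p) ≫ _ = q ≫ f.mapHom (p ≫ arr e)
  rw [CubicalMap.mapHom_comp]; exact Category.assoc _ _ _

variable {f : CubicalMap A X} (hf : f.IsLinkEmbedding) (htot : (ℓ.comap f hf).IsTotal)
  {x : X.Vertex} (hG : SpecialGraph (ℓ.step x)) (a : A.Vertex) (q : X.pt x ⟶ X.pt (f.onVertex a))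
include htot hG

theorem univMap_injective : Function.Injective (f.univMap a q) :=
  hG.map_injective ((ℓ.comap f hf).preSpecialGraph a) ((ℓ.comap f hf).walk_connected htot)
    (ℓ.comap_step q)

theorem orb_convex : ConvexIn (StepAdj (ℓ.step x)) (f.orb a q) :=
  hG.range_convex ((ℓ.comap f hf).preSpecialGraph a) ((ℓ.comap f hf).walk_connected htot)
    (ℓ.comap_step q)

theorem univMap_reflects_step {u u' : A.Univ a} {s : S}
    (h : ℓ.step x (f.univMap a q u) s (f.univMap a q u')) : (ℓ.comap f hf).step a u s u' :=
  hG.map_reflects_step ((ℓ.comap f hf).preSpecialGraph a) ((ℓ.comap f hf).walk_connected htot)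
    (ℓ.comap_step q) h

end EdgeLabelling

/-! ### The labelling of a special cube complex by its hyperplanes -/

namespace CubeComplex

variable {X : CubeComplex.{u}}

/-- Oriented edges up to parallelism. -/
def Hyp (X : CubeComplex.{u}) : Type u := Quot X.Parallel

theorem parallel_equivalence (X : CubeComplex.{u}) : Equivalence X.Parallel :=
  Relation.EqvGen.is_equivalence _

theorem hyp_eq_iff {a b : X.cube 1} :
    (Quot.mk X.Parallel a : X.Hyp) = Quot.mk X.Parallel b ↔ X.Parallel a b :=
  (parallel_equivalence X).quot_mk_eq_iff a b

theorem parallel_opposite (c : X.cube 2) (i : Fin 2) :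
    X.Parallel (X.cornerEdge c i) (X.oppositeEdge c i) := .rel _ _ ⟨c, i, rfl, rfl⟩

theorem rev_cornerEdge (c : X.cube 2) (i : Fin 2) :
    X.rev (X.cornerEdge c i) = X.cornerEdge (X.face (CubeMap.flipAt i) c) i := by
  unfold rev cornerEdge
  simp only [← X.face_comp]
  congr 1
  ext1; funext k
  fin_cases i <;> fin_cases k <;> rfl

theorem rev_oppositeEdge (c : X.cube 2) (i : Fin 2) :
    X.rev (X.oppositeEdge c i) = X.oppositeEdge (X.face (CubeMap.flipAt i) c) i := by
  unfold rev oppositeEdge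
  simp only [← X.face_comp]
  congr 1
  ext1; funext k
  fin_cases i <;> fin_cases k <;> rfl

theorem Parallel.rev {a b : X.cube 1} (h : X.Parallel a b) : X.Parallel (X.rev a) (X.rev b) := by
  induction h with
  | rel a b h =>
    obtain ⟨c, i, rfl, rfl⟩ := h
    rw [rev_cornerEdge, rev_oppositeEdge]
    exact parallel_opposite _ _
  | refl a => exact .refl _
  | symm a b _ ih => exact .symm _ _ ih
  | trans a b c _ _ ih₁ ih₂ => exact .trans _ _ _ ih₁ ih₂

/-- The hyperplanes of a special cube complex as letters. -/
@[reducible]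
def hypLetters (hX : X.IsSpecial) : Letters X.Hyp where
  inv := Quot.map X.rev fun _ _ h => h.rev
  comm s t := ∃ a b, X.SpanSquare a b ∧ s = Quot.mk _ a ∧ t = Quot.mk _ b
  inv_inv := by
    rintro ⟨a⟩
    exact congrArg (Quot.mk _) (X.rev_rev a)
  comm_symm := by
    rintro _ _ ⟨a, b, h, rfl, rfl⟩
    exact ⟨b, a, h.symm, rfl, rfl⟩
  comm_irrefl := by
    rintro s ⟨a, b, h, h1, h2⟩
    exact (hX.embedded a b h).1 (hyp_eq_iff.1 (h1.symm.trans h2))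
  comm_inv := by
    rintro _ _ ⟨_, _, ⟨c, rfl, rfl⟩, rfl, rfl⟩
    exact ⟨_, _, X.spanSquare_rev c, rfl, hyp_eq_iff.2 (parallel_opposite c 1)⟩

/-- The labelling of the edges of a special cube complex by its hyperplanes. -/
def hypLabelling (hX : X.IsSpecial) :
    letI := hypLetters hX
    EdgeLabelling X X.Hyp :=
  letI := hypLetters hX
  { lab := fun a => some (Quot.mk _ a)
    lab_rev := by
      rintro a _ ⟨⟩; rfl
    lab_inj := by
      rintro a b s h ⟨⟩ hb
      exact hX.no_self_osculation a b h (hyp_eq_iff.1 (Option.some.inj hb).symm)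
    lab_span := by
      rintro a b _ _ h ⟨⟩ ⟨⟩ ⟨a', b', hs, h1, h2⟩
      exact hX.no_inter_osculation a' b' a b hs (hyp_eq_iff.1 h1.symm) (hyp_eq_iff.1 h2.symm) h
    lab_square := by
      rintro c _ _ ⟨⟩ ⟨⟩
      exact ⟨congrArg some (hyp_eq_iff.2 (parallel_opposite c 0)).symm,
        congrArg some (hyp_eq_iff.2 (parallel_opposite c 1)).symm, _, _, ⟨c, rfl, rfl⟩, rfl, rfl⟩ }

theorem hypLabelling_isTotal (hX : X.IsSpecial) :
    letI := hypLetters hX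
    (hypLabelling hX).IsTotal := fun _ => ⟨_, rfl⟩

end CubeComplex

/-! ### Good pairs in labelled graphs -/

section Bridges

open Letters

variable {Z S : Type*} [Letters S] {step : Z → S → Z → Prop}

theorem SpecialGraph.near_unique (hG : SpecialGraph step) {D E : Set Z}
    (hD : ConvexIn (StepAdj step) D) (hE : ConvexIn (StepAdj step) E) {m : ℕ}
    (hm : DistLower step D E m) {z z₁ z₂ : Z} {u₁ u₂ : List S} (hz : z ∈ D) (hz₁ : z₁ ∈ E)
    (hz₂ : z₂ ∈ E) (h₁ : Walk step z u₁ z₁) (h₂ : Walk step z u₂ z₂) (l₁ : u₁.length = m)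
    (l₂ : u₂.length = m) : z₁ = z₂ := by
  obtain ⟨v₁, hv₁, r₁, e₁⟩ := hG.exists_reduced h₁
  obtain ⟨v₂, hv₂, r₂, e₂⟩ := hG.exists_reduced h₂
  have := hm _ hz _ hz₁ _ hv₁
  have := hm _ hz _ hz₂ _ hv₂
  exact (hG.bridge_pair hD hE hm hz₁ hz₂ hv₁ hv₂ (by omega) (by omega) r₁ r₂ hz
    (show Walk _ z [] z from rfl) trivial).2.2

variable {G : Type u} [Group G] [MulAction G Z]

/-- A good pair with a convex set. -/
structure GoodConvex (step : Z → S → Z → Prop) (N : Subgroup G) (D : Set Z) (C : Subgroup G) :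
    Prop extends ConvexIn (StepAdj step) D where
  nonempty : D.Nonempty
  smul_mem : ∀ c ∈ C, ∀ z ∈ D, c • z ∈ D
  emb : ∀ n ∈ N, ∀ z ∈ D, n • z ∈ D → n ∈ C

variable {N : Subgroup G}

omit [Letters S] in
theorem GoodConvex.goodPair {D : Set Z} {C : Subgroup G} (h : GoodConvex step N D C) :
    GoodPair (StepAdj step) N D C where
  nonempty := h.nonempty
  conn := h.conn
  smul_mem := h.smul_mem
  emb := h.emb

/-- Shrink a good pair so as to intersect the group with the stabilizer of another convex set. -/
theorem GoodConvex.exists_bridge (hG : SpecialGraph step)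
    (hAdj : ∀ (g : G) a b, StepAdj step a b → StepAdj step (g • a) (g • b))
    (hN : ∀ n ∈ N, ∀ z s z', step z s z' → step (n • z) s (n • z'))
    {D E : Set Z} {C K : Subgroup G} (hD : GoodConvex step N D C) (hE : GoodConvex step N E K)
    {z z' : Z} {w : List S} (hz : z ∈ D) (hz' : z' ∈ E) (hw : Walk step z w z') :
    ∃ D' E' : Set Z, ∃ u : List S, D' ⊆ D ∧ E' ⊆ E ∧
      GoodConvex step N D' (C ⊓ K) ∧ GoodConvex step N E' (C ⊓ K) ∧
      (∀ z ∈ D', ∃ z' ∈ E', Walk step z u z') ∧ (∀ z' ∈ E', ∃ z ∈ D', Walk step z u z') ∧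
      ∀ z₁ ∈ D', ∀ z₂ ∈ D', ∀ z₁' ∈ E', ∀ z₂' ∈ E', Walk step z₁ u z₁' → Walk step z₂ u z₂' →
        (StepAdj step z₁ z₂ ↔ StepAdj step z₁' z₂') := by
  obtain ⟨m, hm, hne⟩ := exists_distLower hz hz' hw
  have hD₁ := hD.toConvexIn
  have hE₁ := hE.toConvexIn
  have hm' := hm.symm hG.toPreSpecialGraph
  obtain ⟨u, lu, hu⟩ := hG.exists_bridge_word hD₁ hE₁ hm hne
  have near' : ∀ {z z' : Z}, z ∈ D → z' ∈ E → Walk step z u z' → z' ∈ nearSet step E D m :=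
    fun {z z'} hz hz' hw => ⟨hz', z, hz, _, hG.walk_inv hw, (length_invWord u).trans lu⟩
  have fwd : ∀ z ∈ nearSet step D E m, ∃ z' ∈ nearSet step E D m, Walk step z u z' := by
    intro z hz
    obtain ⟨z', hz', hw⟩ := hu z hz
    exact ⟨z', near' hz.1 hz' hw, hw⟩
  -- A shortest walk from `z'` to `D` ends in a nearest point of `D`. The walk `u` from that point
  -- leads back to `z'`, because nearest points of `E` are unique.
  have bwd : ∀ z' ∈ nearSet step E D m, ∃ z ∈ nearSet step D E m, Walk step z u z' := by
    rintro z' ⟨hz', z, hz, v, hv, lv⟩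
    have hv' := hG.walk_inv hv
    have lv' := (length_invWord v).trans lv
    have hzD : z ∈ nearSet step D E m := ⟨hz, z', hz', _, hv', lv'⟩
    obtain ⟨z'', hz'', hw⟩ := hu z hzD
    obtain rfl := hG.near_unique hD₁ hE₁ hm hz hz' hz'' hv' hw lv' lu
    exact ⟨z, hzD, hw⟩
  have hNw : ∀ n ∈ N, ∀ {z w z'}, Walk step z w z' → Walk step (n • z) w (n • z') :=
    fun n hn z w z' h => h.map_step (hN n hn)
  refine ⟨nearSet step D E m, nearSet step E D m, u, fun z h => h.1, fun z h => h.1, ?_, ?_, fwd,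
    bwd, ?_⟩
  · refine ⟨hG.nearSet_convex hD₁ hE₁ hm, hne, ?_, ?_⟩
    · intro c hc z hz
      exact nearSet_smul (hAdj c) (hD.smul_mem c hc.1) (hE.smul_mem c hc.2) hz
    -- As `n` preserves labels, it takes the bridge at `z` to the bridge at `n • z`. So it also
    -- takes the far end to a point of `E`, and goodness of `E` applies.
    · intro n hn z hz hnz
      refine ⟨hD.emb n hn z hz.1 hnz.1, ?_⟩
      obtain ⟨z', hz', hw⟩ := hu z hz
      obtain ⟨z'', hz'', hw'⟩ := hu _ hnz
      obtain rfl := hG.walk_det (hNw n hn hw) hw'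
      exact hE.emb n hn z' hz' hz''
  · refine ⟨hG.nearSet_convex hE₁ hD₁ hm', ?_, ?_, ?_⟩
    · obtain ⟨z, hz⟩ := hne
      obtain ⟨z', hz', -⟩ := fwd z hz
      exact ⟨z', hz'⟩
    · intro c hc z hz
      exact nearSet_smul (hAdj c) (hE.smul_mem c hc.2) (hD.smul_mem c hc.1) hz
    · intro n hn z' hz' hnz'
      refine ⟨?_, hE.emb n hn z' hz'.1 hnz'.1⟩
      obtain ⟨z, hz, hw⟩ := bwd z' hz'
      obtain ⟨z₁, hz₁, hw₁⟩ := bwd _ hnz'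
      obtain rfl := hG.walk_det (hG.walk_inv (hNw n hn hw)) (hG.walk_inv hw₁)
      exact hD.emb n hn z hz.1 hz₁.1
  · intro z₁ h₁ z₂ h₂ z₁' h₁' z₂' h₂' w₁ w₂
    exact ⟨hG.bridge_adj hD₁ hE₁ hm lu h₁.1 h₂.1 h₁'.1 h₂'.1 w₁ w₂,
      hG.bridge_adj hE₁ hD₁ hm' ((length_invWord u).trans lu) h₁'.1 h₂'.1 h₁.1 h₂.1
        (hG.walk_inv w₁) (hG.walk_inv w₂)⟩

end Bridges

/-! ### Transport along path classes -/

namespace CubeComplex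

variable {X : CubeComplex.{u}}

/-- Transport along an edge path. -/
def pathMove {T : Type*} (move : T → X.cube 1 → T) {x : X.Vertex} :
    ∀ {y : X.Vertex}, Quiver.Path x y → T → T
  | _, .nil, t => t
  | _, .cons p e, t => move (pathMove move p t) e.1

theorem pathMove_comp {T : Type*} (move : T → X.cube 1 → T) {x y z : X.Vertex}
    (p : Quiver.Path x y) (q : Quiver.Path y z) (t : T) :
    pathMove move (p.comp q) t = pathMove move q (pathMove move p t) := by
  induction q with
  | nil => rfl
  | cons q e ih => simp [pathMove, ih]

theorem pathMove_proj {T : Type*} {π : T → X.Vertex} {move : T → X.cube 1 → T}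
    (hπ : ∀ t a, π t = X.src a → π (move t a) = X.tgt a) {x y : X.Vertex} (p : Quiver.Path x y)
    {t : T} (ht : π t = x) : π (pathMove move p t) = y := by
  induction p with
  | nil => exact ht
  | cons p e ih => exact (hπ _ _ (ih.trans e.2.1.symm)).trans e.2.2

theorem pathMove_homotopy {T : Type*} {π : T → X.Vertex} {move : T → X.cube 1 → T}
    (hrev : ∀ t a, π t = X.src a → move (move t a) (X.rev a) = t)
    (hsq : ∀ t c, π t = X.corner c → move (move t (X.cornerEdge c 0)) (X.oppositeEdge c 1) =
      move (move t (X.cornerEdge c 1)) (X.oppositeEdge c 0))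
    {x y : X.Vertex} {m₁ m₂ : Quiver.Path x y} (h : @ElementaryHomotopy X x y m₁ m₂) {t : T}
    (ht : π t = x) : pathMove move m₁ t = pathMove move m₂ t := by
  cases h with
  | backtrack a b h =>
    change move (move t a.1) b.1 = t
    rw [h, hrev _ _ (ht.trans a.2.1.symm)]
  | square c a b a' b' ha hb ha' hb' =>
    change move (move t a.1) b.1 = move (move t a'.1) b'.1
    rw [ha, hb, ha', hb', hsq]
    rw [← X.src_cornerEdge c 0, ← ha, a.2.1, ht]

/-- An abstract homotopy lifting property. It serves to lift paths to covers and to count crossings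
modulo two. -/
theorem exists_transport {T : Type*} (π : T → X.Vertex) (move : T → X.cube 1 → T)
    (hπ : ∀ t a, π t = X.src a → π (move t a) = X.tgt a)
    (hrev : ∀ t a, π t = X.src a → move (move t a) (X.rev a) = t)
    (hsq : ∀ t c, π t = X.corner c → move (move t (X.cornerEdge c 0)) (X.oppositeEdge c 1) =
      move (move t (X.cornerEdge c 1)) (X.oppositeEdge c 0)) :
    ∃ tr : ∀ {x y : X.Vertex}, (X.pt x ⟶ X.pt y) → T → T,
      (∀ x t, π t = x → tr (𝟙 (X.pt x)) t = t) ∧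
      ∀ {x y z : X.Vertex} (g : X.pt x ⟶ X.pt y) (e : y ⟶ z) t, π t = x →
        tr (g ≫ arr e) t = move (tr g t) e.1 := by
  classical
  let tr : ∀ {x y : X.Vertex}, (X.pt x ⟶ X.pt y) → T → T := fun {x y} g =>
    -- Points of `T` that do not lie over `x` are left fixed, since the hypotheses say nothing about
    -- them.
    Quot.lift (fun (p : Quiver.Path x y) (t : T) => if π t = x then pathMove move p t else t) (by
      rintro p q ⟨a, b, f, m₁, m₂, g, h⟩
      funext t
      by_cases ht : π t = x
      · simp only [ht, if_true]
        refine (pathMove_comp move f (Quiver.Path.comp m₁ g) t).trans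
          (Eq.trans ?_ (pathMove_comp move f (Quiver.Path.comp m₂ g) t).symm)
        refine (pathMove_comp move m₁ g _).trans (Eq.trans ?_ (pathMove_comp move m₂ g _).symm)
        rw [pathMove_homotopy hrev hsq h (pathMove_proj hπ f ht)]
      · simp [ht]) g
  refine ⟨tr, fun x t ht => if_pos ht, fun {x y z} g e t ht => ?_⟩
  obtain ⟨p, rfl⟩ := exists_cls g
  rw [← cls_cons]
  exact (if_pos ht).trans (congrArg (fun s => move s e.1) (if_pos ht).symm)

theorem Univ.extend_congr {x v₁ v₂ w₁ w₂ : X.Vertex} {r₁ : X.pt x ⟶ X.pt v₁}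
    {r₂ : X.pt x ⟶ X.pt v₂} (h : (⟨v₁, r₁⟩ : X.Univ x) = ⟨v₂, r₂⟩) (e₁ : v₁ ⟶ w₁) (e₂ : v₂ ⟶ w₂)
    (he : e₁.1 = e₂.1) : (⟨w₁, r₁ ≫ arr e₁⟩ : X.Univ x) = ⟨w₂, r₂ ≫ arr e₂⟩ := by
  obtain rfl : v₁ = v₂ := congrArg Univ.vtx h
  obtain rfl := Univ.hom_eq h
  obtain ⟨e₁, h1, h2⟩ := e₁
  obtain ⟨e₂, h1', h2'⟩ := e₂
  obtain rfl : e₁ = e₂ := he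
  obtain rfl : X.tgt e₁ = w₁ := h2
  obtain rfl : X.tgt e₁ = w₂ := h2'
  rfl

/-- Two points of the universal cover are joined by an edge. -/
def UnivAdj {x : X.Vertex} (z z' : X.Univ x) : Prop := ∃ e : z.1 ⟶ z'.1, z.2 ≫ arr e = z'.2

theorem UnivAdj.smul {x : X.Vertex} {z z' : X.Univ x} (g : X.Pi1 x) (h : UnivAdj z z') :
    UnivAdj (g • z) (g • z') := by
  obtain ⟨e, he⟩ := h
  refine ⟨e, ?_⟩
  change (g.inv ≫ z.2) ≫ arr e = g.inv ≫ z'.2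
  rw [← he]; exact Category.assoc _ _ _

end CubeComplex

/-! ### Covers -/

namespace CubicalMap

open CubeComplex

variable {Y X : CubeComplex.{u}} {p : CubicalMap Y X}

theorem univMap_arr {y : Y.Vertex} {x : X.Vertex} (q : X.pt x ⟶ X.pt (p.onVertex y))
    {v w : Y.Vertex} (r : Y.pt y ⟶ Y.pt v) (e : v ⟶ w) :
    p.univMap y q ⟨w, r ≫ arr e⟩ = ⟨_, (q ≫ p.mapHom r) ≫ arr (p.mapArr e)⟩ :=
  Univ.mk_congr (by
    change q ≫ p.mapHom (r ≫ arr e) = _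
    rw [mapHom_comp]; exact (Category.assoc _ _ _).symm)

/-- Edges lift uniquely. -/
def LiftsEdges (p : CubicalMap Y X) : Prop :=
  ∀ (y : Y.Vertex) (c : X.cube 1), X.src c = p.onVertex y → ∃ d, Y.src d = y ∧ p.toFun d = c

theorem IsFiniteCover.liftsEdges (hp : p.IsFiniteCover) : p.LiftsEdges := fun y c h => by
  obtain ⟨d, hd, -⟩ := hp.lift_unique y 1 c h
  exact ⟨d, hd⟩

theorem LiftsEdges.univMap_surjective (hp : p.LiftsEdges) {y : Y.Vertex} {x : X.Vertex}
    (q : X.pt x ⟶ X.pt (p.onVertex y)) : Function.Surjective (p.univMap y q) := by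
  have key : ∀ (x' : X.Vertex) (r : X.pt (p.onVertex y) ⟶ X.pt x'),
      ∃ u, p.univMap y q u = ⟨x', q ≫ r⟩ := by
    intro x' r
    induction r using hom_induction with
    | nil => exact ⟨Univ.base Y y, Univ.mk_congr (by
        change q ≫ p.mapHom (𝟙 _) = _
        rw [mapHom_id])⟩
    | cons x' x'' r e ih =>
      obtain ⟨⟨v, g⟩, hu⟩ := ih
      have hv : p.onVertex v = x' := congrArg Univ.vtx hu
      obtain ⟨d, hd, hd'⟩ := hp v e.1 (e.2.1.trans hv.symm)
      let d' : v ⟶ Y.tgt d := ⟨d, hd, rfl⟩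
      refine ⟨⟨Y.tgt d, g ≫ arr d'⟩, ?_⟩
      rw [univMap_arr, ← Category.assoc]
      exact Univ.extend_congr hu _ _ hd'
  rintro ⟨x', r⟩
  obtain ⟨u, hu⟩ := key x' (inv q ≫ r)
  exact ⟨u, by rw [hu, IsIso.hom_inv_id_assoc]⟩

/-- Edges and squares lift uniquely, so path classes of `X` act on the universal cover of `Y` by
lifting. Lifting the image of a point from the base point recovers the point. -/
theorem IsFiniteCover.univMap_injective (hp : p.IsFiniteCover) {y : Y.Vertex} {x : X.Vertex}
    (q : X.pt x ⟶ X.pt (p.onVertex y)) : Function.Injective (p.univMap y q) := by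
  classical
  -- Away from the edges that start below `u` the motion is arbitrary; there `u` is kept.
  have lift1 : ∀ (u : Y.Univ y) (c : X.cube 1), ∃ u' : Y.Univ y, ∀ h : p.onVertex u.1 = X.src c,
      ∃ e : u.1 ⟶ u'.1, u.2 ≫ arr e = u'.2 ∧ p.toFun e.1 = c := by
    intro u c
    by_cases h : p.onVertex u.1 = X.src c
    · obtain ⟨d, hd, hd'⟩ := hp.liftsEdges u.1 c h.symm
      exact ⟨⟨Y.tgt d, u.2 ≫ arr (⟨d, hd, rfl⟩ : u.1 ⟶ Y.tgt d)⟩, fun _ => ⟨_, rfl, hd'⟩⟩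
    · exact ⟨u, fun h' => absurd h' h⟩
  choose move hmove using lift1
  have uniq : ∀ (u : Y.Univ y) {v : Y.Vertex} (e : u.1 ⟶ v),
      move u (p.toFun e.1) = ⟨v, u.2 ≫ arr e⟩ := by
    intro u v e
    obtain ⟨e', he', hp'⟩ := hmove u (p.toFun e.1) (by rw [p.map_src, e.2.1])
    have h1 : e'.1 = e.1 := by
      obtain ⟨d, -, hd⟩ := hp.lift_unique u.1 1 (p.toFun e.1)
        ((p.map_src e.1).trans (congrArg p.onVertex e.2.1))
      exact (hd _ ⟨e'.2.1, hp'⟩).trans (hd _ ⟨e.2.1, rfl⟩).symm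
    have : move u (p.toFun e.1) = ⟨_, u.2 ≫ arr e'⟩ := by rw [he']
    rw [this]
    exact Univ.extend_congr rfl _ _ h1
  obtain ⟨tr, htr1, htr2⟩ := exists_transport (X := X) (fun u : Y.Univ y => p.onVertex u.1) move
    (by
      intro u c h
      obtain ⟨e, -, he⟩ := hmove u c h
      rw [← e.2.2, ← p.map_tgt, he])
    (by
      intro u c h
      obtain ⟨d, hd, rfl⟩ := hp.liftsEdges u.1 c h.symm
      let e : u.1 ⟶ Y.tgt d := ⟨d, hd, rfl⟩
      rw [← p.map_rev, uniq u e]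
      refine (uniq ⟨_, u.2 ≫ arr e⟩ (revArr e)).trans (Univ.mk_congr ?_)
      change (u.2 ≫ arr e) ≫ arr (revArr e) = u.2
      rw [Category.assoc, arr_revArr, Category.comp_id])
    (by
      intro u c h
      obtain ⟨D, ⟨hD, rfl⟩, -⟩ := hp.lift_unique u.1 2 c h.symm
      simp only [← p.map_cornerEdge, ← p.map_oppositeEdge]
      let e₀ : u.1 ⟶ Y.tgt (Y.cornerEdge D 0) := ⟨_, (Y.src_cornerEdge D 0).trans hD, rfl⟩
      let e₁ : u.1 ⟶ Y.tgt (Y.cornerEdge D 1) := ⟨_, (Y.src_cornerEdge D 1).trans hD, rfl⟩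
      let d₁ : Y.tgt (Y.cornerEdge D 0) ⟶ Y.tgt (Y.oppositeEdge D 1) :=
        ⟨_, (Y.tgt_cornerEdge_zero D).symm, rfl⟩
      let d₀ : Y.tgt (Y.cornerEdge D 1) ⟶ Y.tgt (Y.oppositeEdge D 1) :=
        ⟨_, (Y.tgt_cornerEdge_one D).symm, (Y.tgt_oppositeEdge D).symm⟩
      rw [uniq u e₀, uniq u e₁]
      refine (uniq ⟨_, u.2 ≫ arr e₀⟩ d₁).trans
        (Eq.trans (Univ.mk_congr ?_) (uniq ⟨_, u.2 ≫ arr e₁⟩ d₀).symm)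
      change (u.2 ≫ arr e₀) ≫ arr d₁ = (u.2 ≫ arr e₁) ≫ arr d₀
      rw [Category.assoc, Category.assoc, arr_square D e₀ d₁ e₁ d₀ rfl rfl rfl rfl])
  have key : ∀ u : Y.Univ y, tr (p.mapHom u.2) (Univ.base Y y) = u := by
    rintro ⟨v, g⟩
    induction g using hom_induction with
    | nil => exact (congrArg (fun g => tr g (Univ.base Y y)) (p.mapHom_id y)).trans (htr1 _ _ rfl)
    | cons v w g e ih =>
      change tr (p.mapHom (g ≫ arr e)) (Univ.base Y y) = _
      rw [mapHom_comp, mapHom_arr]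
      refine (htr2 (p.mapHom g) (p.mapArr e) _ rfl).trans ?_
      refine (congrArg (fun u => move u _) ih).trans ?_
      exact uniq ⟨v, g⟩ e
  intro u₁ u₂ h
  have h' := congrArg (fun z : X.Univ x => tr (inv q ≫ z.2) (Univ.base Y y)) h
  simp only [univMap, IsIso.inv_hom_id_assoc] at h'
  rw [key, key] at h'
  exact h'

end CubicalMap

/-! ### Completing partial permutations -/

section Completion

open Letters

variable {V S : Type*} [Letters S] {step : V → S → V → Prop}

open Classical in
/-- Follow the edge with the given label if there is one. -/
noncomputable def slide (step : V → S → V → Prop) (v : V) (s : S) : V :=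
  if h : ∃ v', step v s v' then h.choose else v

/-- There is no edge with the given label. -/
def Blocked (step : V → S → V → Prop) (v : V) (s : S) : Prop := ¬ ∃ v', step v s v'

omit [Letters S] in
theorem slide_of_blocked {v : V} {s : S} (h : Blocked step v s) : slide step v s = v := dif_neg h

namespace PreSpecialGraph

variable (hG : PreSpecialGraph step)
include hG

theorem slide_eq {v v' : V} {s : S} (h : step v s v') : slide step v s = v' := by
  have hex : ∃ v', step v s v' := ⟨v', h⟩
  rw [slide, dif_pos hex]
  exact hG.det hex.choose_spec h

theorem slide_slide_inv {v : V} {s : S} (h : ¬ Blocked step v s) :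
    slide step (slide step v s) (Letters.inv s) = v ∧
      ¬ Blocked step (slide step v s) (Letters.inv s) := by
  obtain ⟨v', hv'⟩ := not_not.1 h
  rw [hG.slide_eq hv']
  exact ⟨hG.slide_eq (hG.inv hv'), not_not.2 ⟨_, hG.inv hv'⟩⟩

/-- By completing squares, an edge labelled `t` at one end of an edge labelled `s` forces one at the
other end. -/
theorem blocked_slide {v : V} {s t : S} (hc : comm s t) :
    Blocked step (slide step v s) t ↔ Blocked step v t := by
  by_cases h : Blocked step v s
  · rw [slide_of_blocked h]
  · obtain ⟨v', hv'⟩ := not_not.1 h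
    rw [hG.slide_eq hv']
    refine not_congr ⟨?_, ?_⟩
    · rintro ⟨w, hw⟩
      obtain ⟨y, hy, -⟩ := hG.square (comm_inv hc) (hG.inv hv') hw
      exact ⟨y, hy⟩
    · rintro ⟨w, hw⟩
      obtain ⟨y, hy, -⟩ := hG.square hc hv' hw
      exact ⟨y, hy⟩

theorem slide_comm {v : V} {s t : S} (hc : comm s t) :
    slide step (slide step v s) t = slide step (slide step v t) s := by
  by_cases h : Blocked step v s
  · rw [slide_of_blocked h, slide_of_blocked ((hG.blocked_slide (comm_symm hc)).2 h)]
  · by_cases h' : Blocked step v t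
    · rw [slide_of_blocked h', slide_of_blocked ((hG.blocked_slide hc).2 h')]
    · obtain ⟨a, ha⟩ := not_not.1 h
      obtain ⟨b, hb⟩ := not_not.1 h'
      obtain ⟨w, h1, h2⟩ := hG.square hc ha hb
      rw [hG.slide_eq ha, hG.slide_eq hb, hG.slide_eq h1, hG.slide_eq h2]

end PreSpecialGraph

/-- A choice of direction for each letter and its inverse. -/
def Sheet (S : Type*) [Letters S] : Type _ := {ε : S → Bool // ∀ s, ε (Letters.inv s) = ε s}

open Classical in
/-- Change the direction of a letter. -/
noncomputable def Sheet.flip (ε : Sheet S) (s : S) : Sheet S :=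
  ⟨fun t => if t = s ∨ t = Letters.inv s then !ε.1 t else ε.1 t, by
    intro t
    have h : (Letters.inv t = s ∨ Letters.inv t = Letters.inv s) ↔ (t = s ∨ t = Letters.inv s) := by
      constructor
      · rintro (rfl | h)
        · exact .inr (Letters.inv_inv t).symm
        · exact .inl (by rw [← Letters.inv_inv t, h, Letters.inv_inv])
      · rintro (rfl | rfl)
        · exact .inr rfl
        · exact .inl (Letters.inv_inv s)
    simp only [h, ε.2]⟩

/-- The letter in the direction given by the sheet. -/
def Sheet.dir (ε : Sheet S) (s : S) : S := if ε.1 s then Letters.inv s else s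

theorem Sheet.dir_inv (ε : Sheet S) (s : S) : ε.dir (Letters.inv s) = Letters.inv (ε.dir s) := by
  unfold Sheet.dir
  rw [ε.2]
  split <;> simp

theorem Sheet.flip_flip_inv (ε : Sheet S) (s : S) : (ε.flip s).flip (Letters.inv s) = ε := by
  apply Subtype.ext
  funext t
  have hc : (t = Letters.inv s ∨ t = Letters.inv (Letters.inv s)) ↔
      (t = s ∨ t = Letters.inv s) := by rw [Letters.inv_inv, or_comm]
  by_cases h : t = s ∨ t = Letters.inv s
  · simp only [Sheet.flip, if_pos (hc.2 h), if_pos h, Bool.not_not]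
  · simp only [Sheet.flip, if_neg (mt hc.1 h), if_neg h]

theorem Sheet.dir_flip_inv (ε : Sheet S) (s : S) : (ε.flip s).dir (Letters.inv s) = ε.dir s := by
  unfold Sheet.dir
  rw [(ε.flip s).2]
  simp only [Sheet.flip, true_or, if_true]
  cases ε.1 s <;> simp [Letters.inv_inv]

theorem Sheet.flip_apply_of_comm (ε : Sheet S) {s t : S} (h : comm s t) :
    (ε.flip s).1 t = ε.1 t := by
  have h1 : t ≠ s := (ne_of_comm h).symm
  have h2 : t ≠ Letters.inv s := (ne_of_comm (comm_inv h)).symm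
  simp [Sheet.flip, h1, h2]

theorem Sheet.dir_flip_of_comm (ε : Sheet S) {s t : S} (h : comm s t) :
    (ε.flip s).dir t = ε.dir t := by
  unfold Sheet.dir; rw [ε.flip_apply_of_comm h]

theorem Sheet.flip_comm (ε : Sheet S) (s t : S) : (ε.flip s).flip t = (ε.flip t).flip s := by
  apply Subtype.ext
  funext r
  simp only [Sheet.flip]
  split_ifs <;> rfl

theorem Sheet.comm_dir (ε : Sheet S) {s t : S} (h : comm s t) : comm (ε.dir s) (ε.dir t) := by
  unfold Sheet.dir
  split_ifs
  · exact comm_inv (comm_inv_right h)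
  · exact comm_inv h
  · exact comm_inv_right h
  · exact h

open Classical in
/-- Move along an edge with the given label; at the end of a line of such edges, turn around. -/
noncomputable def bounce (step : V → S → V → Prop) (s : S) (x : V × Sheet S) : V × Sheet S :=
  (slide step x.1 (x.2.dir s), if Blocked step x.1 (x.2.dir s) then x.2.flip s else x.2)

namespace PreSpecialGraph

variable (hG : PreSpecialGraph step)
include hG

/-- A maximal line of edges labelled `s` is doubled to a closed orbit, the sheet recording the
direction of travel. At a blocked end the point stays and the direction is reversed; the inverse
letter, read in the new direction, is blocked there too and reverses it back. -/
theorem bounce_inv (s : S) (x : V × Sheet S) :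
    bounce step (Letters.inv s) (bounce step s x) = x := by
  obtain ⟨v, ε⟩ := x
  by_cases h : Blocked step v (ε.dir s)
  · have h1 : bounce step s (v, ε) = (v, ε.flip s) := by simp [bounce, h, slide_of_blocked h]
    rw [h1]
    simp only [bounce, ε.dir_flip_inv, h, if_true, slide_of_blocked h, ε.flip_flip_inv]
  · obtain ⟨h2, h3⟩ := hG.slide_slide_inv h
    have h1 : bounce step s (v, ε) = (slide step v (ε.dir s), ε) := by simp [bounce, h]
    rw [h1]
    simp only [bounce, ε.dir_inv, h2, h3, if_false]

/-- Commuting letters neither unblock nor redirect one another, so sliding and turning around can be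
done for the two letters independently. -/
theorem bounce_comm {s t : S} (hc : comm s t) (x : V × Sheet S) :
    bounce step s (bounce step t x) = bounce step t (bounce step s x) := by
  classical
  obtain ⟨v, ε⟩ := x
  have hd := ε.comm_dir hc
  have key : ∀ {s t : S}, comm s t → bounce step s (bounce step t (v, ε)) =
      (slide step (slide step v (ε.dir t)) (ε.dir s),
        if Blocked step v (ε.dir s) then
          (if Blocked step v (ε.dir t) then (ε.flip t).flip s else ε.flip s)
        else if Blocked step v (ε.dir t) then ε.flip t else ε) := by
    intro s t hc
    have hd := ε.comm_dir hc
    have hdir : (if Blocked step v (ε.dir t) then ε.flip t else ε).dir s = ε.dir s := by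
      split_ifs
      · exact ε.dir_flip_of_comm (comm_symm hc)
      · rfl
    simp only [bounce, hdir, hG.blocked_slide (comm_symm hd)]
    congr 1
    split_ifs <;> rfl
  rw [key hc, key (comm_symm hc), hG.slide_comm hd, ε.flip_comm]
  congr 1
  split_ifs <;> rfl

/-- The permutation by which a letter acts. -/
noncomputable def bouncePerm (s : S) : Equiv.Perm (V × Sheet S) where
  toFun := bounce step s
  invFun := bounce step (Letters.inv s)
  left_inv := hG.bounce_inv s
  right_inv x := by
    have := hG.bounce_inv (Letters.inv s) x
    rwa [Letters.inv_inv] at this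

omit hG in
theorem bouncePerm_apply (hG : PreSpecialGraph step) (s : S) (x : V × Sheet S) :
    hG.bouncePerm s x = bounce step s x := rfl

theorem bouncePerm_inv (s : S) : hG.bouncePerm (Letters.inv s) = (hG.bouncePerm s)⁻¹ := by
  ext1 x; rfl

theorem bouncePerm_comm {s t : S} (hc : comm s t) :
    hG.bouncePerm s * hG.bouncePerm t = hG.bouncePerm t * hG.bouncePerm s := by
  ext1 x; exact hG.bounce_comm hc x

/-- The sheet without reversed directions is a copy of the graph, on which the permutations extend
the given partial ones. -/
theorem bouncePerm_step {s : S} {v v' : V} (h : step v s v') :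
    hG.bouncePerm s (v, ⟨fun _ => false, fun _ => rfl⟩) = (v', ⟨fun _ => false, fun _ => rfl⟩) := by
  have hd : Sheet.dir (⟨fun _ => false, fun _ => rfl⟩ : Sheet S) s = s := by simp [Sheet.dir]
  have hb : ¬ Blocked step v s := not_not.2 ⟨v', h⟩
  rw [bouncePerm_apply, bounce, hd, if_neg hb, hG.slide_eq h]

end PreSpecialGraph

end Completion

/-! ### A permutation representation that separates vertices -/

namespace EdgeLabelling

open CubeComplex Letters

variable {X : CubeComplex.{u}} {S : Type*} [Letters S] (ℓ : EdgeLabelling X S)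

/-- The labelled edges of the complex. -/
def vertexStep (v : X.Vertex) (s : S) (v' : X.Vertex) : Prop :=
  ∃ e : v ⟶ v', ℓ.lab e.1 = some s

theorem vertexStep_preSpecialGraph : PreSpecialGraph ℓ.vertexStep where
  inv := by
    rintro v s v' ⟨e, he⟩
    exact ⟨revArr e, ℓ.lab_rev he⟩
  det := by
    rintro v s a b ⟨⟨e, h1, h2⟩, he⟩ ⟨⟨e', h1', h2'⟩, he'⟩
    obtain rfl : e = e' := ℓ.lab_inj (h1.trans h1'.symm) he he'
    exact h2.symm.trans h2'
  square := by
    rintro v s t a b hc ⟨e, he⟩ ⟨e', he'⟩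
    obtain ⟨c, h0, h1⟩ := ℓ.lab_span (e.2.1.trans e'.2.1.symm) he he' hc
    rw [← h0] at he
    rw [← h1] at he'
    obtain ⟨l0, l1, -⟩ := ℓ.lab_square he he'
    exact ⟨X.tgt (X.oppositeEdge c 1),
      ⟨⟨X.oppositeEdge c 1, by rw [← X.tgt_cornerEdge_zero, h0]; exact e.2.2, rfl⟩, l1⟩,
      ⟨⟨X.oppositeEdge c 0, by rw [← X.tgt_cornerEdge_one, h1]; exact e'.2.2,
        (X.tgt_oppositeEdge c).symm⟩, l0⟩⟩

/-- Paths of a complex `W` over `X` are detected by a representation of the path classes of `X` by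
permutations of a finite set. -/
theorem exists_separating_holonomy (hℓ : ℓ.IsTotal) {W : CubeComplex.{u}} {f : CubicalMap W X}
    (hf : f.IsLinkEmbedding) :
    ∃ hol : ∀ {x y : X.Vertex}, (X.pt x ⟶ X.pt y) → Equiv.Perm (W.Vertex × Sheet S),
      (∀ x, hol (𝟙 (X.pt x)) = 1) ∧
      (∀ {x y z : X.Vertex} (p : X.pt x ⟶ X.pt y) (q : X.pt y ⟶ X.pt z),
        hol (p ≫ q) = hol p * hol q) ∧
      ∀ {a b : W.Vertex} (g : W.pt a ⟶ W.pt b), hol (f.mapHom g) = 1 → a = b := by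
  choose lam hlam using hℓ
  have hG := (ℓ.comap f hf).vertexStep_preSpecialGraph
  have hinv : ∀ a, lam (X.rev a) = Letters.inv (lam a) := fun a =>
    Option.some.inj ((hlam _).symm.trans (ℓ.lab_rev (hlam a)))
  -- Holonomy multiplies in the order of the path while permutations act on the left. With inverses,
  -- the holonomy of a path from `a` to `b` takes the point over `b` back to the point over `a`.
  obtain ⟨hol, h1, h2, h3⟩ := exists_holonomy (X := X) (fun a => (hG.bouncePerm (lam a))⁻¹)
    (by intro a; rw [hinv, hG.bouncePerm_inv])
    (by
      intro c
      obtain ⟨e0, e1, hc⟩ := ℓ.lab_square (hlam (X.cornerEdge c 0)) (hlam (X.cornerEdge c 1))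
      rw [hlam, Option.some.injEq] at e0 e1
      rw [e0, e1, ← mul_inv_rev, ← mul_inv_rev, hG.bouncePerm_comm hc])
  refine ⟨hol, h1, h2, fun {a b} g hg => ?_⟩
  let o : Sheet S := ⟨fun _ => false, fun _ => rfl⟩
  have key : ∀ {b : W.Vertex} (g : W.pt a ⟶ W.pt b), hol (f.mapHom g) (b, o) = (a, o) := by
    intro b g
    induction g using hom_induction with
    | nil => rw [CubicalMap.mapHom_id, h1]; rfl
    | cons b b' g e ih =>
      rw [CubicalMap.mapHom_comp, h2, CubicalMap.mapHom_arr, h3, Equiv.Perm.mul_apply, ← ih]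
      congr 1
      rw [Equiv.Perm.inv_eq_iff_eq]
      exact (hG.bouncePerm_step ⟨e, hlam _⟩).symm
  have := key g
  have hg' : hol (f.mapHom g) = 1 := hg
  rw [hg'] at this
  exact (congrArg Prod.fst this).symm

end EdgeLabelling

/-! ### Fibre products -/

/-- The fibre product of two cube complexes over a third. -/
def fibreProduct {A Y X : CubeComplex.{u}} (f : CubicalMap A X) (p : CubicalMap Y X) :
    CubeComplex.{u} where
  cube n := {c : A.cube n × Y.cube n // f.toFun c.1 = p.toFun c.2}
  face g c := ⟨(A.face g c.1.1, Y.face g c.1.2), by rw [f.map_face, p.map_face, c.2]⟩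
  face_id c := Subtype.ext (Prod.ext (A.face_id _) (Y.face_id _))
  face_comp g h c := Subtype.ext (Prod.ext (A.face_comp _ _ _) (Y.face_comp _ _ _))
  free g c h := A.free g c.1.1 (congrArg (fun d => d.1.1) h)

namespace fibreProduct

variable {A Y X : CubeComplex.{u}} (f : CubicalMap A X) (p : CubicalMap Y X)

/-- The first projection. -/
def fst : CubicalMap (fibreProduct f p) A where
  toFun c := c.1.1
  map_face _ _ := rfl

/-- The second projection. -/
def snd : CubicalMap (fibreProduct f p) Y where
  toFun c := c.1.2
  map_face _ _ := rfl

/-- A square in `Y` and one in `A` over the same pair of edges of `X` have the same image: in a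
nonpositively curved complex two edges at a vertex determine the square that they span. So the two
squares form a square of the fibre product. -/
theorem snd_isLinkEmbedding (hX : X.IsNonpositivelyCurved) {f : CubicalMap A X}
    (hf : f.IsLinkEmbedding) : (snd f p).IsLinkEmbedding where
  inj := by
    rintro ⟨⟨a, d⟩, h⟩ ⟨⟨a', d'⟩, h'⟩ hs hd
    obtain rfl : d = d' := hd
    obtain rfl : a = a' := hf.inj a a' (congrArg (fun d => d.1.1) hs) (h.trans h'.symm)
    rfl
  span := by
    rintro ⟨⟨a, d⟩, h⟩ ⟨⟨a', d'⟩, h'⟩ hs ⟨c, rfl, rfl⟩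
    have hs' : A.src a = A.src a' := congrArg (fun d => d.1.1) hs
    simp only at h h'
    obtain ⟨c', rfl, rfl⟩ := hf.span a a' hs' ⟨p.toFun c, by
      rw [← p.map_cornerEdge]; exact h.symm, by rw [← p.map_cornerEdge]; exact h'.symm⟩
    have h0 : X.cornerEdge (f.toFun c') 0 = X.cornerEdge (p.toFun c) 0 := by
      rw [← f.map_cornerEdge, ← p.map_cornerEdge]; exact h
    have h1 : X.cornerEdge (f.toFun c') 1 = X.cornerEdge (p.toFun c) 1 := by
      rw [← f.map_cornerEdge, ← p.map_cornerEdge]; exact h'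
    have hc : X.corner (f.toFun c') = X.corner (p.toFun c) := by
      rw [← X.src_cornerEdge _ 0, h0, X.src_cornerEdge]
    have heq : f.toFun c' = p.toFun c := by
      obtain ⟨_, -, hu⟩ := hX.flag (X.corner (p.toFun c)) 2 (fun i => X.cornerEdge (p.toFun c) i)
        (fun i => X.src_cornerEdge _ i) (by
          intro i j hij
          have hsq : X.SpanSquare (X.cornerEdge (p.toFun c) 0) (X.cornerEdge (p.toFun c) 1) :=
            ⟨_, rfl, rfl⟩
          fin_cases i <;> fin_cases j
          · exact absurd rfl hij
          · exact hsq
          · exact hsq.symm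
          · exact absurd rfl hij)
      refine (hu (f.toFun c') ⟨hc, ?_⟩).trans (hu (p.toFun c) ⟨rfl, fun i => rfl⟩).symm
      intro i
      fin_cases i
      exacts [h0, h1]
    exact ⟨⟨(c', c), heq⟩, rfl, rfl⟩

theorem fst_liftsEdges {p : CubicalMap Y X} (hp : p.LiftsEdges) : (fst f p).LiftsEdges := by
  rintro ⟨⟨a, y⟩, h⟩ e he
  obtain ⟨d, hd, hd'⟩ := hp y (f.toFun e) (by
    rw [f.map_src]
    exact (congrArg f.onVertex he).trans h)
  exact ⟨⟨(e, d), hd'.symm⟩, Subtype.ext (Prod.ext he hd), rfl⟩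

open CubeComplex in
/-- The two ways to map the universal cover of the fibre product to that of the base agree. -/
theorem univMap_snd_fst {x : Y.Vertex} {w : (fibreProduct f p).Vertex}
    {q : X.pt (p.onVertex x) ⟶ X.pt (f.onVertex ((fst f p).onVertex w))}
    {r : Y.pt x ⟶ Y.pt ((snd f p).onVertex w)}
    (h : p.univMap x (𝟙 _) ⟨_, r⟩ = ⟨_, q⟩) (v : (fibreProduct f p).Univ w) :
    p.univMap x (𝟙 _) ((snd f p).univMap w r v) =
      f.univMap _ q ((fst f p).univMap w (𝟙 _) v) := by
  obtain ⟨v, g⟩ := v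
  induction g using hom_induction with
  | nil =>
    refine Eq.trans ?_ (h.trans ?_)
    · refine congrArg _ (Univ.mk_congr ?_)
      change r ≫ CubicalMap.mapHom _ (𝟙 _) = r
      rw [CubicalMap.mapHom_id, Category.comp_id]
    · refine Univ.mk_congr ?_
      change q = q ≫ f.mapHom (𝟙 _ ≫ CubicalMap.mapHom _ (𝟙 _))
      rw [CubicalMap.mapHom_id, Category.comp_id, CubicalMap.mapHom_id, Category.comp_id]
  | cons v v' g e ih =>
    rw [CubicalMap.univMap_arr, CubicalMap.univMap_arr, CubicalMap.univMap_arr,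
      CubicalMap.univMap_arr]
    exact Univ.extend_congr ih _ _ e.1.2.symm

end fibreProduct

/-! ### Finite stature for virtually special complexes -/

theorem SpecialGraph.comap {Z Z' S : Type*} [Letters S] {step : Z → S → Z → Prop}
    (hG : SpecialGraph step) {ψ : Z' → Z} (hψ : Function.Bijective ψ) :
    SpecialGraph fun z s z' => step (ψ z) s (ψ z') where
  inv h := hG.inv h
  det h h' := hψ.1 (hG.det h h')
  square hc h h' := by
    obtain ⟨w, h1, h2⟩ := hG.square hc h h'
    obtain ⟨w, rfl⟩ := hψ.2 w
    exact ⟨w, h1, h2⟩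
  label_unique hw hv := hG.label_unique (Walk.map_step (g := ψ) (fun _ _ _ h => h) hw)
    (Walk.map_step (g := ψ) (fun _ _ _ h => h) hv)

theorem PreSpecialGraph.finite_adj {Z S : Type*} [Letters S] [Finite S] {step : Z → S → Z → Prop}
    (hG : PreSpecialGraph step) (z : Z) : {y | StepAdj step z y}.Finite := by
  have : Nonempty Z := ⟨z⟩
  choose! f hf using fun (s : S) (h : ∃ y, step z s y) => h
  refine (Set.finite_range f).subset ?_
  rintro y ⟨s, hs⟩
  exact ⟨s, hG.det (hf s ⟨y, hs⟩) hs⟩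

theorem exists_finite_representatives {G Z κ : Type*} [Group G] [MulAction G Z] [Finite κ]
    {N : Subgroup G} (σ : Z → κ) (hσ : ∀ z z', σ z = σ z' → ∃ n ∈ N, n • z = z') :
    ∃ R : Set Z, R.Finite ∧ ∀ z, ∃ n ∈ N, n • z ∈ R := by
  obtain _ | _ := isEmpty_or_nonempty Z
  · exact ⟨∅, Set.finite_empty, isEmptyElim⟩
  choose! f hf using fun (k : κ) (h : ∃ z, σ z = k) => h
  refine ⟨Set.range f, Set.finite_range f, fun z => ?_⟩
  obtain ⟨n, hn, h⟩ := hσ z (f (σ z)) (hf _ ⟨z, rfl⟩).symm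
  exact ⟨n, hn, σ z, h.symm⟩

/-- Finite intersections are counted along with the infinite ones; the finiteness obtained from good
pairs covers both. -/
theorem HasFiniteStature.of_types {G : Type u} [Group G] {Λ : Type*} {Ω : Λ → Subgroup G}
    (h : ∀ l, ∃ F : Set (Subgroup G), F.Finite ∧ ∀ T : Set (Λ × G), ∃ L ∈ F, ∃ h ∈ Ω l,
      Ω l ⊓ ⨅ p ∈ T, (Ω p.1).conjBy p.2 = L.conjBy h) : HasFiniteStature Ω := fun l => by
  obtain ⟨F, hF, h⟩ := h l
  exact ⟨F, hF, fun T _ => h T⟩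

namespace CubeComplex

variable {X : CubeComplex.{u}}

theorem IsCompact.finite_cube (hX : X.IsCompact) (n : ℕ) : Finite (X.cube n) := by
  have : Finite (Σ n, X.cube n) := hX
  exact Finite.of_injective (fun c : X.cube n => (⟨n, c⟩ : Σ n, X.cube n)) sigma_mk_injective

theorem IsCompact.finite_vertex (hX : X.IsCompact) : Finite X.Vertex := hX.finite_cube 0

end CubeComplex

namespace CubicalMap

open CubeComplex

variable {Y X : CubeComplex.{u}} {p : CubicalMap Y X}

theorem IsFiniteCover.finite_vertex (hp : p.IsFiniteCover) (hX : X.IsCompact) :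
    Finite Y.Vertex := by
  have := hX.finite_vertex
  have h : (⋃ x : X.Vertex, {y : Y.Vertex | p.onVertex y = x}).Finite :=
    Set.finite_iUnion hp.finite_fiber
  refine Set.finite_univ_iff.1 (h.subset fun y _ => ?_)
  exact Set.mem_iUnion.2 ⟨p.onVertex y, rfl⟩

theorem IsFiniteCover.finite_edge (hp : p.IsFiniteCover) (hX : X.IsCompact) :
    Finite (Y.cube 1) := by
  have := hX.finite_cube 1
  have := hp.finite_vertex hX
  refine Finite.of_injective (fun c : Y.cube 1 => (Y.src c, p.toFun c)) fun c c' h => ?_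
  simp only [Prod.mk.injEq] at h
  obtain ⟨d, -, hd⟩ := hp.lift_unique (Y.src c) 1 (p.toFun c) (p.map_src c)
  exact (hd c ⟨rfl, rfl⟩).trans (hd c' ⟨h.1.symm, h.2.symm⟩).symm

end CubicalMap

open CubeComplex in
-- The universal covers of `Y` and `X` are identified, which transports the hyperplane labels of
-- `Y`. The translates of the universal covers of the `A i` are good for a subgroup of the group of
-- `Y` defined by trivial holonomy.
theorem hasFiniteStature_of_special_cover {Y X : CubeComplex.{u}} {p : CubicalMap Y X}
    (hp : p.IsFiniteCover) (hY : Y.IsSpecial) (hX : X.IsCompact) (hX' : X.IsNonpositivelyCurved)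
    {Λ : Type*} [Finite Λ] {A : Λ → CubeComplex.{u}} (f : ∀ i, CubicalMap (A i) X)
    (hA : ∀ i, (A i).IsCompact) (hf : ∀ i, (f i).IsLocalIsometry) (y₀ : Y.Vertex)
    (a : ∀ i, (A i).Vertex) (q : ∀ i, X.pt (p.onVertex y₀) ⟶ X.pt ((f i).onVertex (a i))) :
    HasFiniteStature fun i => (f i).stab (a i) (q i) := by
  let _ := hypLetters hY
  have hYv := hp.finite_vertex hX
  have hYe := hp.finite_edge hX
  have hAv : ∀ i, Finite (A i).Vertex := fun i => (hA i).finite_vertex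
  have hS : Finite Y.Hyp := Finite.of_surjective (Quot.mk _) Quot.mk_surjective
  have hSh : Finite (Sheet Y.Hyp) := inferInstanceAs (Finite {ε : Y.Hyp → Bool // _})
  have hW : ∀ i, Finite (fibreProduct (f i) p).Vertex := fun i =>
    Finite.of_injective (β := (A i).Vertex × Y.Vertex)
      (fun c => ((fibreProduct.fst (f i) p).onVertex c, (fibreProduct.snd (f i) p).onVertex c))
      fun c c' h => Subtype.ext (Prod.ext (congrArg Prod.fst h) (congrArg Prod.snd h))
  let ℓ := hypLabelling hY
  have hℓ : ℓ.IsTotal := hypLabelling_isTotal hY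
  have hsnd : ∀ i, (fibreProduct.snd (f i) p).IsLinkEmbedding := fun i =>
    fibreProduct.snd_isLinkEmbedding p hX' (hf i).isLinkEmbedding
  have hol_ex := fun i => ℓ.exists_separating_holonomy hℓ (hsnd i)
  choose hol hol_id hol_comp hol_sep using hol_ex
  let Φ : Y.Univ y₀ → X.Univ (p.onVertex y₀) := p.univMap y₀ (𝟙 _)
  have hΦ : Function.Bijective Φ := ⟨hp.univMap_injective _, hp.liftsEdges.univMap_surjective _⟩
  obtain ⟨Ψ, hΨΦ, hΦΨ⟩ := Function.bijective_iff_has_inverse.1 hΦ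
  have hΨ : Function.Bijective Ψ := Function.bijective_iff_has_inverse.2 ⟨Φ, hΦΨ, hΨΦ⟩
  let step := fun z s z' => ℓ.step y₀ (Ψ z) s (Ψ z')
  have hG : SpecialGraph step := (ℓ.specialGraph hℓ y₀).comap hΨ
  -- Deck transformations that do not come from `Y` need not preserve labels, but they preserve
  -- adjacency, which does not depend on the labelling.
  have hAdj' : ∀ z z', StepAdj step z z' ↔ UnivAdj z z' := by
    intro z z'
    obtain ⟨u, rfl⟩ := hΦ.2 z
    obtain ⟨u', rfl⟩ := hΦ.2 z'
    simp only [StepAdj, step, hΨΦ _]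
    constructor
    · rintro ⟨s, e, he, -⟩
      refine ⟨p.mapArr e, ?_⟩
      change (𝟙 _ ≫ p.mapHom u.2) ≫ p.mapHom (arr e) = 𝟙 _ ≫ p.mapHom u'.2
      rw [← he, CubicalMap.mapHom_comp, Category.assoc]
    · rintro ⟨e, he⟩
      obtain ⟨d, hd, hd'⟩ := hp.liftsEdges u.1 e.1 e.2.1
      let d' : u.1 ⟶ Y.tgt d := ⟨d, hd, rfl⟩
      have : (⟨Y.tgt d, u.2 ≫ arr d'⟩ : Y.Univ y₀) = u' := by
        refine hΦ.1 ((CubicalMap.univMap_arr _ _ _).trans ?_)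
        have h1 : Φ u' = ⟨(Φ u').1, (Φ u).2 ≫ arr e⟩ := Univ.mk_congr he.symm
        rw [h1]
        exact Univ.extend_congr rfl _ _ hd'
      obtain ⟨s, hs⟩ := hℓ d
      refine ⟨s, ?_⟩
      rw [← this]
      exact ⟨d', rfl, hs⟩
  have hAdj : ∀ (g : X.Pi1 (p.onVertex y₀)) z z', StepAdj step z z' →
      StepAdj step (g • z) (g • z') := fun g z z' h =>
    (hAdj' _ _).2 (((hAdj' _ _).1 h).smul g)
  have hol_inv : ∀ i {x y : Y.Vertex} (g : Y.pt x ⟶ Y.pt y), hol i (inv g) = (hol i g)⁻¹ := by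
    intro i x y g
    rw [eq_inv_iff_mul_eq_one, ← hol_comp, IsIso.inv_hom_id, hol_id]
  -- The elements that lift to closed paths in `Y` and have trivial holonomy for each of the
  -- finitely many `i`.
  let N : Subgroup (X.Pi1 (p.onVertex y₀)) :=
    { carrier := {g | ∃ n : Y.pt y₀ ⟶ Y.pt y₀, g.inv ≫ 𝟙 _ = 𝟙 _ ≫ p.mapHom n ∧
        ∀ i, hol i n = 1}
      one_mem' := ⟨𝟙 _, by rw [CubicalMap.mapHom_id]; rfl, fun i => hol_id i _⟩
      mul_mem' := by
        rintro g g' ⟨n, h, hn⟩ ⟨n', h', hn'⟩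
        refine ⟨n ≫ n', ?_, fun i => by rw [hol_comp, hn, hn', one_mul]⟩
        rw [Category.comp_id, Category.id_comp] at h h' ⊢
        rw [CubicalMap.mapHom_comp, ← h, ← h']
        rfl
      inv_mem' := by
        rintro g ⟨n, h, hn⟩
        refine ⟨inv n, ?_, fun i => by rw [hol_inv, hn, inv_one]⟩
        rw [Category.comp_id, Category.id_comp] at h ⊢
        rw [CubicalMap.mapHom_inv, ← h]
        exact (IsIso.inv_eq_of_hom_inv_id g.inv_hom_id).symm }
  have hNΦ : ∀ {g : X.Pi1 (p.onVertex y₀)} {n : Y.pt y₀ ⟶ Y.pt y₀},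
      g.inv ≫ 𝟙 _ = 𝟙 _ ≫ p.mapHom n → ∀ z, Ψ (g • z) = ⟨(Ψ z).1, n ≫ (Ψ z).2⟩ := by
    intro g n h z
    obtain ⟨u, rfl⟩ := hΦ.2 z
    rw [show g • Φ u = Φ ⟨u.1, n ≫ u.2⟩ from p.smul_univMap h u, hΨΦ, hΨΦ]
  have hN : ∀ n ∈ N, ∀ z s z', step z s z' → step (n • z) s (n • z') := by
    rintro g ⟨n, h, -⟩ z s z' ⟨e, he, hs⟩
    simp only [step]
    rw [hNΦ h, hNΦ h]
    exact ⟨e, by rw [← he]; exact Category.assoc _ _ _, hs⟩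
  obtain ⟨R, hR, hRN⟩ : ∃ R : Set (X.Univ (p.onVertex y₀)), R.Finite ∧
      ∀ z, ∃ n ∈ N, n • z ∈ R := by
    -- The `N`-orbit of a point is determined by its vertex in `Y` and its holonomies, for which
    -- there are finitely many possibilities.
    refine exists_finite_representatives
      (fun z => ((Ψ z).1, fun i => hol i (Ψ z).2)) fun z z' h => ?_
    simp only [Prod.mk.injEq] at h
    obtain ⟨u, rfl⟩ := hΦ.2 z
    obtain ⟨u', rfl⟩ := hΦ.2 z'
    rw [hΨΦ, hΨΦ] at h
    obtain ⟨y, r⟩ := u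
    obtain ⟨y', r'⟩ := u'
    obtain ⟨h1, h2⟩ := h
    obtain rfl : y = y' := h1
    let g : X.Pi1 (p.onVertex y₀) := (asIso (p.mapHom (r' ≫ inv r))).symm
    have hg : g.inv ≫ 𝟙 _ = 𝟙 _ ≫ p.mapHom (r' ≫ inv r) := by
      rw [Category.comp_id, Category.id_comp]; rfl
    refine ⟨g, ⟨_, hg, fun i => ?_⟩, ?_⟩
    · rw [hol_comp, hol_inv, mul_inv_eq_one]
      exact (congrFun h2 i).symm
    · refine (p.smul_univMap hg _).trans (congrArg Φ (Univ.mk_congr ?_))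
      simp
  have hE : ∀ i (r : X.pt (p.onVertex y₀) ⟶ X.pt ((f i).onVertex (a i))),
      GoodConvex step N ((f i).orb (a i) r) ((f i).stab (a i) r) := by
    intro i r
    -- The orbit of `A i` is also the image of the universal cover of the fibre product of `A i` and
    -- `Y`, based at a suitable vertex. The latter maps to `Y` by an embedding of links and so
    -- inherits the labels.
    obtain ⟨⟨y₁, t₀⟩, ht₀⟩ := hΦ.2 ⟨_, r⟩
    have hy₁ : p.onVertex y₁ = (f i).onVertex (a i) := congrArg Univ.vtx ht₀
    let w : (fibreProduct (f i) p).Vertex := ⟨(a i, y₁), hy₁.symm⟩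
    obtain ⟨t, ht⟩ : ∃ t : Y.pt y₀ ⟶ Y.pt ((fibreProduct.snd (f i) p).onVertex w),
      Φ ⟨_, t⟩ = ⟨_, r⟩ := ⟨t₀, ht₀⟩
    have key : ∀ v, Φ ((fibreProduct.snd (f i) p).univMap w t v) =
        (f i).univMap (a i) r ((fibreProduct.fst (f i) p).univMap w (𝟙 _) v) :=
      fibreProduct.univMap_snd_fst (f i) p (w := w) ht
    have hfst := (fibreProduct.fst_liftsEdges (f i) hp.liftsEdges).univMap_surjective
      (y := w) (𝟙 ((A i).pt (a i)))
    have hrange : (f i).orb (a i) r =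
        Set.range fun v => Φ ((fibreProduct.snd (f i) p).univMap w t v) := by
      rw [funext key]
      exact (hfst.range_comp _).symm
    refine ⟨?_, ⟨_, (f i).mem_orb_self r⟩, fun c hc z hz => (f i).smul_mem_orb hc hz, ?_⟩
    · rw [hrange]
      refine hG.range_convex ((ℓ.comap _ (hsnd i)).preSpecialGraph w)
        ((ℓ.comap _ (hsnd i)).walk_connected fun c => hℓ _) fun u s u' h => ?_
      simp only [step, hΨΦ _]
      exact ℓ.comap_step t u s u' h
    · rw [hrange]
      -- As `n` has trivial holonomy, the two points have equal holonomy and hence lie over the same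
      -- vertex of the fibre product; `mem_stab_of_smul` then applies.
      rintro g ⟨n, hn, hn1⟩ _ ⟨v, rfl⟩ ⟨v', hv'⟩
      have h1 := congrArg Ψ hv'
      rw [hNΦ hn] at h1
      beta_reduce at h1
      rw [hΨΦ, hΨΦ] at h1
      have hu : ∀ v, hol i ((fibreProduct.snd (f i) p).univMap w t v).2 =
            hol i t * hol i ((fibreProduct.snd (f i) p).mapHom v.2) :=
        fun v => hol_comp i _ _
      have h2 : hol i ((fibreProduct.snd (f i) p).univMap w t v').2 =
        hol i (n ≫ ((fibreProduct.snd (f i) p).univMap w t v).2) :=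
        congrArg (fun z : Y.Univ y₀ => hol i z.2) h1
      rw [hol_comp, hu, hu, hn1, one_mul, mul_right_inj] at h2
      have h3 : v.1 = v'.1 := hol_sep i (inv v.2 ≫ v'.2) (by
        rw [CubicalMap.mapHom_comp, CubicalMap.mapHom_inv, hol_comp, hol_inv, h2, inv_mul_cancel])
      obtain ⟨v, s⟩ := v
      obtain ⟨v', s'⟩ := v'
      obtain rfl : v = v' := h3
      simp only [key] at hv'
      exact (f i).mem_stab_of_smul hv'.symm
  refine HasFiniteStature.of_types fun l => ?_
  refine exists_finite_types (Adj := StepAdj step) (N := N) hAdj smul_free hR hRN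
    hG.finite_adj (P := GoodConvex step N) (fun h => h.goodPair)
    (K := fun j : Λ × X.Pi1 (p.onVertex y₀) => ((f j.1).stab (a j.1) (q j.1)).conjBy j.2)
    ?_ (hE l (q l))
  rintro D C hD ⟨i, g⟩
  simp only [CubicalMap.stab_conjBy]
  have hE' := hE i (g.inv ≫ q i)
  obtain ⟨z, hz⟩ := hD.nonempty
  obtain ⟨z', hz'⟩ := hE'.nonempty
  obtain ⟨w, hw⟩ := ℓ.walk_connected hℓ (Ψ z) (Ψ z')
  have hw' : Walk step (Φ (Ψ z)) w (Φ (Ψ z')) := hw.map_step (g := Φ) fun u s u' h => by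
    simp only [step, hΨΦ _]; exact h
  rw [hΦΨ, hΦΨ] at hw'
  obtain ⟨D', -, -, hD', -, hg, -⟩ := hD.exists_bridge hG hAdj hN hE' hz hz' hw'
  exact ⟨D', hD', hg⟩

theorem hasFiniteStature_of_isVirtuallySpecial {X : CubeComplex.{u}} (hX : X.IsCompact)
    (hX' : X.IsNonpositivelyCurved) (hs : X.IsVirtuallySpecial)
    {Λ : Type*} [Finite Λ] {A : Λ → CubeComplex.{u}} (f : ∀ i, CubicalMap (A i) X)
    (hA : ∀ i, (A i).IsCompact) (hf : ∀ i, (f i).IsLocalIsometry) (x : X.Vertex)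
    (a : ∀ i, (A i).Vertex) (γ : ∀ i, X.PathClass ((f i).onVertex (a i)) x) :
    HasFiniteStature fun i => (f i).subgroup (a i) (γ i) := by
  obtain ⟨Y, p, -, hp, hY⟩ := hs
  obtain ⟨y₀, rfl⟩ := hp.surjective x
  simp only [CubicalMap.subgroup_eq_stab]
  exact hasFiniteStature_of_special_cover hp hY hX hX' f hA hf y₀ a _

/-! ### Labelled graphs joined along walls -/

section Walls

set_option linter.unusedSectionVars false

open Letters

variable {Z S : Type*} [Letters S] {step : Z → S → Z → Prop} {G : Type u} [Group G] [MulAction G Z]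
  {N : Subgroup G}

/-- An equivariant isomorphism between two convex sets. -/
structure IsMatching (step : Z → S → Z → Prop) (N K : Subgroup G) (M : Z → Z → Prop) : Prop where
  dom : GoodConvex step N {y | ∃ y', M y y'} K
  cod : GoodConvex step N {y' | ∃ y, M y y'} K
  right_unique : ∀ {y a b}, M y a → M y b → a = b
  left_unique : ∀ {y a b}, M a y → M b y → a = b
  adj : ∀ {y y' v v'}, M y y' → M v v' → (StepAdj step y v ↔ StepAdj step y' v')
  smul : ∀ {c y y'}, c ∈ K → M y y' → M (c • y) (c • y')

variable {K : Subgroup G} {M : Z → Z → Prop}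

theorem IsMatching.symm (h : IsMatching step N K M) : IsMatching step N K fun y y' => M y' y where
  dom := h.cod
  cod := h.dom
  right_unique := h.left_unique
  left_unique := h.right_unique
  adj h₁ h₂ := (h.adj h₁ h₂).symm
  smul hc h₁ := h.smul hc h₁

/-- Good pairs correspond to each other under a matching. -/
theorem IsMatching.goodConvex (h : IsMatching step N K M) {D : Set Z} {C : Subgroup G}
    (hD : GoodConvex step N D C) (hDM : D ⊆ {y | ∃ y', M y y'}) (hCK : C ≤ K) :
    GoodConvex step N {y' | ∃ y ∈ D, M y y'} C where
  conn := by
    rintro z ⟨y, hy, hyz⟩ z' ⟨y', hy', hyz'⟩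
    have key : ∀ v, Relation.ReflTransGen (fun a b => StepAdj step a b ∧ a ∈ D ∧ b ∈ D) y v →
        ∀ v', M v v' → Relation.ReflTransGen (fun a b => StepAdj step a b ∧
          a ∈ {y' | ∃ y ∈ D, M y y'} ∧ b ∈ {y' | ∃ y ∈ D, M y y'}) z v' := by
      intro v hv
      induction hv with
      | refl => intro v' hv'; rw [h.right_unique hyz hv']
      | tail _ hbc ih =>
        intro v' hv'
        obtain ⟨hadj, hb, hc⟩ := hbc
        obtain ⟨b', hb'⟩ := hDM hb
        exact (ih b' hb').tail ⟨(h.adj hb' hv').1 hadj, ⟨_, hb, hb'⟩, ⟨_, hc, hv'⟩⟩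
    exact key y' (hD.conn y hy y' hy') z' hyz'
  square := by
    rintro z a b w ⟨z₀, hz₀, hz⟩ ⟨a₀, ha₀, ha⟩ ⟨b₀, hb₀, hb⟩ za zb aw bw hab hzw
    obtain ⟨w₀, hw⟩ : w ∈ {y' | ∃ y, M y y'} :=
      h.cod.square ⟨_, hz⟩ ⟨_, ha⟩ ⟨_, hb⟩ za zb aw bw hab hzw
    refine ⟨w₀, hD.square hz₀ ha₀ hb₀ ((h.adj hz ha).2 za) ((h.adj hz hb).2 zb)
      ((h.adj ha hw).2 aw) ((h.adj hb hw).2 bw) ?_ ?_, hw⟩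
    · rintro rfl; exact hab (h.right_unique ha hb)
    · rintro rfl; exact hzw (h.right_unique hz hw)
  nonempty := by
    obtain ⟨y, hy⟩ := hD.nonempty
    obtain ⟨y', hy'⟩ := hDM hy
    exact ⟨y', y, hy, hy'⟩
  smul_mem := by
    rintro c hc z ⟨y, hy, hyz⟩
    exact ⟨_, hD.smul_mem c hc y hy, h.smul (hCK hc) hyz⟩
  emb := by
    -- Goodness of the codomain puts `n` in `K`. Hence `n` commutes with the matching, and the
    -- question returns to `D`.
    rintro n hn z ⟨y, hy, hyz⟩ ⟨y', hy', hyz'⟩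
    have hnK := h.cod.emb n hn z ⟨_, hyz⟩ ⟨_, hyz'⟩
    have := h.left_unique (h.smul hnK hyz) hyz'
    exact hD.emb n hn y hy (this ▸ hy')

/-- Two points are joined by a walk. -/
def WalkJoined (step : Z → S → Z → Prop) (z z' : Z) : Prop := ∃ w, Walk step z w z'

theorem WalkJoined.refl (z : Z) : WalkJoined step z z := ⟨[], rfl⟩

theorem WalkJoined.trans {a b c : Z} (h : WalkJoined step a b) (h' : WalkJoined step b c) :
    WalkJoined step a c := by
  obtain ⟨w, hw⟩ := h
  obtain ⟨v, hv⟩ := h'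
  exact ⟨_, hw.append hv⟩

theorem WalkJoined.symm (hG : PreSpecialGraph step) {a b : Z} (h : WalkJoined step a b) :
    WalkJoined step b a := by
  obtain ⟨w, hw⟩ := h
  exact ⟨_, hG.walk_inv hw⟩

theorem ConvexIn.joined {D : Set Z} (hD : ConvexIn (StepAdj step) D) {a b : Z} (ha : a ∈ D)
    (hb : b ∈ D) : WalkJoined step a b := by
  obtain ⟨w, hw⟩ := Walk.exists_of_reflTransGen (hD.conn a ha b hb)
  exact ⟨w, hw.of_stepOn⟩

theorem WalkJoined.map {g : Z → Z} (hg : ∀ a s b, step a s b → step (g a) s (g b)) {a b : Z}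
    (h : WalkJoined step a b) : WalkJoined step (g a) (g b) := by
  obtain ⟨w, hw⟩ := h
  exact ⟨w, hw.map_step hg⟩

theorem WalkJoined.eq_of_forall {T : Type*} {σ : Z → T} (hσ : ∀ a s b, step a s b → σ a = σ b)
    {a b : Z} (h : WalkJoined step a b) : σ a = σ b := by
  obtain ⟨w, hw⟩ := h
  induction w generalizing a with
  | nil => cases hw; rfl
  | cons s w ih =>
    obtain ⟨y, hy, hw⟩ := hw
    exact (hσ _ _ _ hy).trans (ih hw)

variable {Λ : Type*} {up : Λ → Z → Z → Prop}

/-- A path that crosses `k` walls. -/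
inductive Reach (step : Z → S → Z → Prop) (up : Λ → Z → Z → Prop) : ℕ → Z → Z → Prop
  | joined {z z' : Z} : WalkJoined step z z' → Reach step up 0 z z'
  | cross {k : ℕ} {z z₁ z₂ z' : Z} {l : Λ} : WalkJoined step z z₁ → up l z₁ z₂ ∨ up l z₂ z₁ →
      Reach step up k z₂ z' → Reach step up (k + 1) z z'

theorem Reach.of_joined {k : ℕ} {z y z' : Z} (h : WalkJoined step z y) (h' : Reach step up k y z') :
    Reach step up k z z' := by
  cases h' with
  | joined h' => exact .joined (h.trans h')
  | cross h₁ h₂ h₃ => exact .cross (h.trans h₁) h₂ h₃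

/-- Since `σ` is constant along walks, it changes at one of the crossings; `i` is the number of
crossings left after that one. -/
theorem Reach.exists_crossing {T : Type*} {σ : Z → T} (hσ : ∀ a s b, step a s b → σ a = σ b) {k : ℕ}
    {z z' : Z} (h : Reach step up k z z') (hne : σ z ≠ σ z') :
    ∃ i < k, ∃ l v v', (up l v v' ∨ up l v' v) ∧ σ v ≠ σ v' ∧ Reach step up i v' z' ∧
      Reach step up (i + 1) v z' := by
  induction h with
  | joined h => exact absurd (h.eq_of_forall hσ) hne
  | @cross k z z₁ z₂ z' l h₁ h₂ h₃ ih =>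
    by_cases h : σ z₁ = σ z₂
    · obtain ⟨i, hi, rest⟩ := ih (by rw [← h, ← h₁.eq_of_forall hσ]; exact hne)
      exact ⟨i, by omega, rest⟩
    · exact ⟨k, by omega, l, z₁, z₂, h₂, h, h₃, .cross (.refl _) h₂ h₃⟩

/-- A matching that separates the graph. -/
structure IsWall (step : Z → S → Z → Prop) (up : Λ → Z → Z → Prop) (N K : Subgroup G)
    (R : Λ → Z → Z → Prop) : Prop where
  matching : IsMatching step N K fun y y' => ∃ l, R l y y'
  mem : ∀ {l c y y'}, R l y y' → R l (c • y) (c • y') → c ∈ K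
  side : ∃ σ : Z → Bool, (∀ a s b, step a s b → σ a = σ b) ∧ (∀ {l y y'}, R l y y' → σ y ≠ σ y') ∧
    ∀ {l y y'}, up l y y' → σ y ≠ σ y' → R l y y'

variable (hG : SpecialGraph step)
  (hstep : ∀ (g : G) a s b, step a s b → step (g • a) s (g • b))
  (hup : ∀ (g : G) l a b, up l a b → up l (g • a) (g • b))
include hG hstep

/-- The stabilizer of a component. -/
def joinedStab (z : Z) : Subgroup G where
  carrier := {g | WalkJoined step z (g • z)}
  one_mem' := by change WalkJoined step z ((1 : G) • z); rw [one_smul]; exact .refl z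
  mul_mem' := by
    intro g g' h h'
    change WalkJoined step z ((g * g') • z)
    rw [mul_smul]
    exact h.trans (WalkJoined.map (hstep g) h')
  inv_mem' := by
    intro g h
    have := WalkJoined.map (hstep g⁻¹) h
    rw [inv_smul_smul] at this
    exact this.symm hG.toPreSpecialGraph

include hup in
/-- A group element that preserves two components preserves the first wall that separates them. -/
theorem mem_of_first_crossing {R : Λ → Z → Z → Prop} (hR : IsWall step up N K R) {k : ℕ}
    {z z₁ z₂ z' : Z} {l : Λ} (h₁ : WalkJoined step z z₁) (h₂ : R l z₁ z₂ ∨ R l z₂ z₁)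
    (hup₂ : up l z₁ z₂ ∨ up l z₂ z₁)
    (h₃ : Reach step up k z₂ z') (hmin : ∀ j ≤ k, ¬ Reach step up j z z') {c : G}
    (hz : WalkJoined step z (c • z)) (hz' : WalkJoined step z' (c • z')) : c ∈ K := by
  have hP := hG.toPreSpecialGraph
  obtain ⟨σ, hσ, hσR, hσup⟩ := hR.side
  have hmin' : ∀ {y}, WalkJoined step z y → ∀ j ≤ k, ¬ Reach step up j y z' :=
    fun hy j hj h => hmin j hj (.of_joined hy h)
  -- Crossing the wall once more would allow a shortcut.
  have cross : ∀ (d : G), WalkJoined step z (d • z) → ∀ {y : Z}, Reach step up k y z' →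
      σ (d⁻¹ • y) = σ (d⁻¹ • z') := by
    intro d hd y hy
    by_contra hne
    have hzd : WalkJoined step z (d • z₁) := hd.trans (WalkJoined.map (hstep d) h₁)
    have hRz : ∀ {l' v v'}, R l' (d⁻¹ • v) (d⁻¹ • v') ∨ R l' (d⁻¹ • v') (d⁻¹ • v) →
        WalkJoined step z v ∨ WalkJoined step z v' := by
      intro l' v v' h
      have aux : ∀ {v}, WalkJoined step z₁ (d⁻¹ • v) → WalkJoined step z v := fun {v} h => by
        have := WalkJoined.map (hstep d) h
        rw [smul_inv_smul] at this
        exact hzd.trans this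
      obtain h₂ | h₂ := h₂ <;> obtain h | h := h
      · exact .inl (aux (hR.matching.dom.joined ⟨_, _, h₂⟩ ⟨_, _, h⟩))
      · exact .inr (aux (hR.matching.dom.joined ⟨_, _, h₂⟩ ⟨_, _, h⟩))
      · exact .inr (aux (hR.matching.cod.joined ⟨_, _, h₂⟩ ⟨_, _, h⟩))
      · exact .inl (aux (hR.matching.cod.joined ⟨_, _, h₂⟩ ⟨_, _, h⟩))
    obtain ⟨i, hi, l', v, v', hvv, hs, r1, r2⟩ := hy.exists_crossing (σ := fun y => σ (d⁻¹ • y))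
      (fun a s b h => hσ _ _ _ (hstep d⁻¹ a s b h)) hne
    obtain h | h := hRz (l' := l') (hvv.imp (fun h => hσup (hup _ _ _ _ h) hs)
      fun h => hσup (hup _ _ _ _ h) hs.symm)
    · exact hmin' h _ (by omega) r2
    · exact hmin' h _ (by omega) r1
  -- The rest of the path crosses neither the wall nor its translate by `c`. Hence `c⁻¹ • z₁` lies
  -- on the side of `z` and `c⁻¹ • z₂` on the side of `z'`. These sides differ, so the translated
  -- crossing belongs to the same wall.
  have e1 := cross 1 (by rw [one_smul]; exact .refl z) h₃
  have e2 := cross c hz h₃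
  rw [inv_one, one_smul, one_smul] at e1
  have ez : σ (c⁻¹ • z) = σ z := by
    have := WalkJoined.map (hstep c⁻¹) hz
    rw [inv_smul_smul] at this
    exact this.eq_of_forall hσ
  have ez' : σ (c⁻¹ • z') = σ z' := by
    have := WalkJoined.map (hstep c⁻¹) hz'
    rw [inv_smul_smul] at this
    exact this.eq_of_forall hσ
  have ez₁ : σ (c⁻¹ • z₁) = σ (c⁻¹ • z) :=
    ((WalkJoined.map (hstep c⁻¹) h₁).eq_of_forall hσ).symm
  have e3 := h₁.eq_of_forall hσ
  refine (inv_mem_iff (x := c)).1 ?_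
  obtain h₂ | h₂ := h₂
  · have hne := hσR h₂
    obtain hu | hu := hup₂
    · exact hR.mem h₂ (hσup (hup c⁻¹ _ _ _ hu) (by rw [ez₁, ez, e2, ez', ← e1, e3]; exact hne))
    -- If the crossing also belonged to the wall in the opposite orientation, both of its ends would
    -- lie in the domain of the matching and be joined by a walk, so the crossing could be skipped.
    · exact absurd (hR.matching.dom.joined ⟨_, _, h₂⟩ ⟨_, _, hσup hu hne.symm⟩)
        fun h => hmin' (h₁.trans h) k le_rfl h₃
  · have hne := hσR h₂
    obtain hu | hu := hup₂
    · exact absurd (hR.matching.cod.joined ⟨_, _, h₂⟩ ⟨_, _, hσup hu hne.symm⟩)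
        fun h => hmin' (h₁.trans h) k le_rfl h₃
    · exact hR.mem h₂ (hσup (hup c⁻¹ _ _ _ hu) (by rw [ez₁, ez, e2, ez', ← e1, e3]; exact hne))

include hup in
/-- Shrink a good pair so as to intersect the group with the stabilizer of a component. -/
theorem GoodConvex.exists_inf_joinedStab
    (hwall : ∀ l y y', up l y y' → ∃ R K, IsWall step up N K R ∧ R l y y') {k : ℕ} {z z' : Z}
    (hreach : Reach step up k z z') (hmin : ∀ j < k, ¬ Reach step up j z z')
    {D : Set Z} {C : Subgroup G} (hD : GoodConvex step N D C) (hz : z ∈ D)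
    (hC : C ≤ joinedStab hG hstep z) :
    ∃ D', D' ⊆ D ∧ GoodConvex step N D' (C ⊓ joinedStab hG hstep z') := by
  have hP := hG.toPreSpecialGraph
  induction k generalizing z D C with
  | zero =>
    obtain ⟨h⟩ := hreach
    refine ⟨D, le_rfl, ?_⟩
    rwa [inf_eq_left.2]
    intro c hc
    exact ((h.symm hP).trans (hC hc)).trans (WalkJoined.map (hstep c) h)
  | succ k ih =>
    obtain _ | @⟨_, _, z₁, z₂, _, l, h₁, h₂, h₃⟩ := hreach
    -- Orient the matching of the first wall away from `z`. By minimality of the path the whole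
    -- intersection preserves this wall.
    obtain ⟨M, K, hM, hM₁₂, hmem⟩ : ∃ M K, IsMatching step N K M ∧ M z₁ z₂ ∧
        C ⊓ joinedStab hG hstep z' ≤ K := by
      have aux := fun {R K} (hR : IsWall step up N K R) h => fun c
        (hc : c ∈ C ⊓ joinedStab hG hstep z') => mem_of_first_crossing hG hstep hup hR h₁ h h₂ h₃
        (fun j hj => hmin j (by omega)) (hC hc.1) hc.2
      obtain h | h := h₂
      · obtain ⟨R, K, hR, hl⟩ := hwall l _ _ h
        exact ⟨_, K, hR.matching, ⟨l, hl⟩, aux hR (.inl hl)⟩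
      · obtain ⟨R, K, hR, hl⟩ := hwall l _ _ h
        exact ⟨_, K, hR.matching.symm, ⟨l, hl⟩, aux hR (.inr hl)⟩
    obtain ⟨w, hw⟩ := id h₁
    -- `D₁` consists of the points of `D` nearest to the wall and `A₁` of the corresponding points
    -- of its near side; the matching carries `A₁` across the wall.
    obtain ⟨D₁, A₁, v, hD₁, hA₁, gD₁, gA₁, hDA, hAD, hadj⟩ := hD.exists_bridge hG
      (fun g a b ⟨s, h⟩ => ⟨s, hstep g _ _ _ h⟩) (fun n _ => hstep n) hM.dom hz ⟨_, hM₁₂⟩ hw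
    have gB₁ := hM.goodConvex gA₁ hA₁ inf_le_right
    obtain ⟨y, hy⟩ := gB₁.nonempty
    have hyB : y ∈ {y' | ∃ y, M y y'} := let ⟨a, _, h⟩ := hy; ⟨a, h⟩
    have hy₂ : WalkJoined step y z₂ := hM.cod.joined hyB ⟨_, hM₁₂⟩
    have hsub : C ⊓ K ⊓ joinedStab hG hstep z' = C ⊓ joinedStab hG hstep z' :=
      le_antisymm (inf_le_inf_right _ inf_le_left)
        (le_inf (le_inf inf_le_left hmem) inf_le_right)
    -- Beyond the wall one crossing fewer remains, so the induction hypothesis shrinks the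
    -- transported pair.
    have hih : ∃ D', D' ⊆ {y' | ∃ y ∈ A₁, M y y'} ∧
        GoodConvex step N D' (C ⊓ K ⊓ joinedStab hG hstep z') := by
      refine ih (h₃.of_joined hy₂) (fun j hj hr => ?_) gB₁ hy fun c hc => ?_
      · exact hmin (j + 1) (by omega) (.cross h₁ h₂ (hr.of_joined (hy₂.symm hP)))
      · obtain ⟨a, ha⟩ := hyB
        exact hM.cod.joined ⟨a, ha⟩ ⟨_, hM.smul hc.2 ha⟩
    rw [hsub] at hih
    obtain ⟨B₂, hB₂, gB₂⟩ := hih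
    -- Return across the wall to `A₁`.
    have gA₂ := hM.symm.goodConvex gB₂ (fun b hb => let ⟨a, _, h⟩ := hB₂ hb; ⟨a, h⟩) hmem
    have hA₂ : {a | ∃ b ∈ B₂, M a b} ⊆ A₁ := by
      rintro a ⟨b, hb, hab⟩
      obtain ⟨a', ha', h⟩ := hB₂ hb
      rwa [hM.left_unique hab h]
    -- The bridge between `A₁` and `D₁` is a matching as well, and brings the pair back into `D`.
    have hW : IsMatching step N (C ⊓ K) fun a d => a ∈ A₁ ∧ d ∈ D₁ ∧ Walk step d v a := by
      refine ⟨?_, ?_, ?_, ?_, ?_, ?_⟩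
      · convert gA₁ using 1
        ext a
        exact ⟨fun ⟨d, h, _⟩ => h, fun h => let ⟨d, hd, hda⟩ := hAD a h; ⟨d, h, hd, hda⟩⟩
      · convert gD₁ using 1
        ext d
        exact ⟨fun ⟨a, _, h, _⟩ => h, fun h => let ⟨a, ha, hda⟩ := hDA d h; ⟨a, ha, h, hda⟩⟩
      · rintro y a b ⟨-, -, h⟩ ⟨-, -, h'⟩
        exact hG.walk_det (hG.walk_inv h) (hG.walk_inv h')
      · rintro y a b ⟨-, -, h⟩ ⟨-, -, h'⟩
        exact hG.walk_det h h'
      · rintro y y' v v' ⟨a, b, h⟩ ⟨a', b', h'⟩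
        exact (hadj _ b _ b' _ a _ a' h h').symm
      · rintro c y y' hc ⟨a, b, h⟩
        exact ⟨gA₁.smul_mem c hc _ a, gD₁.smul_mem c hc _ b, h.map_step (hstep c)⟩
    refine ⟨_, ?_, hW.goodConvex gA₂ ?_ (le_inf inf_le_left hmem)⟩
    · rintro d ⟨a, -, -, hd, -⟩
      exact hD₁ hd
    · intro a ha
      obtain ⟨d, hd, hda⟩ := hAD a (hA₂ ha)
      exact ⟨d, hA₂ ha, hd, hda⟩

include hup in
theorem exists_finite_types_of_walls [Finite S]
    (hwall : ∀ l y y', up l y y' → ∃ R K, IsWall step up N K R ∧ R l y y')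
    (hfree : ∀ (g : G) (z : Z), g • z = z → g = 1)
    {Q : Set Z} (hQ : Q.Finite) (hQN : ∀ z, ∃ n ∈ N, n • z ∈ Q)
    (hreach : ∀ z z', ∃ k, Reach step up k z z') {J : Type*} (ζ : J → Z) {D₀ : Set Z}
    {H : Subgroup G} (h₀ : GoodConvex step N D₀ H) :
    ∃ F : Set (Subgroup G), F.Finite ∧
      ∀ T : Set J, ∃ L ∈ F, ∃ h ∈ H, H ⊓ ⨅ j ∈ T, joinedStab hG hstep (ζ j) = L.conjBy h := by
  classical
  refine exists_finite_types (Adj := StepAdj step) (N := N)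
    (fun g a b ⟨s, h⟩ => ⟨s, hstep g _ _ _ h⟩) hfree hQ hQN hG.finite_adj
    (P := GoodConvex step N) (fun h => h.goodPair) (fun D C hD j => ?_) h₀
  obtain ⟨z, hz⟩ := hD.nonempty
  exact hD.exists_inf_joinedStab hG hstep hup hwall (Nat.find_spec (hreach z (ζ j)))
    (fun i hi => Nat.find_min (hreach z (ζ j)) hi) hz
    fun c hc => hD.joined hz (hD.smul_mem c hc z hz)

end Walls

/-! ### The cubes of the total space -/

namespace GraphOfCubeComplexes

open CubeComplex

variable (𝒢 : GraphOfCubeComplexes.{u})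

/-- The map of an edge space to the total space through one of its ends. -/
def sideMap (s : Bool) (e : 𝒢.E) : CubicalMap (𝒢.edgeSpace e) 𝒢.total :=
  (𝒢.vertexMap (𝒢.endpoint s e)).comp (𝒢.attach s e)

/-- The edge of the total space that crosses the thickened edge space, starting at the given end. -/
def crossEdge (e : 𝒢.E) (s : Bool) (b : (𝒢.edgeSpace e).Vertex) : 𝒢.total.cube 1 :=
  TotalCube.thick e 0 s b

/-- The square of the total space over an edge of an edge space. -/
def crossSquare (e : 𝒢.E) (j : Fin 2) (s : Bool) (d : (𝒢.edgeSpace e).cube 1) : 𝒢.total.cube 2 :=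
  TotalCube.thick e j s d

variable {𝒢}

theorem src_crossEdge (e : 𝒢.E) (s : Bool) (b : (𝒢.edgeSpace e).Vertex) :
    𝒢.total.src (𝒢.crossEdge e s b) = (𝒢.sideMap s e).onVertex b := by
  refine (𝒢.totalFace_thick (n := 0) (CubeMap.vertex fun _ => false) e 0 s b
    (.const false) rfl).trans ?_
  simp only [thickFace, Bool.false_xor]
  refine congrArg (𝒢.glued e s) ?_
  refine (congrArg (fun f => (𝒢.edgeSpace e).face f b) ?_).trans ((𝒢.edgeSpace e).face_id b)
  ext1; funext k; exact k.elim0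

theorem tgt_crossEdge (e : 𝒢.E) (s : Bool) (b : (𝒢.edgeSpace e).Vertex) :
    𝒢.total.tgt (𝒢.crossEdge e s b) = (𝒢.sideMap (!s) e).onVertex b := by
  refine (𝒢.totalFace_thick (n := 0) (CubeMap.vertex fun _ => true) e 0 s b
    (.const true) rfl).trans ?_
  simp only [thickFace, Bool.true_xor]
  refine congrArg (𝒢.glued e (!s)) ?_
  refine (congrArg (fun f => (𝒢.edgeSpace e).face f b) ?_).trans ((𝒢.edgeSpace e).face_id b)
  ext1; funext k; exact k.elim0

theorem rev_crossEdge (e : 𝒢.E) (s : Bool) (b : (𝒢.edgeSpace e).Vertex) :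
    𝒢.total.rev (𝒢.crossEdge e s b) = 𝒢.crossEdge e (!s) b := by
  refine (𝒢.totalFace_thick (n := 0) CubeMap.flip e 0 s b (.var 0 true) rfl).trans ?_
  simp only [thickFace, Bool.true_xor]
  refine congrArg (𝒢.crossEdge e (!s)) ?_
  refine (congrArg (fun f => (𝒢.edgeSpace e).face f b) ?_).trans ((𝒢.edgeSpace e).face_id b)
  ext1; funext k; exact k.elim0

theorem face_axis_crossSquare_self (e : 𝒢.E) (j : Fin 2) (s t : Bool)
    (d : (𝒢.edgeSpace e).cube 1) :
    𝒢.total.face (CubeMap.axis j fun _ => t) (𝒢.crossSquare e j s d) =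
      𝒢.crossEdge e s ((𝒢.edgeSpace e).face (CubeMap.vertex fun _ => t) d) := by
  change 𝒢.totalFace _ (.thick e j s d) = _
  rw [𝒢.totalFace_thick _ e j s d (.var 0 false) (by simp [CubeMap.axis])]
  simp only [thickFace, Bool.false_xor]
  refine congrArg (𝒢.crossEdge e s) ?_
  refine congrArg (fun f => (𝒢.edgeSpace e).face f d) ?_
  ext1; funext k
  simp [CubeMap.eraseVar, CubeMap.axis, CubeMap.vertex, Fin.succAbove_ne, CubeMap.lower]

theorem face_axis_crossSquare_other (e : 𝒢.E) {j i : Fin 2} (h : j ≠ i) (s t : Bool)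
    (d : (𝒢.edgeSpace e).cube 1) :
    𝒢.total.face (CubeMap.axis i fun _ => t) (𝒢.crossSquare e j s d) =
      (𝒢.sideMap (xor t s) e).toFun d := by
  change 𝒢.totalFace _ (.thick e j s d) = _
  rw [𝒢.totalFace_thick _ e j s d (.const t) (by simp [CubeMap.axis, h])]
  simp only [thickFace]
  refine congrArg (𝒢.glued e (xor t s)) ?_
  refine (congrArg (fun f => (𝒢.edgeSpace e).face f d) ?_).trans ((𝒢.edgeSpace e).face_id d)
  ext1; funext k
  have hk : j.succAbove k = i := by
    have := Fin.succAbove_ne j k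
    omega
  obtain rfl : k = 0 := Subsingleton.elim _ _
  simp [CubeMap.eraseConst, CubeMap.axis, CubeMap.id, hk]

theorem vertex_cases (x : 𝒢.total.Vertex) : ∃ v y, x = (𝒢.vertexMap v).onVertex y := by
  obtain ⟨v, y⟩ := x
  exact ⟨v, y, rfl⟩

theorem edge_cases (a : 𝒢.total.cube 1) :
    (∃ v c, a = (𝒢.vertexMap v).toFun c) ∨ ∃ e s b, a = 𝒢.crossEdge e s b := by
  obtain ⟨v, c⟩ | ⟨e, j, s, b⟩ := a
  · exact .inl ⟨v, c, rfl⟩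
  · obtain rfl : j = 0 := Fin.fin_one_eq_zero j
    exact .inr ⟨e, s, b, rfl⟩

theorem square_cases (c : 𝒢.total.cube 2) :
    (∃ v d, c = (𝒢.vertexMap v).toFun d) ∨ ∃ e j s d, c = 𝒢.crossSquare e j s d := by
  obtain ⟨v, c⟩ | ⟨e, j, s, b⟩ := c
  · exact .inl ⟨v, c, rfl⟩
  · exact .inr ⟨e, j, s, b, rfl⟩

theorem vertexMap_ne_crossEdge {v : 𝒢.V} {c : (𝒢.vertexSpace v).cube 1} {e : 𝒢.E} {s : Bool}
    {b : (𝒢.edgeSpace e).Vertex} : (𝒢.vertexMap v).toFun c ≠ 𝒢.crossEdge e s b :=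
  fun h => by cases h

theorem crossEdge_inj {e e' : 𝒢.E} {s s' : Bool} {b : (𝒢.edgeSpace e).Vertex}
    {b' : (𝒢.edgeSpace e').Vertex} (h : 𝒢.crossEdge e s b = 𝒢.crossEdge e' s' b') :
    e = e' ∧ s = s' ∧ HEq b b' := by
  cases h; exact ⟨rfl, rfl, .rfl⟩

variable (𝒢) in
/-- The edge that crosses the thickened edge space. -/
def crossArr (e : 𝒢.E) (b : (𝒢.edgeSpace e).Vertex) :
    (𝒢.sideMap false e).onVertex b ⟶ (𝒢.sideMap true e).onVertex b :=
  ⟨𝒢.crossEdge e false b, src_crossEdge e false b, tgt_crossEdge e false b⟩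

/-- The squares over the edges of the edge space form a homotopy between its two attaching maps. -/
theorem crossArr_natural (e : 𝒢.E) {b b' : (𝒢.edgeSpace e).Vertex}
    (p : (𝒢.edgeSpace e).pt b ⟶ (𝒢.edgeSpace e).pt b') :
    (𝒢.sideMap false e).mapHom p ≫ arr (𝒢.crossArr e b') =
      arr (𝒢.crossArr e b) ≫ (𝒢.sideMap true e).mapHom p := by
  induction p using hom_induction with
  | nil => rw [CubicalMap.mapHom_id, CubicalMap.mapHom_id, Category.id_comp, Category.comp_id]
  | cons y z p d ih =>
    rw [CubicalMap.mapHom_comp, CubicalMap.mapHom_comp, Category.assoc, ← Category.assoc (arr _),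
      ← ih, Category.assoc]
    congr 1
    refine (arr_square (𝒢.crossSquare e 0 false d.1) (𝒢.crossArr e y) ((𝒢.sideMap true e).mapArr d)
      ((𝒢.sideMap false e).mapArr d) (𝒢.crossArr e z) ?_ ?_ ?_ ?_).symm
    · refine Eq.trans ?_ (face_axis_crossSquare_self e 0 false false d.1).symm
      exact congrArg (𝒢.crossEdge e false) d.2.1.symm
    · exact (face_axis_crossSquare_other e (by decide) false true d.1).symm
    · exact (face_axis_crossSquare_other e (by decide) false false d.1).symm
    · refine Eq.trans ?_ (face_axis_crossSquare_self e 0 false true d.1).symm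
      exact congrArg (𝒢.crossEdge e false) d.2.2.symm

end GraphOfCubeComplexes

/-! ### Embedding vertex groups -/

section Intertwiner

variable {B : Type u} [Group B]

/-- Left translations of the first factor. -/
def leftPerm (κ : Type*) : B →* Equiv.Perm (B × κ) where
  toFun b := (Equiv.mulLeft b).prodCongr (Equiv.refl κ)
  map_one' := by ext1 ⟨x, y⟩; simp
  map_mul' a b := by ext1 ⟨x, y⟩; simp [mul_assoc]

theorem leftPerm_apply {κ : Type*} (b x : B) (y : κ) : leftPerm κ b (x, y) = (b * x, y) := rfl

theorem leftPerm_injective {κ : Type*} [Nonempty κ] :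
    Function.Injective (leftPerm κ : B →* Equiv.Perm (B × κ)) := by
  intro a b h
  obtain ⟨y⟩ := ‹Nonempty κ›
  have := congrArg (fun e : Equiv.Perm (B × κ) => (e (1, y)).1) h
  simpa [leftPerm_apply] using this

/-- Up to multiplicity, a free action is a multiple of the regular one. -/
theorem exists_equivariant_equiv {H : Type u} [Group H] {φ : H →* B} (hφ : Function.Injective φ) :
    ∃ ε : H × (B × ℕ) ≃ B × (B × ℕ), ∀ h k t, leftPerm _ (φ h) (ε (k, t)) = ε (h * k, t) := by
  let Q := Quotient (QuotientGroup.rightRel φ.range)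
  -- The factor `ℕ` makes the second factor infinite, and there are no more cosets than its
  -- cardinality, so their number is absorbed.
  obtain ⟨ι⟩ : Nonempty (Q × (B × ℕ) ≃ B × ℕ) := by
    refine Cardinal.eq.1 ?_
    rw [← Cardinal.mul_def]
    have hle : Cardinal.mk Q ≤ Cardinal.mk (B × ℕ) :=
      (Cardinal.mk_le_of_surjective Quotient.mk_surjective).trans
        (Cardinal.mk_le_of_injective (f := fun b : B => (b, 0)) fun a b h => congrArg Prod.fst h)
    refine Cardinal.mul_eq_right (Cardinal.aleph0_le_mk _) hle (Cardinal.mk_ne_zero_iff.2 ?_)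
    exact ⟨Quotient.mk _ 1⟩
  let f : H × (Q × (B × ℕ)) → B × (B × ℕ) := fun p => (φ p.1 * p.2.1.out, p.2.2)
  have hf : Function.Bijective f := by
    constructor
    · rintro ⟨h, q, t⟩ ⟨h', q', t'⟩ he
      simp only [f, Prod.mk.injEq] at he
      obtain ⟨he, rfl⟩ := he
      obtain rfl : q = q' := by
        rw [← q.out_eq, ← q'.out_eq]
        refine Quotient.sound ?_
        refine QuotientGroup.rightRel_apply.2 ⟨h'⁻¹ * h, ?_⟩
        rw [map_mul, map_inv, eq_mul_inv_iff_mul_eq, mul_assoc, he, inv_mul_cancel_left]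
      rw [hφ (mul_right_cancel he)]
    · rintro ⟨b, t⟩
      obtain ⟨h, hh⟩ := QuotientGroup.rightRel_apply.1
        (Quotient.mk_out (s := QuotientGroup.rightRel φ.range) b)
      exact ⟨(h, Quotient.mk _ b, t), Prod.ext (by simp only [f, hh]; group) rfl⟩
  refine ⟨((Equiv.refl H).prodCongr ι.symm).trans (Equiv.ofBijective f hf), fun h k t => ?_⟩
  refine Prod.ext ?_ rfl
  change φ h * (φ k * _) = φ (h * k) * _
  rw [map_mul, mul_assoc]
  rfl

/-- Both actions are isomorphic to the same multiple of the regular action, hence conjugate. -/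
theorem exists_intertwiner {H : Type u} [Group H] {φ ψ : H →* B} (hφ : Function.Injective φ)
    (hψ : Function.Injective ψ) : ∃ θ : Equiv.Perm (B × (B × ℕ)),
      ∀ h, leftPerm _ (φ h) * θ = θ * leftPerm _ (ψ h) := by
  obtain ⟨ε, hε⟩ := exists_equivariant_equiv hφ
  obtain ⟨δ, hδ⟩ := exists_equivariant_equiv hψ
  refine ⟨δ.symm.trans ε, fun h => ?_⟩
  ext1 t
  obtain ⟨⟨k, s⟩, rfl⟩ := δ.surjective t
  simp only [Equiv.Perm.mul_apply, hδ, Equiv.trans_apply, Equiv.symm_apply_apply, hε]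

end Intertwiner

namespace CubeComplex

variable {X : CubeComplex.{u}}

/-- A closed path as an element of the fundamental group. -/
noncomputable def loop {x : X.Vertex} (p : X.pt x ⟶ X.pt x) : X.Pi1 x := (asIso p).symm

theorem loop_comp {x : X.Vertex} (p q : X.pt x ⟶ X.pt x) : loop (p ≫ q) = loop p * loop q := by
  apply Iso.ext
  change inv (p ≫ q) = inv q ≫ inv p
  exact IsIso.inv_comp

theorem loop_inv {x : X.Vertex} (g : X.Pi1 x) : loop g.inv = g :=
  Iso.ext (IsIso.inv_eq_of_hom_inv_id g.inv_hom_id)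

theorem loop_injective {x : X.Vertex} {p q : X.pt x ⟶ X.pt x} (h : loop p = loop q) : p = q :=
  congrArg Iso.inv h

theorem IsConnected.nonempty_hom (hX : X.IsConnected) (x y : X.Vertex) :
    Nonempty (X.pt x ⟶ X.pt y) := (hX.2 x y).map cls

end CubeComplex

namespace GraphOfCubeComplexes

open CubeComplex

variable {𝒢 : GraphOfCubeComplexes.{u}}

/-- The labels of the special vertex space pull back to the edge space, where reduced words of
distinct path classes from one point end in distinct points of the target's universal cover. -/
theorem attach_mapHom_injective (hs : ∀ v, (𝒢.vertexSpace v).IsSpecial) (s : Bool) (e : 𝒢.E)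
    {b b' : (𝒢.edgeSpace e).Vertex} {p p' : (𝒢.edgeSpace e).pt b ⟶ (𝒢.edgeSpace e).pt b'}
    (h : (𝒢.attach s e).mapHom p = (𝒢.attach s e).mapHom p') : p = p' := by
  let _ := hypLetters (hs (𝒢.endpoint s e))
  have hinj := (hypLabelling (hs (𝒢.endpoint s e))).univMap_injective
    (𝒢.attach_localIsometry s e).isLinkEmbedding (fun a => ⟨_, rfl⟩)
    ((hypLabelling (hs _)).specialGraph (hypLabelling_isTotal (hs _)) _) b (𝟙 _)
  exact Univ.hom_eq (@hinj ⟨b', p⟩ ⟨b', p'⟩ (Univ.mk_congr (by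
    change 𝟙 _ ≫ (𝒢.attach s e).mapHom p = 𝟙 _ ≫ (𝒢.attach s e).mapHom p'
    rw [h])))

/-- The fundamental groupoid of a vertex space embeds in that of the total space. -/
theorem vertexMap_mapHom_injective (hs : ∀ v, (𝒢.vertexSpace v).IsSpecial) (v : 𝒢.V)
    {a b : (𝒢.vertexSpace v).Vertex} {p p' : (𝒢.vertexSpace v).pt a ⟶ (𝒢.vertexSpace v).pt b}
    (h : (𝒢.vertexMap v).mapHom p = (𝒢.vertexMap v).mapHom p') : p = p' := by
  classical
  let a₀ : ∀ v, (𝒢.vertexSpace v).Vertex := fun v => (𝒢.vertexSpace_connected v).1.some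
  let b₀ : ∀ e, (𝒢.edgeSpace e).Vertex := fun e => (𝒢.edgeSpace_connected e).1.some
  let t : ∀ v a, (𝒢.vertexSpace v).pt (a₀ v) ⟶ (𝒢.vertexSpace v).pt a := fun v a =>
    ((𝒢.vertexSpace_connected v).nonempty_hom _ _).some
  let r : ∀ e b, (𝒢.edgeSpace e).pt (b₀ e) ⟶ (𝒢.edgeSpace e).pt b := fun e b =>
    ((𝒢.edgeSpace_connected e).nonempty_hom _ _).some
  -- One group that contains all vertex groups, with each sitting in its own factor. The aim is a
  -- holonomy of the total space that restricts to a faithful one on each vertex space.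
  let B := ∀ v, (𝒢.vertexSpace v).Pi1 (a₀ v)
  let i : ∀ v {a b}, ((𝒢.vertexSpace v).pt a ⟶ (𝒢.vertexSpace v).pt b) → B := fun v a b p =>
    Pi.mulSingle v (loop (t v a ≫ p ≫ inv (t v b)))
  have i_comp : ∀ v {a b c} (p : (𝒢.vertexSpace v).pt a ⟶ (𝒢.vertexSpace v).pt b)
      (q : (𝒢.vertexSpace v).pt b ⟶ (𝒢.vertexSpace v).pt c), i v (p ≫ q) = i v p * i v q := by
    intro v a b c p q
    simp only [i]
    rw [← Pi.mulSingle_mul, ← loop_comp]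
    simp
  have i_inj : ∀ v {a b} {p q : (𝒢.vertexSpace v).pt a ⟶ (𝒢.vertexSpace v).pt b},
      i v p = i v q → p = q := by
    intro v a b p q h
    have h' := loop_injective (Pi.mulSingle_injective (M := fun v => (𝒢.vertexSpace v).Pi1 (a₀ v)) v h)
    rwa [cancel_epi, cancel_mono] at h'
  let φ : ∀ s e, (𝒢.edgeSpace e).Pi1 (b₀ e) →* B := fun s e =>
    MonoidHom.mk' (fun h => i _ ((𝒢.attach s e).mapHom h.inv)) (fun h h' => by
      rw [← i_comp, ← CubicalMap.mapHom_comp]; rfl)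
  have hφ : ∀ s e, Function.Injective (φ s e) := fun s e h h' he =>
    (loop_inv h).symm.trans ((congrArg loop
      (attach_mapHom_injective hs s e (i_inj _ he))).trans (loop_inv h'))
  -- The two embeddings of an edge group in `B` need not agree, but the permutation actions they
  -- induce are conjugate; the conjugating permutation becomes the holonomy across the edge space.
  choose θ hθ using fun e => exists_intertwiner (hφ false e) (hφ true e)
  let j : ∀ v {a b}, ((𝒢.vertexSpace v).pt a ⟶ (𝒢.vertexSpace v).pt b) →
    Equiv.Perm (B × (B × ℕ)) := fun v a b p => leftPerm _ (i v p)
  have j_comp : ∀ v {a b c} (p : (𝒢.vertexSpace v).pt a ⟶ (𝒢.vertexSpace v).pt b)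
      (q : (𝒢.vertexSpace v).pt b ⟶ (𝒢.vertexSpace v).pt c), j v (p ≫ q) = j v p * j v q :=
    fun v {a b c} p q => (congrArg (leftPerm _) (i_comp v p q)).trans (map_mul _ _ _)
  have j_id : ∀ v a, j v (𝟙 ((𝒢.vertexSpace v).pt a)) = 1 := by
    intro v a
    have := j_comp v (𝟙 ((𝒢.vertexSpace v).pt a)) (𝟙 _)
    rw [Category.comp_id] at this
    exact left_eq_mul.1 this
  -- Spread the permutation from the base point of the edge space to its other vertices.
  let Θ : ∀ e, (𝒢.edgeSpace e).Vertex → Equiv.Perm (B × (B × ℕ)) := fun e b =>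
    (j _ ((𝒢.attach false e).mapHom (r e b)))⁻¹ * θ e * j _ ((𝒢.attach true e).mapHom (r e b))
  have hΘ : ∀ e {b b'} (p : (𝒢.edgeSpace e).pt b ⟶ (𝒢.edgeSpace e).pt b'),
      j _ ((𝒢.attach false e).mapHom p) * Θ e b' = Θ e b * j _ ((𝒢.attach true e).mapHom p) := by
    intro e b b' p
    have h1 := hθ e (loop (r e b ≫ p ≫ inv (r e b')))
    have h2 : ∀ s, leftPerm (B × ℕ) (φ s e (loop (r e b ≫ p ≫ inv (r e b')))) =
        j _ ((𝒢.attach s e).mapHom (r e b)) * j _ ((𝒢.attach s e).mapHom p) *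
          (j _ ((𝒢.attach s e).mapHom (r e b')))⁻¹ := by
      intro s
      rw [eq_mul_inv_iff_mul_eq, ← j_comp, ← CubicalMap.mapHom_comp]
      change j _ ((𝒢.attach s e).mapHom (r e b ≫ p ≫ inv (r e b'))) * _ = _
      rw [← j_comp, ← CubicalMap.mapHom_comp]
      simp
    rw [h2, h2] at h1
    simp only [Θ]
    have h3 := congrArg (fun x => (j _ ((𝒢.attach false e).mapHom (r e b)))⁻¹ * x *
      j _ ((𝒢.attach true e).mapHom (r e b'))) h1
    simpa only [mul_assoc, inv_mul_cancel_left, inv_mul_cancel, mul_one] using h3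
  let ρ : 𝒢.total.cube 1 → Equiv.Perm (B × (B × ℕ)) := fun c =>
    match (c : 𝒢.TotalCube 1) with
    | .vert v c => j v (arr (⟨c, rfl, rfl⟩ : (𝒢.vertexSpace v).src c ⟶ (𝒢.vertexSpace v).tgt c))
    | .thick e _ s b => if s then (Θ e b)⁻¹ else Θ e b
  have ρ_vert : ∀ v {a b : (𝒢.vertexSpace v).Vertex} (e : a ⟶ b), ρ ((𝒢.vertexMap v).toFun e.1) = j v (arr e) := by
    rintro v _ _ ⟨e, rfl, rfl⟩; rfl
  have ρ_cross : ∀ e s b, ρ (𝒢.crossEdge e s b) = if s then (Θ e b)⁻¹ else Θ e b :=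
    fun _ _ _ => rfl
  have ρ_side : ∀ s e {b b' : (𝒢.edgeSpace e).Vertex} (d : b ⟶ b'), ρ ((𝒢.sideMap s e).toFun d.1) =
      j _ ((𝒢.attach s e).mapHom (arr d)) := fun s e {b b'} d =>
    ρ_vert _ ((𝒢.attach s e).mapArr d)
  -- Compatibility of the holonomy with the squares over the edges of an edge space.
  have nat : ∀ (e : 𝒢.E) s (d : (𝒢.edgeSpace e).cube 1),
      ρ (𝒢.crossEdge e s ((𝒢.edgeSpace e).src d)) * ρ ((𝒢.sideMap (!s) e).toFun d) =
      ρ ((𝒢.sideMap s e).toFun d) * ρ (𝒢.crossEdge e s ((𝒢.edgeSpace e).tgt d)) := by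
    intro e s d
    let d' : (𝒢.edgeSpace e).src d ⟶ (𝒢.edgeSpace e).tgt d := ⟨d, rfl, rfl⟩
    have h0 := hΘ e (arr d')
    rw [← ρ_side, ← ρ_side] at h0
    rw [ρ_cross, ρ_cross]
    cases s
    · exact h0.symm
    · simp only [if_true, Bool.not_true]
      rw [inv_mul_eq_iff_eq_mul, ← mul_assoc, ← mul_inv_eq_iff_eq_mul, inv_inv]
      exact h0
  obtain ⟨hol, h1, h2, h3⟩ := exists_holonomy (X := 𝒢.total) ρ
    (by
      intro a
      obtain ⟨v, c, rfl⟩ | ⟨e, s, b, rfl⟩ := edge_cases a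
      · let c' : (𝒢.vertexSpace v).src c ⟶ (𝒢.vertexSpace v).tgt c := ⟨c, rfl, rfl⟩
        rw [← CubicalMap.map_rev, eq_inv_iff_mul_eq_one]
        have e1 := ρ_vert v (revArr c')
        have e2 := ρ_vert v c'
        have : ρ ((𝒢.vertexMap v).toFun ((𝒢.vertexSpace v).rev c)) *
            ρ ((𝒢.vertexMap v).toFun c) = j v (arr (revArr c')) * j v (arr c') := by
          rw [← e1, ← e2]; rfl
        rw [this, ← j_comp, revArr_arr, j_id]
      · rw [rev_crossEdge, ρ_cross, ρ_cross]
        cases s <;> simp)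
    (by
      intro c
      obtain ⟨v, c, rfl⟩ | ⟨e, i, s, d, rfl⟩ := square_cases c
      · let X := 𝒢.vertexSpace v
        let e₀ : X.corner c ⟶ X.tgt (X.cornerEdge c 0) := ⟨_, X.src_cornerEdge c 0, rfl⟩
        let e₁ : X.corner c ⟶ X.tgt (X.cornerEdge c 1) := ⟨_, X.src_cornerEdge c 1, rfl⟩
        let d₁ : X.tgt (X.cornerEdge c 0) ⟶ X.tgt (X.oppositeEdge c 1) :=
          ⟨_, (X.tgt_cornerEdge_zero c).symm, rfl⟩
        let d₀ : X.tgt (X.cornerEdge c 1) ⟶ X.tgt (X.oppositeEdge c 1) :=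
          ⟨_, (X.tgt_cornerEdge_one c).symm, (X.tgt_oppositeEdge c).symm⟩
        have hsq := arr_square c e₀ d₁ e₁ d₀ rfl rfl rfl rfl
        have hsq' := congrArg (j v) hsq
        rw [j_comp, j_comp, ← ρ_vert, ← ρ_vert, ← ρ_vert, ← ρ_vert] at hsq'
        simp only [← CubicalMap.map_cornerEdge, ← CubicalMap.map_oppositeEdge]
        exact hsq'
      · simp only [cornerEdge, oppositeEdge]
        fin_cases i
        · have f1 := face_axis_crossSquare_self e 0 s false d
          have f2 := face_axis_crossSquare_self e 0 s true d
          have f3 := face_axis_crossSquare_other e (show (0 : Fin 2) ≠ 1 by decide) s false d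
          have f4 := face_axis_crossSquare_other e (show (0 : Fin 2) ≠ 1 by decide) s true d
          rw [Bool.false_xor] at f3
          rw [Bool.true_xor] at f4
          simp only [Fin.zero_eta]
          rw [f1, f2, f3, f4]
          exact nat e s d
        · have f1 := face_axis_crossSquare_self e 1 s false d
          have f2 := face_axis_crossSquare_self e 1 s true d
          have f3 := face_axis_crossSquare_other e (show (1 : Fin 2) ≠ 0 by decide) s false d
          have f4 := face_axis_crossSquare_other e (show (1 : Fin 2) ≠ 0 by decide) s true d
          rw [Bool.false_xor] at f3
          rw [Bool.true_xor] at f4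
          simp only [Fin.mk_one]
          rw [f1, f2, f3, f4]
          exact (nat e s d).symm)
  -- On the vertex space the holonomy is left translation, which is faithful.
  have key : ∀ {b} (p : (𝒢.vertexSpace v).pt a ⟶ (𝒢.vertexSpace v).pt b),
      hol ((𝒢.vertexMap v).mapHom p) = j v p := by
    intro b p
    induction p using hom_induction with
    | nil => rw [CubicalMap.mapHom_id, h1, j_id]
    | cons b b' p e ih =>
      rw [CubicalMap.mapHom_comp, h2, ih, CubicalMap.mapHom_arr, h3, j_comp]
      exact congrArg _ (ρ_vert v e)
  exact i_inj v (leftPerm_injective ((key p).symm.trans ((congrArg hol h).trans (key p'))))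

end GraphOfCubeComplexes

/-! ### Counting crossings -/

namespace CubeComplex

variable {X : CubeComplex.{u}} {x : X.Vertex}

/-- Move along an edge in the universal cover. -/
def Univ.extend (z : X.Univ x) (c : X.cube 1) (h : X.src c = z.1) : X.Univ x :=
  ⟨X.tgt c, z.2 ≫ arr (⟨c, h, rfl⟩ : z.1 ⟶ X.tgt c)⟩

theorem Univ.extend_eq (z : X.Univ x) {y : X.Vertex} (e : z.1 ⟶ y) :
    z.extend e.1 e.2.1 = ⟨y, z.2 ≫ arr e⟩ := by
  obtain ⟨e, h, rfl⟩ := e; rfl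

theorem Univ.extend_eq_of_hom {z z' : X.Univ x} {e : z.1 ⟶ z'.1} (h : z.2 ≫ arr e = z'.2) :
    z.extend e.1 e.2.1 = z' := by rw [extend_eq, h]

theorem Univ.extend_rev (z : X.Univ x) (c : X.cube 1) (h : X.src c = z.1) :
    (z.extend c h).extend (X.rev c) (X.src_rev c) = z := by
  obtain ⟨y, g⟩ := z
  obtain rfl : X.src c = y := h
  let e : X.src c ⟶ X.tgt c := ⟨c, rfl, rfl⟩
  refine (Univ.extend_eq (⟨X.tgt c, g ≫ arr e⟩ : X.Univ x) (revArr e)).trans (Univ.mk_congr ?_)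
  change (g ≫ arr e) ≫ arr (revArr e) = g
  rw [Category.assoc, arr_revArr, Category.comp_id]

theorem Univ.extend_square (z : X.Univ x) (c : X.cube 2) (h : X.corner c = z.1) :
    (z.extend (X.cornerEdge c 0) ((X.src_cornerEdge c 0).trans h)).extend (X.oppositeEdge c 1)
      (X.tgt_cornerEdge_zero c).symm =
    (z.extend (X.cornerEdge c 1) ((X.src_cornerEdge c 1).trans h)).extend (X.oppositeEdge c 0)
      (X.tgt_cornerEdge_one c).symm := by
  obtain ⟨y, g⟩ := z
  obtain rfl : X.corner c = y := h
  let e₀ : X.corner c ⟶ X.tgt (X.cornerEdge c 0) := ⟨_, X.src_cornerEdge c 0, rfl⟩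
  let e₁ : X.corner c ⟶ X.tgt (X.cornerEdge c 1) := ⟨_, X.src_cornerEdge c 1, rfl⟩
  let d₁ : X.tgt (X.cornerEdge c 0) ⟶ X.tgt (X.oppositeEdge c 1) :=
    ⟨_, (X.tgt_cornerEdge_zero c).symm, rfl⟩
  let d₀ : X.tgt (X.cornerEdge c 1) ⟶ X.tgt (X.oppositeEdge c 1) :=
    ⟨_, (X.tgt_cornerEdge_one c).symm, (X.tgt_oppositeEdge c).symm⟩
  refine (Univ.extend_eq (⟨_, g ≫ arr e₀⟩ : X.Univ x) d₁).trans (Eq.trans (Univ.mk_congr ?_)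
    (Univ.extend_eq (⟨_, g ≫ arr e₁⟩ : X.Univ x) d₀).symm)
  change (g ≫ arr e₀) ≫ arr d₁ = (g ≫ arr e₁) ≫ arr d₀
  rw [Category.assoc, Category.assoc, arr_square c e₀ d₁ e₁ d₀ rfl rfl rfl rfl]

theorem xor_decide_of_iff {P Q R S : Prop} [Decidable P] [Decidable Q] [Decidable R] [Decidable S]
    (h : (P ↔ Q) ↔ (R ↔ S)) :
    xor (decide P) (decide Q) = xor (decide R) (decide S) := by
  by_cases P <;> by_cases Q <;> by_cases R <;> by_cases S <;> simp_all

/-- The parity of the number of crossings is well-defined. -/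
theorem exists_parity (F : X.Univ x → X.cube 1 → Prop)
    (hrev : ∀ z c (h : X.src c = z.1), F z c → F (z.extend c h) (X.rev c))
    (hsq : ∀ z c (h : X.corner c = z.1),
      (F z (X.cornerEdge c 0) ↔
        F (z.extend (X.cornerEdge c 0) ((X.src_cornerEdge c 0).trans h)) (X.oppositeEdge c 1)) ↔
      (F z (X.cornerEdge c 1) ↔
        F (z.extend (X.cornerEdge c 1) ((X.src_cornerEdge c 1).trans h)) (X.oppositeEdge c 0))) :
    ∃ σ : X.Univ x → Bool, ∀ z c (h : X.src c = z.1), σ z ≠ σ (z.extend c h) ↔ F z c := by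
  classical
  have hrev' : ∀ z c (h : X.src c = z.1), F (z.extend c h) (X.rev c) ↔ F z c := by
    refine fun z c h => ⟨fun hF => ?_, hrev z c h⟩
    have := hrev _ _ (X.src_rev c) hF
    rwa [Univ.extend_rev, X.rev_rev] at this
  let move : X.Univ x × Bool → X.cube 1 → X.Univ x × Bool := fun t c =>
    if h : X.src c = t.1.1 then (t.1.extend c h, xor t.2 (decide (F t.1 c))) else t
  have hmove : ∀ t c (h : X.src c = t.1.1),
      move t c = (t.1.extend c h, xor t.2 (decide (F t.1 c))) := fun t c h => dif_pos h
  have hmove' : ∀ t z c (h : X.src c = z.1), t.1 = z →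
      move t c = (z.extend c h, xor t.2 (decide (F z c))) := by
    rintro t _ c h rfl; exact hmove t c h
  obtain ⟨tr, h1, h2⟩ := exists_transport (X := X) (fun t : X.Univ x × Bool => t.1.1) move
    (by
      intro t a h
      rw [hmove t a h.symm]; rfl)
    (by
      intro t a h
      rw [hmove t a h.symm, hmove _ _ (X.src_rev a)]
      refine Prod.ext (Univ.extend_rev t.1 a h.symm) ?_
      simp only [hrev' t.1 a h.symm, Bool.xor_assoc, Bool.xor_self, Bool.xor_false])
    (by
      intro t c h
      rw [hmove t _ ((X.src_cornerEdge c 0).trans h.symm), hmove _ _ (X.tgt_cornerEdge_zero c).symm,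
        hmove t _ ((X.src_cornerEdge c 1).trans h.symm), hmove _ _ (X.tgt_cornerEdge_one c).symm]
      refine Prod.ext (Univ.extend_square _ _ h.symm) ?_
      have := hsq t.1 c h.symm
      simp only [Bool.xor_assoc]
      rw [xor_decide_of_iff this])
  -- The first component of the transport from the base point merely follows the path, so the second
  -- is a function on the universal cover.
  have key : ∀ z : X.Univ x, (tr z.2 (Univ.base X x, false)).1 = z := by
    rintro ⟨y, g⟩
    induction g using hom_induction with
    | nil => exact congrArg Prod.fst (h1 x _ rfl)
    | cons y y' g e ih =>
      change (tr (g ≫ arr e) _).1 = _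
      rw [h2 g e _ rfl, hmove' _ _ _ e.2.1 ih]
      exact Univ.extend_eq ⟨y, g⟩ e
  refine ⟨fun z => (tr z.2 (Univ.base X x, false)).2, fun z c h => ?_⟩
  have e1 : tr (z.extend c h).2 (Univ.base X x, false) = move (tr z.2 (Univ.base X x, false)) c :=
    h2 z.2 (⟨c, h, rfl⟩ : z.1 ⟶ X.tgt c) _ rfl
  beta_reduce
  rw [e1, hmove' _ _ _ h (key z)]
  by_cases hF : F z c <;> simp [hF]

end CubeComplex

/-! ### The labelling of the total space -/

theorem CubicalMap.IsLinkEmbedding.comp {A X B : CubeComplex.{u}} {g : CubicalMap X B}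
    {f : CubicalMap A X} (hg : g.IsLinkEmbedding) (hf : f.IsLinkEmbedding) :
    (g.comp f).IsLinkEmbedding where
  inj a b h h' := hf.inj a b h (hg.inj _ _ (by rw [f.map_src, f.map_src, h]) h')
  span a b h h' := hf.span a b h (hg.span _ _ (by rw [f.map_src, f.map_src, h]) h')

namespace GraphOfCubeComplexes

open CubeComplex

variable {𝒢 : GraphOfCubeComplexes.{u}}

/-- The hyperplanes of the vertex spaces. -/
def VertexHyp (𝒢 : GraphOfCubeComplexes.{u}) : Type u := Σ v, (𝒢.vertexSpace v).Hyp

/-- The hyperplanes of the vertex spaces as letters; those of different vertex spaces do not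
commute. -/
@[reducible]
def vertexHypLetters (hs : ∀ v, (𝒢.vertexSpace v).IsSpecial) : Letters 𝒢.VertexHyp where
  inv p := ⟨p.1, (hypLetters (hs p.1)).inv p.2⟩
  comm p q := ∃ v s t, (hypLetters (hs v)).comm s t ∧ p = ⟨v, s⟩ ∧ q = ⟨v, t⟩
  inv_inv p := Sigma.ext rfl (heq_of_eq ((hypLetters (hs p.1)).inv_inv p.2))
  comm_symm := by
    rintro _ _ ⟨v, s, t, h, rfl, rfl⟩
    exact ⟨v, t, s, (hypLetters (hs v)).comm_symm h, rfl, rfl⟩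
  comm_irrefl := by
    rintro p ⟨v, s, t, h, rfl, h'⟩
    obtain rfl : s = t := eq_of_heq (Sigma.mk.inj h').2
    exact (hypLetters (hs v)).comm_irrefl s h
  comm_inv := by
    rintro _ _ ⟨v, s, t, h, rfl, rfl⟩
    exact ⟨v, _, t, (hypLetters (hs v)).comm_inv h, rfl, rfl⟩

/-- The label of an edge of the total space. -/
def totalLab (c : 𝒢.total.cube 1) : Option 𝒢.VertexHyp :=
  match (c : 𝒢.TotalCube 1) with
  | .vert v c => some ⟨v, Quot.mk _ c⟩
  | .thick _ _ _ _ => none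

theorem totalLab_vert (v : 𝒢.V) (c : (𝒢.vertexSpace v).cube 1) :
    totalLab ((𝒢.vertexMap v).toFun c) = some ⟨v, Quot.mk _ c⟩ := rfl

theorem totalLab_eq_some {c : 𝒢.total.cube 1} {p : 𝒢.VertexHyp} (h : totalLab c = some p) :
    ∃ v d, c = (𝒢.vertexMap v).toFun d ∧ p = ⟨v, Quot.mk _ d⟩ := by
  obtain ⟨v, d, rfl⟩ | ⟨e, s, b, rfl⟩ := edge_cases c
  · exact ⟨v, d, rfl, (Option.some.inj h).symm⟩
  · cases h

theorem vertexMap_inj {v v' : 𝒢.V} {n : ℕ} {c : (𝒢.vertexSpace v).cube n}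
    {c' : (𝒢.vertexSpace v').cube n} (h : (𝒢.vertexMap v).toFun c = (𝒢.vertexMap v').toFun c') :
    v = v' ∧ HEq c c' := by
  cases h; exact ⟨rfl, .rfl⟩

theorem exists_square_of_cornerEdge {v v' : 𝒢.V} {c : 𝒢.total.cube 2}
    {d : (𝒢.vertexSpace v).cube 1} {d' : (𝒢.vertexSpace v').cube 1}
    (h₀ : 𝒢.total.cornerEdge c 0 = (𝒢.vertexMap v).toFun d)
    (h₁ : 𝒢.total.cornerEdge c 1 = (𝒢.vertexMap v').toFun d') :
    ∃ w q, c = (𝒢.vertexMap w).toFun q := by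
  obtain h | ⟨e, j, s, b, rfl⟩ := square_cases c
  · exact h
  · exfalso
    have h := face_axis_crossSquare_self e j s false b
    fin_cases j
    · exact vertexMap_ne_crossEdge (h₀.symm.trans h)
    · exact vertexMap_ne_crossEdge (h₁.symm.trans h)

theorem vertexMap_isLinkEmbedding (v : 𝒢.V) : (𝒢.vertexMap v).IsLinkEmbedding where
  inj a b _ h := eq_of_heq (vertexMap_inj h).2
  span := by
    rintro a b - ⟨c, h₀, h₁⟩
    obtain ⟨w, q, rfl⟩ := exists_square_of_cornerEdge h₀ h₁
    rw [← CubicalMap.map_cornerEdge] at h₀ h₁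
    obtain ⟨rfl, h₀⟩ := vertexMap_inj h₀
    exact ⟨q, eq_of_heq h₀, eq_of_heq (vertexMap_inj h₁).2⟩

theorem sideMap_isLinkEmbedding (s : Bool) (e : 𝒢.E) : (𝒢.sideMap s e).IsLinkEmbedding :=
  (vertexMap_isLinkEmbedding _).comp (𝒢.attach_localIsometry s e).isLinkEmbedding

/-- The labelling of the edges of the vertex spaces by their hyperplanes. -/
def totalLabelling (hs : ∀ v, (𝒢.vertexSpace v).IsSpecial) :
    letI := vertexHypLetters hs
    EdgeLabelling 𝒢.total 𝒢.VertexHyp :=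
  letI := vertexHypLetters hs
  { lab := totalLab
    lab_rev := by
      intro a s h
      obtain ⟨v, d, rfl, rfl⟩ := totalLab_eq_some h
      rw [← CubicalMap.map_rev]
      rfl
    lab_inj := by
      intro a b s h ha hb
      obtain ⟨v, d, rfl, rfl⟩ := totalLab_eq_some ha
      obtain ⟨v', d', rfl, h'⟩ := totalLab_eq_some hb
      rw [CubicalMap.map_src, CubicalMap.map_src] at h
      obtain ⟨rfl, h⟩ := vertexMap_inj h
      refine congrArg _ ((hs v).no_self_osculation d d' (eq_of_heq h) (hyp_eq_iff.1 ?_))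
      exact eq_of_heq (Sigma.mk.inj h').2
    lab_span := by
      rintro a b s t h ha hb ⟨w, s', t', hc, rfl, rfl⟩
      obtain ⟨v, d, rfl, h1⟩ := totalLab_eq_some ha
      obtain ⟨v', d', rfl, h2⟩ := totalLab_eq_some hb
      obtain ⟨rfl, h1⟩ := Sigma.mk.inj h1
      obtain ⟨rfl, h2⟩ := Sigma.mk.inj h2
      obtain rfl := eq_of_heq h1
      obtain rfl := eq_of_heq h2
      rw [CubicalMap.map_src, CubicalMap.map_src] at h
      obtain ⟨c, rfl, rfl⟩ := (let _ := hypLetters (hs w); (hypLabelling (hs w)).lab_span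
        (eq_of_heq (vertexMap_inj h).2) rfl rfl hc)
      exact ⟨(𝒢.vertexMap w).toFun c, (CubicalMap.map_cornerEdge _ _ _).symm,
        (CubicalMap.map_cornerEdge _ _ _).symm⟩
    lab_square := by
      intro c s t h₀ h₁
      obtain ⟨v, d, e₀, rfl⟩ := totalLab_eq_some h₀
      obtain ⟨v', d', e₁, rfl⟩ := totalLab_eq_some h₁
      obtain ⟨w, q, rfl⟩ := exists_square_of_cornerEdge e₀ e₁
      rw [← CubicalMap.map_cornerEdge] at e₀ e₁
      obtain ⟨rfl, e₀⟩ := vertexMap_inj e₀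
      obtain ⟨rfl, e₁⟩ := vertexMap_inj e₁
      obtain rfl := eq_of_heq e₀
      obtain rfl := eq_of_heq e₁
      obtain ⟨l0, l1, hc⟩ := (let _ := hypLetters (hs w); (hypLabelling (hs w)).lab_square
        (c := q) rfl rfl)
      rw [← CubicalMap.map_oppositeEdge, ← CubicalMap.map_oppositeEdge]
      refine ⟨?_, ?_, w, _, _, hc, rfl, rfl⟩
      · rw [totalLab_vert]
        exact congrArg (fun h => some (⟨w, h⟩ : 𝒢.VertexHyp)) (Option.some.inj l0)
      · rw [totalLab_vert]
        exact congrArg (fun h => some (⟨w, h⟩ : 𝒢.VertexHyp)) (Option.some.inj l1) }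

theorem vertexMap_comap_isTotal (hs : ∀ v, (𝒢.vertexSpace v).IsSpecial) (v : 𝒢.V) :
    letI := vertexHypLetters hs
    ((totalLabelling hs).comap (𝒢.vertexMap v) (vertexMap_isLinkEmbedding v)).IsTotal :=
  fun _ => ⟨_, rfl⟩

theorem sideMap_comap_isTotal (hs : ∀ v, (𝒢.vertexSpace v).IsSpecial) (s : Bool) (e : 𝒢.E) :
    letI := vertexHypLetters hs
    ((totalLabelling hs).comap (𝒢.sideMap s e) (sideMap_isLinkEmbedding s e)).IsTotal :=
  fun _ => ⟨_, rfl⟩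

theorem univMap_vertexMap_injective (hs : ∀ v, (𝒢.vertexSpace v).IsSpecial) (v : 𝒢.V)
    (a : (𝒢.vertexSpace v).Vertex) {x : 𝒢.total.Vertex}
    (q : 𝒢.total.pt x ⟶ 𝒢.total.pt ((𝒢.vertexMap v).onVertex a)) :
    Function.Injective ((𝒢.vertexMap v).univMap a q) := by
  rintro ⟨b, p⟩ ⟨b', p'⟩ h
  obtain rfl : b = b' := eq_of_heq (vertexMap_inj (congrArg Univ.vtx h)).2
  have := Univ.hom_eq h
  exact Univ.mk_congr (vertexMap_mapHom_injective hs v ((cancel_epi q).1 this))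

/-- Labelled edges belong to vertex spaces, so walks never leave the image of the universal cover of
the vertex space in which they start. -/
theorem exists_lift_step (hs : ∀ v, (𝒢.vertexSpace v).IsSpecial) {v : 𝒢.V}
    {a : (𝒢.vertexSpace v).Vertex} {x : 𝒢.total.Vertex}
    {q : 𝒢.total.pt x ⟶ 𝒢.total.pt ((𝒢.vertexMap v).onVertex a)} {u : (𝒢.vertexSpace v).Univ a}
    {s : 𝒢.VertexHyp} {z : 𝒢.total.Univ x} :
    letI := vertexHypLetters hs
    (totalLabelling hs).step x ((𝒢.vertexMap v).univMap a q u) s z →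
    ∃ u', z = (𝒢.vertexMap v).univMap a q u' ∧
      ((totalLabelling hs).comap _ (vertexMap_isLinkEmbedding v)).step a u s u' := by
  rintro ⟨e, he, hl⟩
  obtain ⟨w, d, hd, rfl⟩ := totalLab_eq_some hl
  have h1 : (𝒢.vertexMap w).onVertex ((𝒢.vertexSpace w).src d) = (𝒢.vertexMap v).onVertex u.1 := by
    rw [← CubicalMap.map_src, ← hd]; exact e.2.1
  obtain ⟨rfl, h2⟩ := vertexMap_inj h1
  let d' : u.1 ⟶ (𝒢.vertexSpace w).tgt d := ⟨d, eq_of_heq h2, rfl⟩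
  refine ⟨⟨_, u.2 ≫ arr d'⟩, ?_, d', rfl, rfl⟩
  rw [CubicalMap.univMap_arr]
  rw [← Univ.extend_eq_of_hom he, Univ.extend_eq]
  exact Univ.extend_congr rfl _ _ hd

theorem exists_lift_walk (hs : ∀ v, (𝒢.vertexSpace v).IsSpecial) {v : 𝒢.V}
    {a : (𝒢.vertexSpace v).Vertex} {x : 𝒢.total.Vertex}
    {q : 𝒢.total.pt x ⟶ 𝒢.total.pt ((𝒢.vertexMap v).onVertex a)} {u : (𝒢.vertexSpace v).Univ a}
    {w : List 𝒢.VertexHyp} {z : 𝒢.total.Univ x} :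
    letI := vertexHypLetters hs
    Walk ((totalLabelling hs).step x) ((𝒢.vertexMap v).univMap a q u) w z →
    ∃ u', z = (𝒢.vertexMap v).univMap a q u' ∧
      Walk (((totalLabelling hs).comap _ (vertexMap_isLinkEmbedding v)).step a) u w u' := by
  intro h
  induction w generalizing u with
  | nil => cases h; exact ⟨u, rfl, rfl⟩
  | cons s w ih =>
    obtain ⟨y, hy, h⟩ := h
    obtain ⟨u₁, rfl, h₁⟩ := exists_lift_step hs hy
    obtain ⟨u', rfl, h'⟩ := ih h
    exact ⟨u', rfl, u₁, h₁, h'⟩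

theorem univ_cases {x : 𝒢.total.Vertex} (z : 𝒢.total.Univ x) :
    ∃ (v : 𝒢.V) (a : (𝒢.vertexSpace v).Vertex)
      (q : 𝒢.total.pt x ⟶ 𝒢.total.pt ((𝒢.vertexMap v).onVertex a)), z = ⟨_, q⟩ := by
  obtain ⟨y, q⟩ := z
  obtain ⟨v, a, rfl⟩ := vertex_cases y
  exact ⟨v, a, q, rfl⟩

theorem univMap_base {A X : CubeComplex.{u}} (f : CubicalMap A X) {a : A.Vertex} {x : X.Vertex}
    (q : X.pt x ⟶ X.pt (f.onVertex a)) : f.univMap a q (Univ.base A a) = ⟨_, q⟩ :=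
  Univ.mk_congr (by
    change q ≫ f.mapHom (𝟙 _) = q
    rw [CubicalMap.mapHom_id, Category.comp_id])

/-- Two walks with common end points lift to the universal cover of one vertex space. Since this
maps injectively, the lifts have common end points too, and uniqueness of labels holds for the
special vertex space. -/
theorem total_specialGraph (hs : ∀ v, (𝒢.vertexSpace v).IsSpecial) (x : 𝒢.total.Vertex) :
    letI := vertexHypLetters hs
    SpecialGraph ((totalLabelling hs).step x) :=
  letI := vertexHypLetters hs
  { toPreSpecialGraph := (totalLabelling hs).preSpecialGraph x
    label_unique := by
      intro z z' w w' hw hw' hr hr'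
      obtain ⟨v, a, q, rfl⟩ := univ_cases z
      rw [← univMap_base] at hw hw'
      obtain ⟨u, rfl, h⟩ := exists_lift_walk hs hw
      obtain ⟨u', hu, h'⟩ := exists_lift_walk hs hw'
      obtain rfl := univMap_vertexMap_injective hs v a q hu
      exact (((totalLabelling hs).comap _ (vertexMap_isLinkEmbedding v)).specialGraph
        (vertexMap_comap_isTotal hs v) a).label_unique h h' hr hr' }

end GraphOfCubeComplexes

theorem Reach.trans {Z S Λ : Type*} {step : Z → S → Z → Prop} {up : Λ → Z → Z → Prop}
    [Letters S] {k l : ℕ} {a b c : Z} (h : Reach step up k a b) (h' : Reach step up l b c) :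
    ∃ m, Reach step up m a c := by
  induction h with
  | joined h => exact ⟨_, h'.of_joined h⟩
  | cross h₁ h₂ _ ih =>
    obtain ⟨m, hm⟩ := ih h'
    exact ⟨_, .cross h₁ h₂ hm⟩

/-! ### Walls of the total space -/

namespace GraphOfCubeComplexes

open CubeComplex

variable {𝒢 : GraphOfCubeComplexes.{u}}

/-- The labelled edges of the universal cover of the total space. -/
@[reducible]
def totalStep (hs : ∀ v, (𝒢.vertexSpace v).IsSpecial) (x : 𝒢.total.Vertex) :
    𝒢.total.Univ x → 𝒢.VertexHyp → 𝒢.total.Univ x → Prop :=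
  letI := vertexHypLetters hs
  (totalLabelling hs).step x

/-- The edges of the universal cover of the total space that cross a thickened edge space. -/
def totalUp (x : 𝒢.total.Vertex) (l : Σ e, (𝒢.edgeSpace e).Vertex) (y y' : 𝒢.total.Univ x) : Prop :=
  ∃ r : 𝒢.total.pt x ⟶ 𝒢.total.pt ((𝒢.sideMap false l.1).onVertex l.2),
    y = ⟨_, r⟩ ∧ y' = ⟨_, r ≫ arr (𝒢.crossArr l.1 l.2)⟩

theorem totalUp_smul {x : 𝒢.total.Vertex} (g : 𝒢.total.Pi1 x) (l : Σ e, (𝒢.edgeSpace e).Vertex)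
    (y y' : 𝒢.total.Univ x) (h : totalUp x l y y') : totalUp x l (g • y) (g • y') := by
  obtain ⟨r, rfl, rfl⟩ := h
  exact ⟨g.inv ≫ r, rfl, Univ.mk_congr (Category.assoc _ _ _).symm⟩

theorem stepAdj_univMap_sideMap (hs : ∀ v, (𝒢.vertexSpace v).IsSpecial) {x : 𝒢.total.Vertex}
    {s : Bool} {e : 𝒢.E} {b : (𝒢.edgeSpace e).Vertex}
    (q : 𝒢.total.pt x ⟶ 𝒢.total.pt ((𝒢.sideMap s e).onVertex b)) {u u' : (𝒢.edgeSpace e).Univ b} :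
    StepAdj (totalStep hs x) ((𝒢.sideMap s e).univMap b q u) ((𝒢.sideMap s e).univMap b q u') ↔
      UnivAdj u u' := by
  let _ := vertexHypLetters hs
  constructor
  · rintro ⟨t, ht⟩
    obtain ⟨d, hd, -⟩ := (totalLabelling hs).univMap_reflects_step (sideMap_isLinkEmbedding s e)
      (sideMap_comap_isTotal hs s e) (total_specialGraph hs x) b q ht
    exact ⟨d, hd⟩
  · rintro ⟨d, hd⟩
    obtain ⟨t, ht⟩ := sideMap_comap_isTotal hs s e d.1
    exact ⟨t, (totalLabelling hs).comap_step q u t u' ⟨d, hd, ht⟩⟩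

theorem univMap_sideMap_injective (hs : ∀ v, (𝒢.vertexSpace v).IsSpecial) {x : 𝒢.total.Vertex}
    {s : Bool} {e : 𝒢.E} {b : (𝒢.edgeSpace e).Vertex}
    (q : 𝒢.total.pt x ⟶ 𝒢.total.pt ((𝒢.sideMap s e).onVertex b)) :
    Function.Injective ((𝒢.sideMap s e).univMap b q) := by
  let _ := vertexHypLetters hs
  exact (totalLabelling hs).univMap_injective (sideMap_isLinkEmbedding s e)
    (sideMap_comap_isTotal hs s e) (total_specialGraph hs x) b q

variable (𝒢) in
/-- The subgroup `N` meets the stabilizers of the edge spaces in the universal cover in such a way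
that the quotients of edge spaces by `N` embed. -/
def EdgesEmbed {x : 𝒢.total.Vertex} (N : Subgroup (𝒢.total.Pi1 x)) : Prop :=
  ∀ s e b (q : 𝒢.total.pt x ⟶ 𝒢.total.pt ((𝒢.sideMap s e).onVertex b)), ∀ n ∈ N,
    ∀ z ∈ (𝒢.sideMap s e).orb b q, n • z ∈ (𝒢.sideMap s e).orb b q → n ∈ (𝒢.sideMap s e).stab b q

theorem goodConvex_orb_sideMap (hs : ∀ v, (𝒢.vertexSpace v).IsSpecial) {x : 𝒢.total.Vertex}
    {N : Subgroup (𝒢.total.Pi1 x)} (hN : 𝒢.EdgesEmbed N) {s : Bool} {e : 𝒢.E}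
    {b : (𝒢.edgeSpace e).Vertex} (q : 𝒢.total.pt x ⟶ 𝒢.total.pt ((𝒢.sideMap s e).onVertex b)) :
    GoodConvex (totalStep hs x) N ((𝒢.sideMap s e).orb b q) ((𝒢.sideMap s e).stab b q) where
  toConvexIn := by
    let _ := vertexHypLetters hs
    exact (totalLabelling hs).orb_convex (sideMap_isLinkEmbedding s e)
      (sideMap_comap_isTotal hs s e) (total_specialGraph hs x) b q
  nonempty := ⟨_, (𝒢.sideMap s e).mem_orb_self q⟩
  smul_mem c hc z hz := (𝒢.sideMap s e).smul_mem_orb hc hz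
  emb := hN s e b q

section Wall

variable {x : 𝒢.total.Vertex} {e : 𝒢.E} {b : (𝒢.edgeSpace e).Vertex}
  (r : 𝒢.total.pt x ⟶ 𝒢.total.pt ((𝒢.sideMap false e).onVertex b))

/-- The path that ends on the given side of an edge space. -/
def sideHom : ∀ s, 𝒢.total.pt x ⟶ 𝒢.total.pt ((𝒢.sideMap s e).onVertex b)
  | false => r
  | true => r ≫ arr (𝒢.crossArr e b)

/-- The map from the universal cover of an edge space to one of the sides. -/
def sideUniv (s : Bool) (u : (𝒢.edgeSpace e).Univ b) : 𝒢.total.Univ x :=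
  (𝒢.sideMap s e).univMap b (sideHom r s) u

theorem sideUniv_true (u : (𝒢.edgeSpace e).Univ b) :
    sideUniv r true u = ⟨_, (sideUniv r false u).2 ≫ arr (𝒢.crossArr e u.1)⟩ := by
  refine Univ.mk_congr ?_
  change (r ≫ arr (𝒢.crossArr e b)) ≫ (𝒢.sideMap true e).mapHom u.2 =
    (r ≫ (𝒢.sideMap false e).mapHom u.2) ≫ arr (𝒢.crossArr e u.1)
  rw [Category.assoc, Category.assoc, crossArr_natural]

theorem sideUniv_extend_cross (s : Bool) (u : (𝒢.edgeSpace e).Univ b) :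
    (sideUniv r s u).extend (𝒢.crossEdge e s u.1) (src_crossEdge e s u.1) = sideUniv r (!s) u := by
  have h : (sideUniv r false u).extend (𝒢.crossEdge e false u.1) (src_crossEdge e false u.1) =
      sideUniv r true u := by
    rw [sideUniv_true]
    exact Univ.extend_eq (sideUniv r false u) (𝒢.crossArr e u.1)
  cases s
  · exact h
  · have h' := Univ.extend_rev (sideUniv r false u) _ (src_crossEdge e false u.1)
    simp only [h, rev_crossEdge] at h'
    exact h'

theorem sideUniv_extend_side (s : Bool) (u : (𝒢.edgeSpace e).Univ b)
    (d : (𝒢.edgeSpace e).cube 1) (hd : (𝒢.edgeSpace e).src d = u.1)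
    (h : 𝒢.total.src ((𝒢.sideMap s e).toFun d) = (sideUniv r s u).1) :
    (sideUniv r s u).extend ((𝒢.sideMap s e).toFun d) h = sideUniv r s (u.extend d hd) := by
  let d' : u.1 ⟶ (𝒢.edgeSpace e).tgt d := ⟨d, hd, rfl⟩
  exact (Univ.extend_eq (sideUniv r s u) ((𝒢.sideMap s e).mapArr d')).trans
    (CubicalMap.univMap_arr (p := 𝒢.sideMap s e) (sideHom r s) u.2 d').symm

/-- The edge `c` at `z` crosses the given edge space. -/
def Crosses (z : 𝒢.total.Univ x) (c : 𝒢.total.cube 1) : Prop :=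
  ∃ s u, z = sideUniv r s u ∧ c = 𝒢.crossEdge e s u.1

theorem not_crosses_vert (z : 𝒢.total.Univ x) (v : 𝒢.V) (c : (𝒢.vertexSpace v).cube 1) :
    ¬ Crosses r z ((𝒢.vertexMap v).toFun c) := by
  rintro ⟨s, u, -, h⟩
  exact vertexMap_ne_crossEdge h

/-- Opposite crossing edges of a square over an edge of an edge space pass through the same
translate, which is why crossings can be counted modulo two. -/
theorem crosses_extend_side (z : 𝒢.total.Univ x) (e' : 𝒢.E) (s : Bool)
    (d : (𝒢.edgeSpace e').cube 1) (h : 𝒢.total.src ((𝒢.sideMap s e').toFun d) = z.1) :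
    Crosses r z (𝒢.crossEdge e' s ((𝒢.edgeSpace e').src d)) ↔
      Crosses r (z.extend _ h) (𝒢.crossEdge e' s ((𝒢.edgeSpace e').tgt d)) := by
  have key : ∀ (z : 𝒢.total.Univ x) (d : (𝒢.edgeSpace e').cube 1)
      (h : 𝒢.total.src ((𝒢.sideMap s e').toFun d) = z.1),
      Crosses r z (𝒢.crossEdge e' s ((𝒢.edgeSpace e').src d)) →
      Crosses r (z.extend _ h) (𝒢.crossEdge e' s ((𝒢.edgeSpace e').tgt d)) := by
    rintro z d h ⟨s', u, rfl, hc⟩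
    obtain ⟨rfl, rfl, hd⟩ := crossEdge_inj hc
    have hd := eq_of_heq hd
    exact ⟨s, u.extend d hd, sideUniv_extend_side r s u d hd h, rfl⟩
  refine ⟨key z d h, fun hc => ?_⟩
  have h' : 𝒢.total.src ((𝒢.sideMap s e').toFun ((𝒢.edgeSpace e').rev d)) = (z.extend _ h).1 := by
    rw [CubicalMap.map_rev, src_rev]; rfl
  have := key (z.extend _ h) ((𝒢.edgeSpace e').rev d) h' (by rwa [src_rev])
  simp only [CubicalMap.map_rev, tgt_rev, Univ.extend_rev] at this
  exact this

/-- The side of a point is the parity of the number of times a path from the base point crosses this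
copy of the edge space. In each square, opposite edges either both cross it or both do not. -/
theorem exists_side : ∃ σ : 𝒢.total.Univ x → Bool, ∀ z c (h : 𝒢.total.src c = z.1),
    σ z ≠ σ (z.extend c h) ↔ Crosses r z c := by
  refine exists_parity _ ?_ ?_
  · rintro z c h ⟨s, u, rfl, rfl⟩
    exact ⟨!s, u, sideUniv_extend_cross r s u, rev_crossEdge e s u.1⟩
  · intro z c h
    obtain ⟨v, d, rfl⟩ | ⟨e', j, s, d, rfl⟩ := square_cases c
    · simp only [← CubicalMap.map_cornerEdge, ← CubicalMap.map_oppositeEdge, not_crosses_vert]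
    · have f1 := face_axis_crossSquare_self e' j s false d
      have f2 := face_axis_crossSquare_self e' j s true d
      have hv : ∀ z' t, ¬ Crosses r z' ((𝒢.sideMap t e').toFun d) := fun z' t =>
        not_crosses_vert r z' _ _
      fin_cases j
      · have f3 := face_axis_crossSquare_other e' (show (0 : Fin 2) ≠ 1 by decide) s false d
        have f4 := face_axis_crossSquare_other e' (show (0 : Fin 2) ≠ 1 by decide) s true d
        rw [Bool.false_xor] at f3
        have h3 : 𝒢.total.src ((𝒢.sideMap s e').toFun d) = z.1 := by
          rw [← f3]; exact (𝒢.total.src_cornerEdge _ 1).trans h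
        have hk := crosses_extend_side r z e' s d h3
        simp only [Fin.zero_eta, Fin.isValue, cornerEdge, oppositeEdge] at f1 f2 ⊢
        simp only [f1, f2, f3, f4, hv, iff_false, false_iff]
        exact not_congr hk
      · have f3 := face_axis_crossSquare_other e' (show (1 : Fin 2) ≠ 0 by decide) s false d
        have f4 := face_axis_crossSquare_other e' (show (1 : Fin 2) ≠ 0 by decide) s true d
        rw [Bool.false_xor] at f3
        have h3 : 𝒢.total.src ((𝒢.sideMap s e').toFun d) = z.1 := by
          rw [← f3]; exact (𝒢.total.src_cornerEdge _ 0).trans h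
        have hk := crosses_extend_side r z e' s d h3
        simp only [Fin.mk_one, Fin.isValue, cornerEdge, oppositeEdge] at f1 f2 ⊢
        simp only [f1, f2, f3, f4, hv, iff_false, false_iff]
        exact not_congr hk.symm

/-- The crossings of an edge space in the universal cover. -/
def wallRel (l : Σ e, (𝒢.edgeSpace e).Vertex) (y y' : 𝒢.total.Univ x) : Prop :=
  ∃ u : (𝒢.edgeSpace e).Univ b, l = ⟨e, u.1⟩ ∧ y = sideUniv r false u ∧ y' = sideUniv r true u

theorem mem_stab_true_iff {g : 𝒢.total.Pi1 x} {h : (𝒢.edgeSpace e).pt b ⟶ (𝒢.edgeSpace e).pt b} :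
    g.inv ≫ sideHom r true = sideHom r true ≫ (𝒢.sideMap true e).mapHom h ↔
      g.inv ≫ sideHom r false = sideHom r false ≫ (𝒢.sideMap false e).mapHom h := by
  change g.inv ≫ r ≫ arr (𝒢.crossArr e b) = (r ≫ arr (𝒢.crossArr e b)) ≫ _ ↔ g.inv ≫ r = r ≫ _
  rw [Category.assoc, ← crossArr_natural, ← Category.assoc, ← Category.assoc, cancel_mono]

theorem stab_true_eq : (𝒢.sideMap true e).stab b (sideHom r true) =
    (𝒢.sideMap false e).stab b (sideHom r false) := by
  ext g
  exact exists_congr fun h => mem_stab_true_iff r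

/-- The wall is a translate of the thickened universal cover of the edge space. Both of its sides
are images of that cover and have the same stabilizer; `EdgesEmbed` makes them good. -/
theorem wallRel_isWall (hs : ∀ v, (𝒢.vertexSpace v).IsSpecial) {N : Subgroup (𝒢.total.Pi1 x)}
    (hN : 𝒢.EdgesEmbed N) : IsWall (totalStep hs x) (totalUp x) N
      ((𝒢.sideMap false e).stab b (sideHom r false)) (wallRel r) where
  matching :=
    { dom := by
        convert goodConvex_orb_sideMap hs hN (sideHom r false) using 1
        ext y
        exact ⟨fun ⟨_, _, u, _, h, _⟩ => ⟨u, h.symm⟩, fun ⟨u, h⟩ => ⟨_, _, u, rfl, h.symm, rfl⟩⟩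
      cod := by
        rw [← stab_true_eq]
        convert goodConvex_orb_sideMap hs hN (sideHom r true) using 1
        ext y
        exact ⟨fun ⟨_, _, u, _, _, h⟩ => ⟨u, h.symm⟩, fun ⟨u, h⟩ => ⟨_, _, u, rfl, rfl, h.symm⟩⟩
      right_unique := by
        rintro y _ _ ⟨_, u, -, rfl, rfl⟩ ⟨_, u', -, h, rfl⟩
        rw [univMap_sideMap_injective hs _ h]
      left_unique := by
        rintro y _ _ ⟨_, u, -, rfl, rfl⟩ ⟨_, u', -, rfl, h⟩
        rw [univMap_sideMap_injective hs _ h]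
      adj := by
        rintro _ _ _ _ ⟨_, u, -, rfl, rfl⟩ ⟨_, u', -, rfl, rfl⟩
        exact (stepAdj_univMap_sideMap hs _).trans (stepAdj_univMap_sideMap hs _).symm
      smul := by
        rintro c _ _ ⟨h, hc⟩ ⟨_, u, rfl, rfl, rfl⟩
        exact ⟨_, ⟨u.1, h ≫ u.2⟩, rfl, CubicalMap.smul_univMap _ hc u,
          CubicalMap.smul_univMap _ ((mem_stab_true_iff r).2 hc) u⟩ }
  mem := by
    rintro l c _ _ ⟨⟨a, p⟩, rfl, rfl, rfl⟩ ⟨⟨a', p'⟩, h, h', -⟩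
    obtain rfl : a = a' := eq_of_heq (Sigma.mk.inj h).2
    exact CubicalMap.mem_stab_of_smul _ h'
  side := by
    obtain ⟨σ, hσ⟩ := exists_side r
    refine ⟨σ, ?_, ?_, ?_⟩
    · rintro z t z' ⟨d, hd, hl⟩
      obtain ⟨v, c, hc, -⟩ := totalLab_eq_some hl
      by_contra hne
      rw [← Univ.extend_eq_of_hom hd] at hne
      have := (hσ _ _ _).1 hne
      rw [hc] at this
      exact not_crosses_vert r _ _ _ this
    · rintro l _ _ ⟨u, -, rfl, rfl⟩
      have := (hσ (sideUniv r false u) _ (src_crossEdge e false u.1)).2 ⟨_, u, rfl, rfl⟩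
      rwa [sideUniv_extend_cross] at this
    · rintro ⟨e', b'⟩ _ _ ⟨q, rfl, rfl⟩ hne
      have h1 : (⟨_, q ≫ arr (𝒢.crossArr e' b')⟩ : 𝒢.total.Univ x) =
        Univ.extend ⟨_, q⟩ _ (src_crossEdge e' false b') :=
        (Univ.extend_eq (⟨_, q⟩ : 𝒢.total.Univ x) (𝒢.crossArr e' b')).symm
      rw [h1] at hne ⊢
      obtain ⟨s, u, hu, hc⟩ := (hσ _ _ _).1 hne
      obtain ⟨rfl, rfl, hb⟩ := crossEdge_inj hc
      obtain rfl := eq_of_heq hb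
      refine ⟨u, rfl, hu, ?_⟩
      refine Eq.trans ?_ (sideUniv_extend_cross r false u)
      congr 1

end Wall

/-! ### Finite stature of the vertex groups -/

theorem totalUp_extend {x : 𝒢.total.Vertex} {e : 𝒢.E} {b : (𝒢.edgeSpace e).Vertex}
    {z : 𝒢.total.Univ x} (h : 𝒢.total.src (𝒢.crossEdge e false b) = z.1) :
    totalUp x ⟨e, b⟩ z (z.extend _ h) := by
  obtain ⟨y, g⟩ := z
  obtain rfl : (𝒢.sideMap false e).onVertex b = y := (src_crossEdge e false b).symm.trans h
  exact ⟨g, rfl, Univ.extend_eq (⟨_, g⟩ : 𝒢.total.Univ x) (𝒢.crossArr e b)⟩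

theorem exists_reach (hs : ∀ v, (𝒢.vertexSpace v).IsSpecial) {x : 𝒢.total.Vertex}
    (z z' : 𝒢.total.Univ x) : ∃ k, Reach (totalStep hs x) (totalUp x) k z z' := by
  let _ := vertexHypLetters hs
  obtain ⟨y', g'⟩ := z'
  suffices h : ∀ (y' : 𝒢.total.Vertex) (p : 𝒢.total.pt z.1 ⟶ 𝒢.total.pt y'),
      ∃ k, Reach (totalStep hs x) (totalUp x) k z ⟨y', z.2 ≫ p⟩ by
    have := h y' (inv z.2 ≫ g')
    rwa [IsIso.hom_inv_id_assoc] at this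
  intro y' p
  induction p using hom_induction with
  | nil => exact ⟨0, .joined ⟨[], by rw [Category.comp_id]; rfl⟩⟩
  | cons y y' p d ih =>
    obtain ⟨k, hk⟩ := ih
    suffices h : ∃ l, Reach (totalStep hs x) (totalUp x) l ⟨y, z.2 ≫ p⟩ ⟨y', z.2 ≫ p ≫ arr d⟩ by
      obtain ⟨l, hl⟩ := h
      exact Reach.trans hk hl
    rw [← Category.assoc]
    obtain ⟨d, rfl, rfl⟩ := d
    generalize z.2 ≫ p = q
    obtain ⟨v, c, rfl⟩ | ⟨e, s, b, rfl⟩ := edge_cases d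
    · exact ⟨0, .joined ⟨_, .single ⟨_, rfl, rfl⟩⟩⟩
    · refine ⟨1, .cross (l := ⟨e, b⟩) (.refl _) ?_ (.joined (.refl _))⟩
      have key := fun z h => totalUp_extend (x := x) (e := e) (b := b) (z := z) h
      cases s
      · exact .inl (key ⟨_, q⟩ rfl)
      · refine .inr ?_
        have h₁ := Univ.extend_rev (⟨_, q⟩ : 𝒢.total.Univ x) (𝒢.crossEdge e true b) rfl
        have h₂ := key (Univ.extend ⟨_, q⟩ (𝒢.crossEdge e true b) rfl)
          ((src_crossEdge e false b).trans (tgt_crossEdge e true b).symm)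
        simp only [rev_crossEdge, Bool.not_true] at h₁
        rw [h₁] at h₂
        exact h₂

/-- Any `N` will do, because the vertex spaces themselves embed in the total space. -/
theorem goodConvex_orb_vertexMap (hs : ∀ v, (𝒢.vertexSpace v).IsSpecial) {x : 𝒢.total.Vertex}
    (N : Subgroup (𝒢.total.Pi1 x)) {v : 𝒢.V} {a : (𝒢.vertexSpace v).Vertex}
    (q : 𝒢.total.pt x ⟶ 𝒢.total.pt ((𝒢.vertexMap v).onVertex a)) :
    GoodConvex (totalStep hs x) N ((𝒢.vertexMap v).orb a q) ((𝒢.vertexMap v).stab a q) where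
  toConvexIn := by
    let _ := vertexHypLetters hs
    exact (totalLabelling hs).orb_convex (vertexMap_isLinkEmbedding v)
      (vertexMap_comap_isTotal hs v) (total_specialGraph hs x) a q
  nonempty := ⟨_, (𝒢.vertexMap v).mem_orb_self q⟩
  smul_mem c hc z hz := (𝒢.vertexMap v).smul_mem_orb hc hz
  emb := by
    rintro n - _ ⟨⟨b, p⟩, rfl⟩ ⟨⟨b', p'⟩, h⟩
    obtain rfl : b' = b := eq_of_heq (vertexMap_inj (congrArg Univ.vtx h)).2
    exact (𝒢.vertexMap v).mem_stab_of_smul h.symm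

/-- Identifies the stabilizers of components with the conjugates of vertex groups. -/
theorem joinedStab_eq_stab (hs : ∀ v, (𝒢.vertexSpace v).IsSpecial) {x : 𝒢.total.Vertex} {v : 𝒢.V}
    {a : (𝒢.vertexSpace v).Vertex}
    (q : 𝒢.total.pt x ⟶ 𝒢.total.pt ((𝒢.vertexMap v).onVertex a)) :
    letI := vertexHypLetters hs
    joinedStab (total_specialGraph hs x)
      (fun g _ _ _ h => (totalLabelling hs).step_smul g h) ⟨_, q⟩ = (𝒢.vertexMap v).stab a q := by
  let _ := vertexHypLetters hs
  ext g
  constructor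
  · rintro ⟨w, hw⟩
    rw [← univMap_base] at hw
    obtain ⟨⟨b, p⟩, h, -⟩ := exists_lift_walk hs hw
    obtain rfl : a = b := eq_of_heq (vertexMap_inj (congrArg Univ.vtx h)).2
    exact (𝒢.vertexMap v).mem_stab_of_smul h
  · intro hg
    have hz := (𝒢.vertexMap v).mem_orb_self q
    have hgood := goodConvex_orb_vertexMap hs ⊥ q
    exact hgood.joined hz (hgood.smul_mem g hg _ hz)

theorem finite_vertexHyp (hc : 𝒢.total.IsCompact) : Finite 𝒢.VertexHyp := by
  have := hc.finite_cube 1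
  have : Finite (Σ v, (𝒢.vertexSpace v).cube 1) :=
    Finite.of_injective (fun c => (𝒢.vertexMap c.1).toFun c.2) fun c c' h =>
      Sigma.ext (vertexMap_inj h).1 (vertexMap_inj h).2
  refine Finite.of_surjective (fun c : Σ v, (𝒢.vertexSpace v).cube 1 =>
    (⟨c.1, Quot.mk _ c.2⟩ : 𝒢.VertexHyp)) ?_
  rintro ⟨v, ⟨c⟩⟩
  exact ⟨⟨v, c⟩, rfl⟩

end GraphOfCubeComplexes

theorem CubeComplex.exists_finite_representatives {X : CubeComplex.{u}} (hX : X.IsCompact)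
    {x : X.Vertex} (N : Subgroup (X.Pi1 x)) [N.FiniteIndex] :
    ∃ R : Set (X.Univ x), R.Finite ∧ ∀ z, ∃ n ∈ N, n • z ∈ R := by
  have := hX.finite_vertex
  have : Nonempty (X.Univ x) := ⟨Univ.base X x⟩
  choose! f hf using fun (y : X.Vertex) (h : ∃ z : X.Univ x, z.1 = y) => h
  choose g hg using fun z : X.Univ x => exists_smul_eq (f z.1) z (hf _ ⟨z, rfl⟩)
  refine _root_.exists_finite_representatives (κ := X.Vertex × (X.Pi1 x ⧸ N))
    -- Finitely many vertices and cosets: with the inverse, equality of left cosets says that the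
    -- points are related by an element of `N` acting on the left.
    (fun z => (z.1, QuotientGroup.mk (g z)⁻¹)) fun z z' h => ?_
  simp only [Prod.mk.injEq, QuotientGroup.eq, inv_inv] at h
  refine ⟨_, N.inv_mem h.2, ?_⟩
  rw [mul_inv_rev, inv_inv, mul_smul, inv_smul_eq_iff.2 (hg z).symm, h.1, hg]

namespace GraphOfCubeComplexes

open CubeComplex

variable {𝒢 : GraphOfCubeComplexes.{u}}

/-- The common core of the two statements about graphs of cube complexes, which differ only in the
choice of `N`. -/
theorem hasFiniteStatureVertexGroups_of_edgesEmbed (hc : 𝒢.total.IsCompact)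
    (hs : ∀ v, (𝒢.vertexSpace v).IsSpecial)
    (hN : ∀ x, ∃ N : Subgroup (𝒢.total.Pi1 x), N.FiniteIndex ∧ 𝒢.EdgesEmbed N) :
    𝒢.HasFiniteStatureVertexGroups := by
  intro x y γ
  let _ := vertexHypLetters hs
  obtain ⟨N, hfin, hN⟩ := hN x
  have := finite_vertexHyp hc
  obtain ⟨Q, hQ, hQN⟩ := CubeComplex.exists_finite_representatives hc N
  simp only [CubicalMap.subgroup_eq_stab]
  refine HasFiniteStature.of_types fun l => ?_
  simp only [CubicalMap.stab_conjBy]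
  have hH := goodConvex_orb_vertexMap hs N (γ l).inv
  have h := exists_finite_types_of_walls (total_specialGraph hs x)
    (fun g _ _ _ h => (totalLabelling hs).step_smul g h) totalUp_smul
    (fun l y y' ⟨r, h, h'⟩ => ⟨_, _, wallRel_isWall r hs hN, Univ.base _ _, rfl,
      h.trans (univMap_base _ _).symm, h'.trans (univMap_base _ _).symm⟩)
    smul_free hQ hQN (exists_reach hs)
    (fun j : 𝒢.V × 𝒢.total.Pi1 x => ⟨_, j.2.inv ≫ (γ j.1).inv⟩) hH
  simp only [joinedStab_eq_stab hs] at h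
  exact h

theorem hasFiniteStatureVertexGroups_of_isEmbedding (hc : 𝒢.total.IsCompact)
    (hs : ∀ v, (𝒢.vertexSpace v).IsSpecial) (he : ∀ b e, (𝒢.attach b e).IsEmbedding) :
    𝒢.HasFiniteStatureVertexGroups := by
  -- Points of a translate of an edge space that lie over the same vertex of the total space already
  -- lie over the same vertex of the edge space, so no smaller subgroup is needed.
  refine hasFiniteStatureVertexGroups_of_edgesEmbed hc hs fun x => ⟨⊤, inferInstance, ?_⟩
  rintro s e b q n - _ ⟨⟨a, p⟩, rfl⟩ ⟨⟨a', p'⟩, h⟩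
  obtain rfl : a' = a := he s e 0 (eq_of_heq (vertexMap_inj (congrArg Univ.vtx h)).2)
  exact (𝒢.sideMap s e).mem_stab_of_smul h.symm

end GraphOfCubeComplexes

/-! ### Separable edge groups -/

theorem Subgroup.IsSeparable.map {G G' : Type u} [Group G] [Group G'] {H : Subgroup G}
    (hH : H.IsSeparable) (φ : G ≃* G') : (H.map φ.toMonoidHom).IsSeparable := by
  intro g hg
  obtain ⟨K, hK, hHK, hgK⟩ := hH (φ.symm g) fun h => hg ⟨_, h, φ.apply_symm_apply g⟩
  refine ⟨K.comap φ.symm.toMonoidHom, ⟨?_⟩, ?_, hgK⟩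
  · rw [K.index_comap_of_surjective φ.symm.surjective]
    exact hK.index_ne_zero
  rintro _ ⟨h, hh, rfl⟩
  change φ.symm (φ h) ∈ K
  rw [φ.symm_apply_apply]
  exact hHK hh

namespace CubicalMap

open CubeComplex

variable {A X : CubeComplex.{u}} (f : CubicalMap A X)

theorem smul_mem_orb_iff {a : A.Vertex} {x : X.Vertex} {q : X.pt x ⟶ X.pt (f.onVertex a)}
    (g : X.Pi1 x) (z : X.Univ x) : g • z ∈ f.orb a (g.inv ≫ q) ↔ z ∈ f.orb a q := by
  have h : ∀ u, f.univMap a (g.inv ≫ q) u = g • f.univMap a q u := fun u =>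
    Univ.mk_congr (Category.assoc _ _ _)
  constructor
  · rintro ⟨u, hu⟩
    rw [h] at hu
    exact ⟨u, smul_left_cancel g hu⟩
  · rintro ⟨u, rfl⟩
    exact ⟨u, h u⟩

theorem stab_isSeparable {a : A.Vertex} (h : (f.onPi1 a).range.IsSeparable) {x : X.Vertex}
    (q : X.pt x ⟶ X.pt (f.onVertex a)) : (f.stab a q).IsSeparable := by
  have h₁ := f.subgroup_eq_stab a (asIso q).symm
  rw [show (asIso q).symm.inv = q from rfl] at h₁
  rw [← h₁]
  exact h.map _

/-- A finite index subgroup that separates the points of an orbit with given projections. -/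
theorem exists_separating_subgroup {a : A.Vertex} {x : X.Vertex}
    {q : X.pt x ⟶ X.pt (f.onVertex a)} (h : (f.stab a q).IsSeparable) (z z' : X.Univ x) :
    ∃ K : Subgroup (X.Pi1 x), K.FiniteIndex ∧ f.stab a q ≤ K ∧
      ∀ g ∈ K, g • z = z' → g ∈ f.stab a q := by
  -- The action is free, so at most one element takes `z` to `z'`, and separating this one is
  -- enough.
  by_cases hg : ∃ g : X.Pi1 x, g • z = z' ∧ g ∉ f.stab a q
  · obtain ⟨g, hz, hg⟩ := hg
    obtain ⟨K, hK, hle, hgK⟩ := h g hg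
    refine ⟨K, hK, hle, fun g' hg' hz' => absurd ?_ hgK⟩
    have : g⁻¹ * g' = 1 := smul_free _ z (by rw [mul_smul, hz', ← hz, inv_smul_smul])
    rwa [← inv_mul_eq_one.1 this] at hg'
  · push Not at hg
    exact ⟨⊤, inferInstance, le_top, fun g _ => hg g⟩

end CubicalMap

namespace GraphOfCubeComplexes

open CubeComplex

variable {𝒢 : GraphOfCubeComplexes.{u}}

theorem finite_edgeSpace_vertex (hc : 𝒢.total.IsCompact) :
    Finite (Σ e, (𝒢.edgeSpace e).Vertex) := by
  have := hc.finite_cube 1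
  exact Finite.of_injective (fun c => 𝒢.crossEdge c.1 false c.2) fun c c' h =>
    Sigma.ext (crossEdge_inj h).1 (crossEdge_inj h).2.2

theorem hasFiniteStatureVertexGroups_of_separable (hconn : 𝒢.total.IsConnected)
    (hc : 𝒢.total.IsCompact) (hs : ∀ v, (𝒢.vertexSpace v).IsSpecial)
    (hsep : ∀ e, 𝒢.EdgeGroupSeparable e) : 𝒢.HasFiniteStatureVertexGroups := by
  refine hasFiniteStatureVertexGroups_of_edgesEmbed hc hs fun x => ?_
  have hfin := finite_edgeSpace_vertex hc
  let b₀ : ∀ e, (𝒢.edgeSpace e).Vertex := fun e => (𝒢.edgeSpace_connected e).1.some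
  let t : ∀ e b, (𝒢.edgeSpace e).pt (b₀ e) ⟶ (𝒢.edgeSpace e).pt b := fun e b =>
    ((𝒢.edgeSpace_connected e).nonempty_hom _ _).some
  let q₀ : ∀ e, 𝒢.total.pt x ⟶ 𝒢.total.pt ((𝒢.sideMap false e).onVertex (b₀ e)) := fun e =>
    (hconn.nonempty_hom _ _).some
  -- Separability is assumed for the initial end; the stabilizer at the other end of the thickened
  -- edge space is the same subgroup.
  have hK : ∀ s e, ((𝒢.sideMap s e).stab (b₀ e) (sideHom (q₀ e) s)).IsSeparable := by
    have h0 : ∀ e, ((𝒢.sideMap false e).stab (b₀ e) (sideHom (q₀ e) false)).IsSeparable :=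
      fun e => (𝒢.sideMap false e).stab_isSeparable (hsep e (b₀ e)) _
    rintro (_ | _) e
    · exact h0 e
    · rw [stab_true_eq]; exact h0 e
  -- One separating subgroup for each end and each pair of vertices of edge spaces, finitely many in
  -- all. Normal cores make their intersection normal, so that it serves all translates at once.
  let I := Bool × (Σ e, (𝒢.edgeSpace e).Vertex) × Σ e, (𝒢.edgeSpace e).Vertex
  have hex : ∀ i : I, ∃ K : Subgroup (𝒢.total.Pi1 x), K.FiniteIndex ∧
      (𝒢.sideMap i.1 i.2.1.1).stab _ (sideHom (q₀ i.2.1.1) i.1) ≤ K ∧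
      ∀ g ∈ K, g • sideUniv (q₀ i.2.1.1) i.1 ⟨_, t _ i.2.1.2⟩ =
        sideUniv (q₀ i.2.2.1) i.1 ⟨_, t _ i.2.2.2⟩ →
        g ∈ (𝒢.sideMap i.1 i.2.1.1).stab _ (sideHom (q₀ i.2.1.1) i.1) := fun i =>
    CubicalMap.exists_separating_subgroup _ (hK _ _) _ _
  choose K hKfin hKle hKsep using hex
  let N : Subgroup (𝒢.total.Pi1 x) := ⨅ i, (K i).normalCore
  have hNn : N.Normal := Subgroup.normal_iInf_normal fun i => inferInstance
  refine ⟨N, Subgroup.finiteIndex_iInf fun i => inferInstance, ?_⟩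
  have base : ∀ s e, ∀ n ∈ N, ∀ z ∈ (𝒢.sideMap s e).orb _ (sideHom (q₀ e) s),
      n • z ∈ (𝒢.sideMap s e).orb _ (sideHom (q₀ e) s) →
      n ∈ (𝒢.sideMap s e).stab _ (sideHom (q₀ e) s) := by
    intro s e n hn z hz hnz
    have hrep : ∀ z ∈ (𝒢.sideMap s e).orb _ (sideHom (q₀ e) s), ∃ b,
        ∃ k ∈ (𝒢.sideMap s e).stab _ (sideHom (q₀ e) s),
          k • sideUniv (q₀ e) s ⟨b, t e b⟩ = z := by
      rintro _ ⟨⟨b, p⟩, rfl⟩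
      obtain ⟨k, hk⟩ := exists_smul_eq (sideUniv (q₀ e) s ⟨b, t e b⟩)
        (sideUniv (q₀ e) s ⟨b, p⟩) rfl
      exact ⟨b, k, (𝒢.sideMap s e).mem_stab_of_smul hk, hk⟩
    -- Up to the stabilizer both points are chosen representatives. The element `k₂⁻¹ * (n * k₁)`
    -- takes one representative to the other and lies in the separating subgroup, which contains the
    -- stabilizer.
    obtain ⟨b₁, k₁, hk₁, rfl⟩ := hrep z hz
    obtain ⟨b₂, k₂, hk₂, h₂⟩ := hrep _ hnz
    have hn' := Subgroup.normalCore_le _ (Subgroup.mem_iInf.1 hn (s, ⟨e, b₁⟩, ⟨e, b₂⟩))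
    have hle := hKle (s, ⟨e, b₁⟩, ⟨e, b₂⟩)
    have := hKsep (s, ⟨e, b₁⟩, ⟨e, b₂⟩) (k₂⁻¹ * (n * k₁))
      (mul_mem (inv_mem (hle hk₂)) (mul_mem hn' (hle hk₁)))
      (by rw [mul_smul, mul_smul, ← h₂, inv_smul_smul])
    have h3 := mul_mem (mul_mem hk₂ this) (inv_mem hk₁)
    rwa [mul_inv_cancel_left, mul_inv_cancel_right] at h3
  intro s e b q n hn z hz hnz
  -- Any other copy of the edge space is the translate by `g` of the chosen one, and `N` is normal.
  let q₁ := sideHom (q₀ e) s ≫ (𝒢.sideMap s e).mapHom (t e b)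
  let g : 𝒢.total.Pi1 x := loop (q ≫ inv q₁)
  have hq : q = g.inv ≫ q₁ := by
    change q = (q ≫ inv q₁) ≫ q₁
    simp
  rw [hq] at hz hnz ⊢
  rw [← smul_inv_smul g z, CubicalMap.smul_mem_orb_iff, CubicalMap.orb_comp] at hz
  rw [← smul_inv_smul g (n • z), CubicalMap.smul_mem_orb_iff, CubicalMap.orb_comp] at hnz
  rw [← CubicalMap.stab_conjBy, CubicalMap.stab_comp, Subgroup.mem_conjBy]
  refine base s e _ ?_ _ hz ?_
  · simpa using hNn.conj_mem n hn g⁻¹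
  · rwa [mul_smul, smul_inv_smul, mul_smul]

end GraphOfCubeComplexes

/-! ### The three statements together -/

theorem mainTheorem6 :
    (∀ (X : CubeComplex.{u}) (n : ℕ) (A : Fin n → CubeComplex.{u})
      (f : ∀ i, CubicalMap (A i) X),
      X.IsConnected → X.IsCompact → X.IsNonpositivelyCurved → X.IsVirtuallySpecial →
      (∀ i, (A i).IsConnected) → (∀ i, (A i).IsCompact) → (∀ i, (A i).IsNonpositivelyCurved) →
      (∀ i, (f i).IsLocalIsometry) →
      ∀ (x : X.Vertex) (a : ∀ i, (A i).Vertex) (γ : ∀ i, X.PathClass ((f i).onVertex (a i)) x),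
        HasFiniteStature fun i => (f i).subgroup (a i) (γ i)) ∧
    (∀ 𝒢 : GraphOfCubeComplexes.{u},
      𝒢.total.IsConnected → 𝒢.total.IsCompact → (∀ v, (𝒢.vertexSpace v).IsSpecial) →
      (∀ b e, (𝒢.attach b e).IsEmbedding) →
      𝒢.HasFiniteStatureVertexGroups) ∧
    (∀ 𝒢 : GraphOfCubeComplexes.{u},
      𝒢.total.IsConnected → 𝒢.total.IsCompact → (∀ v, (𝒢.vertexSpace v).IsSpecial) →
      (∀ e, 𝒢.EdgeGroupSeparable e) →
      𝒢.HasFiniteStatureVertexGroups) := by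
  refine ⟨?_, ?_, ?_⟩
  · intro X n A f _ hX hX' hs _ hA _ hf x a γ
    exact hasFiniteStature_of_isVirtuallySpecial hX hX' hs f hA hf x a γ
  · intro 𝒢 _ hc hs he
    exact GraphOfCubeComplexes.hasFiniteStatureVertexGroups_of_isEmbedding hc hs he
  · intro 𝒢 hconn hc hs hsep
    exact GraphOfCubeComplexes.hasFiniteStatureVertexGroups_of_separable hconn hc hs hsep
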